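/- Let $N\geq 1$ be an integer and $\omega=e^{2\pi i/N}$; all indices $k,l,\dots$ run over $\mathbb Z/N$. C*-algebras need not be unital, and $M_N(A)$ denotes the $N\times N$-matrices over a C*-algebra $A$. **The algebras.** * A finite quantum space is a finite dimensional C*-algebra $B$ with a faithful state $\psi$ such that $m m^*=\delta^2\,\mathrm{id}$ for some $\delta>0$, where $m:B\otimes B\to B$ is the multiplication and $m^*$ its adjoint with respect to $\langle x,y\rangle=\psi(x^*y)$. A directed quantum graph $\mathcal G=(B,\psi,A)$ is a finite quantum space with a linear map $A:B\to B$ such that $m(A\otimes A)m^*=\delta^2A$. A quantum Cuntz–Krieger $\mathcal G$-family in a C*-algebra $D$ is a linear map $s:B\to D$ with $\mu(\mathrm{id}\otimes\mu)(s\otimes s^*\otimes s)(\mathrm{id}\otimes m^*)m^*=s$ and $\mu(s^*\otimes s)m^*=\mu(s\otimes s^*)m^*A$, where $\mu$ is the multiplication of $D$ and $s^*(b)=s(b^*)^*$. The quantum Cuntz–Krieger algebra $\mathbb F\mathcal O(\mathcal G)$ is the universal C*-algebra generated by a quantum Cuntz–Krieger $\mathcal G$-family $S$. * $K(M_N(\mathbb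 C),\mathrm{tr})$ is the complete quantum graph on $M_N(\mathbb C)$ with normalized trace $\mathrm{tr}$ ($\delta=N$), given by $A(b)=\delta^2\,\mathrm{tr}(b)1$; $TM_N$ is the trivial quantum graph on $(M_N(\mathbb C),\mathrm{tr})$, given by $A=\mathrm{id}$. In both cases write $S_{kl}=S(N e_{kl})$ for the standard generators of $\mathbb F\mathcal O$. * $\mathcal O_{N^2}$ is the Cuntz algebra, the universal unital C*-algebra generated by isometries $S_{kl}$ with $\sum_{k,l}S_{kl}S_{kl}^*=1$ (for $N=1$ this is $C(S^1)$). $*_{N^2}C(S^1)$ is the non-unital free product of $N^2$ copies of $C(S^1)$, indexed by pairs $(k,l)$, with $S_{kl}$ the canonical unitary generator of the copy with index $(k,l)$. **The actions.** On $\mathbb F\mathcal O(K(M_N(\mathbb C),\mathrm{tr}))$ and on $\mathbb F\mathcal O(TM_N)$ let $\alpha_1,\alpha_2$ be the commuting actions of $\mathbb Z_N=\mathbb Z/N$ whose generators act by $$\alpha_1(S_{kl})=\omega^{k-l}S_{kl},\qquad \alpha_2(S_{kl})=S_{k-1,l-1}$$ (these are induced by conjugation of $M_N(\mathbb C)$ by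 the generalized Pauli matrices $X$ and $Z^*$, where $X|j\rangle=\omega^j|j\rangle$, $Z|j\rangle=|j+1\rangle$). On $\mathcal O_{N^2}$ and on $*_{N^2}C(S^1)$ let $\beta_1,\beta_2$ be the commuting actions of $\mathbb Z_N$ whose generators act by $$\beta_1(S_{kl})=S_{k-1,l},\qquad \beta_2(S_{kl})=S_{k,l-1}.$$ If $\gamma_1,\gamma_2$ is one of these pairs of actions on a C*-algebra $A$, let $\gamma_2$ act on the (full) crossed product $A\rtimes_{\gamma_1}\mathbb Z_N$, with canonical unitaries $u_g$, by letting the generator send $a u_g$ to $\gamma_2(a)\,\omega^{g}u_g$ for $a\in A$, $g\in\mathbb Z_N$; $A\rtimes_{\gamma_1}\mathbb Z_N\rtimes_{\gamma_2}\mathbb Z_N$ is the resulting iterated crossed product. **Theorem.** For every integer $N\ge1$ there exist $*$-isomorphisms $$M_N(\mathbb F\mathcal O(K(M_N(\mathbb C),\mathrm{tr})))\cong \mathcal O_{N^2}\rtimes_{\beta_1}\mathbb Z_N\rtimes_{\beta_2}\mathbb Z_N,$$ $$M_N(\mathcal O_{N^2})\cong \mathbb F\mathcal O(K(M_N(\mathbb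 C),\mathrm{tr}))\rtimes_{\alpha_1}\mathbb Z_N\rtimes_{\alpha_2}\mathbb Z_N,$$ $$M_N(\mathbb F\mathcal O(TM_N))\cong \big(*_{N^2}C(S^1)\big)\rtimes_{\beta_1}\mathbb Z_N\rtimes_{\beta_2}\mathbb Z_N,$$ $$M_N\big(*_{N^2}C(S^1)\big)\cong \mathbb F\mathcal O(TM_N)\rtimes_{\alpha_1}\mathbb Z_N\rtimes_{\alpha_2}\mathbb Z_N.$$ -/

import Mathlib

open scoped TensorProduct ComplexOrder

noncomputable section

/-! ## Universal C*-algebras given by generators and relations -/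

/-- Noncommutative `*`-polynomials without constant term in the variables `X`. -/
inductive StarPoly (X : Type) : Type
  | gen : X → StarPoly X
  | zero : StarPoly X
  | add : StarPoly X → StarPoly X → StarPoly X
  | neg : StarPoly X → StarPoly X
  | smul : ℂ → StarPoly X → StarPoly X
  | mul : StarPoly X → StarPoly X → StarPoly X
  | adj : StarPoly X → StarPoly X

namespace StarPoly

/-- Evaluation of a `*`-polynomial at a family of elements of a C*-algebra. -/
def eval {X D : Type} [NonUnitalCStarAlgebra D] (s : X → D) : StarPoly X → D
  | gen x => s x
  | zero => 0
  | add p q => eval s p + eval s q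
  | neg p => - eval s p
  | smul c p => c • eval s p
  | mul p q => eval s p * eval s q
  | adj p => star (eval s p)

/-- Renaming of variables. -/
def rename {X Y : Type} (f : X → Y) : StarPoly X → StarPoly Y
  | gen x => gen (f x)
  | zero => zero
  | add p q => add (rename f p) (rename f q)
  | neg p => neg (rename f p)
  | smul c p => smul c (rename f p)
  | mul p q => mul (rename f p) (rename f q)
  | adj p => adj (rename f p)

theorem eval_rename {X Y D : Type} [NonUnitalCStarAlgebra D] (f : X → Y) (s : Y → D)
    (p : StarPoly X) : eval s (rename f p) = eval (s ∘ f) p := by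
  induction p <;> simp_all [eval, rename]

end StarPoly

/-- A relation for families `X → D` of elements of C*-algebras `D` (unital or not). -/
structure CStarRelation (X : Type) where
  Holds : ∀ {D : Type} [NonUnitalCStarAlgebra D], (X → D) → Prop

namespace CStarRelation

variable {X Y : Type}

/-- The relation bounds the norm of each generator, uniformly over all C*-algebras. This is what
makes the universal C*-algebra of the relation exist. -/
class IsBounded (R : CStarRelation X) : Prop where
  bound : ∀ x : X, ∃ C : ℝ, ∀ (D : Type) [NonUnitalCStarAlgebra D] (s : X → D),
    R.Holds s → ‖s x‖ ≤ C

/-- The norms of a `*`-polynomial in all families satisfying the relation. -/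
def normSet (R : CStarRelation X) (p : StarPoly X) : Set ℝ :=
  {r | ∃ (D : Type) (_ : NonUnitalCStarAlgebra D) (s : X → D), R.Holds s ∧ r = ‖p.eval s‖}

theorem bddAbove_normSet (R : CStarRelation X) [hR : R.IsBounded] (p : StarPoly X) :
    BddAbove (R.normSet p) := by
  suffices h : ∃ C : ℝ, ∀ (D : Type) [NonUnitalCStarAlgebra D] (s : X → D),
      R.Holds s → ‖p.eval s‖ ≤ C by
    obtain ⟨C, hC⟩ := h
    exact ⟨C, by rintro r ⟨D, _, s, hs, rfl⟩; exact hC D s hs⟩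
  induction p with
  | gen x => exact hR.bound x
  | zero => exact ⟨0, fun D _ s _ => by simp [StarPoly.eval]⟩
  | add p q hp hq =>
    obtain ⟨C, hC⟩ := hp
    obtain ⟨C', hC'⟩ := hq
    exact ⟨C + C', fun D _ s hs => (norm_add_le _ _).trans (add_le_add (hC D s hs) (hC' D s hs))⟩
  | neg p hp =>
    obtain ⟨C, hC⟩ := hp
    exact ⟨C, fun D _ s hs => by simpa [StarPoly.eval] using hC D s hs⟩
  | smul c p hp =>
    obtain ⟨C, hC⟩ := hp
    refine ⟨‖c‖ * C, fun D _ s hs => ?_⟩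
    simpa [StarPoly.eval, norm_smul] using mul_le_mul_of_nonneg_left (hC D s hs) (norm_nonneg c)
  | mul p q hp hq =>
    obtain ⟨C, hC⟩ := hp
    obtain ⟨C', hC'⟩ := hq
    exact ⟨C * C', fun D _ s hs => (norm_mul_le _ _).trans
      (mul_le_mul (hC D s hs) (hC' D s hs) (norm_nonneg _)
        ((norm_nonneg _).trans (hC D s hs)))⟩
  | adj p hp =>
    obtain ⟨C, hC⟩ := hp
    exact ⟨C, fun D _ s hs => by simpa [StarPoly.eval] using hC D s hs⟩

/-- Two `*`-polynomials are identified when they agree in all families satisfying the relation. -/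
def setoid (R : CStarRelation X) : Setoid (StarPoly X) where
  r p q := ∀ (D : Type) [NonUnitalCStarAlgebra D] (s : X → D), R.Holds s → p.eval s = q.eval s
  iseqv := ⟨fun _ _ _ _ _ => rfl, fun h D _ s hs => (h D s hs).symm,
    fun h h' D _ s hs => (h D s hs).trans (h' D s hs)⟩

/-- The `*`-algebra generated by a universal family satisfying the relation. -/
def Pre (R : CStarRelation X) : Type := Quotient R.setoid

namespace Pre

variable (R : CStarRelation X)

/-- The class of a `*`-polynomial. -/
def mk (p : StarPoly X) : R.Pre := Quotient.mk R.setoid p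

variable {R}

theorem mk_eq {p q : StarPoly X} (h : ∀ (D : Type) [NonUnitalCStarAlgebra D] (s : X → D),
    R.Holds s → p.eval s = q.eval s) : mk R p = mk R q := Quotient.sound h

theorem eval_eq {p q : StarPoly X} (h : mk R p = mk R q) {D : Type} [NonUnitalCStarAlgebra D]
    (s : X → D) (hs : R.Holds s) : p.eval s = q.eval s := Quotient.exact h D s hs

theorem ind {P : R.Pre → Prop} (h : ∀ p, P (mk R p)) (a : R.Pre) : P a := Quotient.ind h a

instance : Zero R.Pre := ⟨mk R .zero⟩

instance : Add R.Pre := ⟨Quotient.map₂ .add (fun _ _ h _ _ h' D _ s hs => by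
  simp [StarPoly.eval, h D s hs, h' D s hs])⟩

instance : Mul R.Pre := ⟨Quotient.map₂ .mul (fun _ _ h _ _ h' D _ s hs => by
  simp [StarPoly.eval, h D s hs, h' D s hs])⟩

instance : Neg R.Pre := ⟨Quotient.map .neg (fun _ _ h D _ s hs => by
  simp [StarPoly.eval, h D s hs])⟩

instance : Star R.Pre := ⟨Quotient.map .adj (fun _ _ h D _ s hs => by
  simp [StarPoly.eval, h D s hs])⟩

instance : SMul ℂ R.Pre := ⟨fun c => Quotient.map (.smul c) (fun _ _ h D _ s hs => by
  simp [StarPoly.eval, h D s hs])⟩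

theorem mk_zero : (0 : R.Pre) = mk R .zero := rfl
theorem mk_add (p q : StarPoly X) : mk R p + mk R q = mk R (.add p q) := rfl
theorem mk_mul (p q : StarPoly X) : mk R p * mk R q = mk R (.mul p q) := rfl
theorem mk_neg (p : StarPoly X) : - mk R p = mk R (.neg p) := rfl
theorem mk_star (p : StarPoly X) : star (mk R p) = mk R (.adj p) := rfl
theorem mk_smul (c : ℂ) (p : StarPoly X) : c • mk R p = mk R (.smul c p) := rfl

instance : NonUnitalRing R.Pre where
  add_assoc := by
    refine ind fun p => ind fun q => ind fun r => mk_eq fun D _ s _ => add_assoc _ _ _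
  zero_add := by refine ind fun p => mk_eq fun D _ s _ => zero_add _
  add_zero := by refine ind fun p => mk_eq fun D _ s _ => add_zero _
  add_comm := by refine ind fun p => ind fun q => mk_eq fun D _ s _ => add_comm _ _
  neg_add_cancel := by refine ind fun p => mk_eq fun D _ s _ => neg_add_cancel _
  nsmul := nsmulRec
  zsmul := zsmulRec
  left_distrib := by
    refine ind fun p => ind fun q => ind fun r => mk_eq fun D _ s _ => mul_add _ _ _
  right_distrib := by
    refine ind fun p => ind fun q => ind fun r => mk_eq fun D _ s _ => add_mul _ _ _
  zero_mul := by refine ind fun p => mk_eq fun D _ s _ => zero_mul _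
  mul_zero := by refine ind fun p => mk_eq fun D _ s _ => mul_zero _
  mul_assoc := by
    refine ind fun p => ind fun q => ind fun r => mk_eq fun D _ s _ => mul_assoc _ _ _

instance : StarRing R.Pre where
  star_involutive := by refine ind fun p => mk_eq fun D _ s _ => star_star _
  star_mul := by refine ind fun p => ind fun q => mk_eq fun D _ s _ => star_mul _ _
  star_add := by refine ind fun p => ind fun q => mk_eq fun D _ s _ => star_add _ _

instance : Module ℂ R.Pre where
  one_smul := by refine ind fun p => mk_eq fun D _ s _ => one_smul _ _
  mul_smul c d := by refine ind fun p => mk_eq fun D _ s _ => mul_smul _ _ _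
  smul_zero c := mk_eq fun D _ s _ => smul_zero _
  smul_add c := by refine ind fun p => ind fun q => mk_eq fun D _ s _ => smul_add _ _ _
  add_smul c d := by refine ind fun p => mk_eq fun D _ s _ => add_smul _ _ _
  zero_smul := by refine ind fun p => mk_eq fun D _ s _ => zero_smul _ _

instance : IsScalarTower ℂ R.Pre R.Pre where
  smul_assoc c := by refine ind fun p => ind fun q => mk_eq fun D _ s _ => smul_mul_assoc _ _ _

instance : SMulCommClass ℂ R.Pre R.Pre where
  smul_comm c := by
    refine ind fun p => ind fun q => mk_eq fun D _ s _ => (mul_smul_comm _ _ _).symm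

instance : StarModule ℂ R.Pre where
  star_smul c := by refine ind fun p => mk_eq fun D _ s _ => star_smul _ _

/-- The universal norm: the supremum over all families satisfying the relation. -/
instance : Norm R.Pre := ⟨Quotient.lift (fun p => sSup (R.normSet p)) (fun p q h => by
  have : R.normSet p = R.normSet q := by
    ext r
    constructor
    · rintro ⟨D, _, s, hs, rfl⟩; exact ⟨D, _, s, hs, by rw [h D s hs]⟩
    · rintro ⟨D, _, s, hs, rfl⟩; exact ⟨D, _, s, hs, by rw [h D s hs]⟩
  simp only [this])⟩

theorem norm_mk (p : StarPoly X) : ‖mk R p‖ = sSup (R.normSet p) := rfl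

theorem norm_mk_le {p : StarPoly X} {C : ℝ} (hC : 0 ≤ C)
    (h : ∀ (D : Type) [NonUnitalCStarAlgebra D] (s : X → D), R.Holds s → ‖p.eval s‖ ≤ C) :
    ‖mk R p‖ ≤ C :=
  Real.sSup_le (by rintro r ⟨D, _, s, hs, rfl⟩; exact h D s hs) hC

theorem norm_mk_nonneg (p : StarPoly X) : 0 ≤ ‖mk R p‖ :=
  Real.sSup_nonneg (by rintro r ⟨D, _, s, hs, rfl⟩; exact norm_nonneg _)

variable [R.IsBounded]

theorem le_norm_mk (p : StarPoly X) {D : Type} [NonUnitalCStarAlgebra D] {s : X → D}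
    (hs : R.Holds s) : ‖p.eval s‖ ≤ ‖mk R p‖ :=
  le_csSup (R.bddAbove_normSet p) ⟨D, _, s, hs, rfl⟩

theorem normCore : NormedSpace.Core ℂ R.Pre where
  norm_nonneg := ind norm_mk_nonneg
  norm_smul c := by
    have key : ∀ (c : ℂ) (p : StarPoly X), ‖mk R (.smul c p)‖ ≤ ‖c‖ * ‖mk R p‖ := fun c p =>
      norm_mk_le (mul_nonneg (norm_nonneg _) (norm_mk_nonneg _)) fun D _ s hs => by
        rw [StarPoly.eval, norm_smul]
        exact mul_le_mul_of_nonneg_left (le_norm_mk p hs) (norm_nonneg _)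
    refine ind fun p => le_antisymm (key c p) ?_
    rcases eq_or_ne c 0 with rfl | hc
    · rw [norm_zero, zero_mul]
      exact norm_mk_nonneg (R := R) (.smul 0 p)
    · have h := key c⁻¹ (.smul c p)
      have h2 : mk R (.smul c⁻¹ (.smul c p)) = mk R p := by
        rw [← mk_smul, ← mk_smul, inv_smul_smul₀ hc]
      rw [h2, norm_inv, ← div_eq_inv_mul, le_div_iff₀ (norm_pos_iff.2 hc), mul_comm] at h
      exact h
  norm_triangle := by
    refine ind fun p => ind fun q =>
      norm_mk_le (add_nonneg (norm_mk_nonneg _) (norm_mk_nonneg _)) fun D _ s hs => ?_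
    exact (norm_add_le _ _).trans (add_le_add (le_norm_mk p hs) (le_norm_mk q hs))
  norm_eq_zero_iff := by
    refine ind fun p => ⟨fun h => mk_eq fun D _ s hs => ?_, fun h => ?_⟩
    · exact norm_le_zero_iff.1 ((le_norm_mk p hs).trans h.le)
    · rw [h]
      exact le_antisymm (norm_mk_le le_rfl fun D _ s hs => by simp [StarPoly.eval])
        (norm_mk_nonneg _)

instance : NormedAddCommGroup R.Pre := NormedAddCommGroup.ofCore normCore

instance : NormedSpace ℂ R.Pre := NormedSpace.ofCore normCore

instance : NonUnitalNormedRing R.Pre where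
  __ : NormedAddCommGroup R.Pre := inferInstance
  __ : NonUnitalRing R.Pre := inferInstance
  norm_mul_le := by
    refine ind fun p => ind fun q =>
      norm_mk_le (mul_nonneg (norm_mk_nonneg _) (norm_mk_nonneg _)) fun D _ s hs => ?_
    exact (norm_mul_le _ _).trans
      (mul_le_mul (le_norm_mk p hs) (le_norm_mk q hs) (norm_nonneg _) (norm_mk_nonneg _))

instance : CStarRing R.Pre where
  norm_mul_self_le := by
    refine ind fun p => ?_
    have h0 : 0 ≤ ‖star (mk R p) * mk R p‖ := norm_nonneg _
    have h : ‖mk R p‖ ≤ √‖star (mk R p) * mk R p‖ :=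
      norm_mk_le (Real.sqrt_nonneg _) fun D _ s hs => by
        refine Real.le_sqrt_of_sq_le ?_
        have h := le_norm_mk (R := R) (.mul (.adj p) p) hs
        rw [StarPoly.eval, StarPoly.eval, CStarRing.norm_star_mul_self] at h
        rw [sq]
        exact h
    calc ‖mk R p‖ * ‖mk R p‖ ≤ √‖star (mk R p) * mk R p‖ * √‖star (mk R p) * mk R p‖ :=
          mul_self_le_mul_self (norm_nonneg _) h
      _ = _ := Real.mul_self_sqrt h0

end Pre

end CStarRelation

open UniformSpace (Completion)

/-- The universal C*-algebra generated by a family satisfying the relation `R`: the completion of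
the `*`-algebra generated by a universal family, in the universal norm. -/
def UniversalCStarAlgebra {X : Type} (R : CStarRelation X) [R.IsBounded] : Type :=
  Completion R.Pre

namespace UniversalCStarAlgebra

open CStarRelation

variable {X Y : Type} {R : CStarRelation X} [R.IsBounded]

instance : NormedAddCommGroup (UniversalCStarAlgebra R) :=
  inferInstanceAs (NormedAddCommGroup (Completion R.Pre))

instance : NormedSpace ℂ (UniversalCStarAlgebra R) :=
  inferInstanceAs (NormedSpace ℂ (Completion R.Pre))

instance : CompleteSpace (UniversalCStarAlgebra R) :=
  inferInstanceAs (CompleteSpace (Completion R.Pre))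

/-- The canonical map from the dense `*`-algebra. -/
def ofPre (a : R.Pre) : UniversalCStarAlgebra R := (a : Completion R.Pre)

theorem isDenseInducing_ofPre : IsDenseInducing (ofPre (R := R)) :=
  Completion.isDenseInducing_coe

theorem continuous_ofPre : Continuous (ofPre (R := R)) := Completion.continuous_coe _

theorem denseRange_ofPre : DenseRange (ofPre (R := R)) := Completion.denseRange_coe

theorem norm_ofPre (a : R.Pre) : ‖ofPre a‖ = ‖a‖ := Completion.norm_coe a

theorem ofPre_add (a b : R.Pre) : ofPre (a + b) = ofPre a + ofPre b := Completion.coe_add a b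

theorem ofPre_neg (a : R.Pre) : ofPre (-a) = - ofPre a := Completion.coe_neg a

theorem ofPre_zero : ofPre (0 : R.Pre) = 0 := Completion.coe_zero

theorem ofPre_smul (c : ℂ) (a : R.Pre) : ofPre (c • a) = c • ofPre a := Completion.coe_smul c a

/-- `ofPre` as an additive map. -/
def ofPreHom : R.Pre →+ UniversalCStarAlgebra R := ⟨⟨ofPre, ofPre_zero⟩, ofPre_add⟩

/-- `ofPre` as a continuous linear map. -/
def ofPreCLM : R.Pre →L[ℂ] UniversalCStarAlgebra R where
  toFun := ofPre
  map_add' := ofPre_add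
  map_smul' := ofPre_smul
  cont := continuous_ofPre

theorem induction_on {P : UniversalCStarAlgebra R → Prop} (a : UniversalCStarAlgebra R)
    (hP : IsClosed {a | P a}) (h : ∀ a, P (ofPre a)) : P a :=
  Completion.induction_on a hP h

instance : Mul (UniversalCStarAlgebra R) :=
  ⟨Function.curry <| (isDenseInducing_ofPre.prodMap isDenseInducing_ofPre).extend
    (ofPre ∘ Function.uncurry (· * ·))⟩

theorem ofPre_mul (a b : R.Pre) : ofPre (a * b) = ofPre a * ofPre b :=
  ((isDenseInducing_ofPre.prodMap isDenseInducing_ofPre).extend_eq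
    (continuous_ofPre.comp continuous_mul) (a, b)).symm

instance : ContinuousMul (UniversalCStarAlgebra R) where
  continuous_mul := by
    let m := (AddMonoidHom.mul : R.Pre →+ R.Pre →+ R.Pre).compr₂ ofPreHom
    have : Continuous fun p : R.Pre × R.Pre => m p.1 p.2 :=
      continuous_ofPre.comp continuous_mul
    have di : IsDenseInducing (ofPreHom : R.Pre → UniversalCStarAlgebra R) :=
      isDenseInducing_ofPre
    exact (di.extend_Z_bilin di this :)

instance : Star (UniversalCStarAlgebra R) := ⟨Completion.map (star : R.Pre → R.Pre)⟩

theorem ofPre_star (a : R.Pre) : ofPre (star a) = star (ofPre a) :=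
  (Completion.map_coe (star_isometry (E := R.Pre)).uniformContinuous a).symm

instance : ContinuousStar (UniversalCStarAlgebra R) := ⟨Completion.continuous_map⟩

theorem induction_on₂ {P : UniversalCStarAlgebra R → UniversalCStarAlgebra R → Prop}
    (a b : UniversalCStarAlgebra R)
    (hP : IsClosed {x : UniversalCStarAlgebra R × UniversalCStarAlgebra R | P x.1 x.2})
    (h : ∀ a b, P (ofPre a) (ofPre b)) : P a b :=
  Completion.induction_on₂ a b hP h

theorem induction_on₃
    {P : UniversalCStarAlgebra R → UniversalCStarAlgebra R → UniversalCStarAlgebra R → Prop}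
    (a b c : UniversalCStarAlgebra R)
    (hP : IsClosed {x : UniversalCStarAlgebra R × UniversalCStarAlgebra R ×
      UniversalCStarAlgebra R | P x.1 x.2.1 x.2.2})
    (h : ∀ a b c, P (ofPre a) (ofPre b) (ofPre c)) : P a b c :=
  Completion.induction_on₃ a b c hP h

instance : NonUnitalRing (UniversalCStarAlgebra R) where
  __ : AddCommGroup (UniversalCStarAlgebra R) := inferInstance
  zero_mul a := by
    refine induction_on (P := fun a => 0 * a = 0) a
      (isClosed_eq (continuous_const.mul continuous_id) continuous_const) fun a => ?_
    rw [← ofPre_zero, ← ofPre_mul, zero_mul]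
  mul_zero a := by
    refine induction_on (P := fun a => a * 0 = 0) a
      (isClosed_eq (continuous_id.mul continuous_const) continuous_const) fun a => ?_
    rw [← ofPre_zero, ← ofPre_mul, mul_zero]
  mul_assoc a b c := by
    refine induction_on₃ (P := fun a b c => a * b * c = a * (b * c)) a b c
      (isClosed_eq (by fun_prop) (by fun_prop)) fun a b c => ?_
    simp only [← ofPre_mul, mul_assoc]
  left_distrib a b c := by
    refine induction_on₃ (P := fun a b c => a * (b + c) = a * b + a * c) a b c
      (isClosed_eq (by fun_prop) (by fun_prop)) fun a b c => ?_
    rw [← ofPre_mul, ← ofPre_mul, ← ofPre_add, ← ofPre_add, ← ofPre_mul, mul_add]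
  right_distrib a b c := by
    refine induction_on₃ (P := fun a b c => (a + b) * c = a * c + b * c) a b c
      (isClosed_eq (by fun_prop) (by fun_prop)) fun a b c => ?_
    rw [← ofPre_mul, ← ofPre_mul, ← ofPre_add, ← ofPre_add, ← ofPre_mul, add_mul]

instance : NonUnitalNormedRing (UniversalCStarAlgebra R) where
  __ : NormedAddCommGroup (UniversalCStarAlgebra R) := inferInstance
  __ : NonUnitalRing (UniversalCStarAlgebra R) := inferInstance
  norm_mul_le a b := by
    refine induction_on₂ (P := fun a b => ‖a * b‖ ≤ ‖a‖ * ‖b‖) a b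
      (isClosed_le (by fun_prop) (by fun_prop)) fun a b => ?_
    rw [← ofPre_mul, norm_ofPre, norm_ofPre, norm_ofPre]
    exact norm_mul_le a b

instance : StarRing (UniversalCStarAlgebra R) where
  star_involutive a := by
    refine induction_on (P := fun a => star (star a) = a) a
      (isClosed_eq (by fun_prop) (by fun_prop)) fun a => ?_
    rw [← ofPre_star, ← ofPre_star, star_star]
  star_mul a b := by
    refine induction_on₂ (P := fun a b => star (a * b) = star b * star a) a b
      (isClosed_eq (by fun_prop) (by fun_prop)) fun a b => ?_
    rw [← ofPre_mul, ← ofPre_star, ← ofPre_star, ← ofPre_star, ← ofPre_mul, star_mul]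
  star_add a b := by
    refine induction_on₂ (P := fun a b => star (a + b) = star a + star b) a b
      (isClosed_eq (by fun_prop) (by fun_prop)) fun a b => ?_
    rw [← ofPre_add, ← ofPre_star, ← ofPre_star, ← ofPre_star, ← ofPre_add, star_add]

instance : CStarRing (UniversalCStarAlgebra R) where
  norm_mul_self_le a := by
    refine induction_on (P := fun a => ‖a‖ * ‖a‖ ≤ ‖star a * a‖) a
      (isClosed_le (by fun_prop) (by fun_prop)) fun a => ?_
    rw [← ofPre_star, ← ofPre_mul, norm_ofPre, norm_ofPre]
    exact CStarRing.norm_mul_self_le a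

instance : IsScalarTower ℂ (UniversalCStarAlgebra R) (UniversalCStarAlgebra R) where
  smul_assoc c a b := by
    refine induction_on₂ (P := fun a b => (c • a) * b = c • (a * b)) a b
      (isClosed_eq ((continuous_fst.const_smul c).mul continuous_snd)
        ((continuous_fst.mul continuous_snd).const_smul c)) fun a b => ?_
    rw [← ofPre_mul, ← ofPre_smul, ← ofPre_smul, ← ofPre_mul, smul_mul_assoc]

instance : SMulCommClass ℂ (UniversalCStarAlgebra R) (UniversalCStarAlgebra R) where
  smul_comm c a b := by
    refine induction_on₂ (P := fun a b => c • (a * b) = a * (c • b)) a b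
      (isClosed_eq ((continuous_fst.mul continuous_snd).const_smul c)
        (continuous_fst.mul (continuous_snd.const_smul c))) fun a b => ?_
    rw [← ofPre_mul, ← ofPre_smul, ← ofPre_smul, ← ofPre_mul, mul_smul_comm]

instance : StarModule ℂ (UniversalCStarAlgebra R) where
  star_smul c a := by
    refine induction_on (P := fun a => star (c • a) = star c • star a) a
      (isClosed_eq (continuous_id.const_smul c).star (continuous_id.star.const_smul (star c)))
      fun a => ?_
    rw [← ofPre_smul, ← ofPre_star, ← ofPre_star, ← ofPre_smul, star_smul]

instance : NonUnitalCStarAlgebra (UniversalCStarAlgebra R) where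

/-- The universal family. -/
def gen (R : CStarRelation X) [R.IsBounded] (x : X) : UniversalCStarAlgebra R :=
  ofPre (Pre.mk R (.gen x))

theorem ofPre_mk (p : StarPoly X) : ofPre (Pre.mk R p) = p.eval (gen R) := by
  induction p with
  | gen x => rfl
  | zero => exact ofPre_zero
  | add p q hp hq => rw [← Pre.mk_add, ofPre_add, hp, hq, StarPoly.eval]
  | neg p hp => rw [← Pre.mk_neg, ofPre_neg, hp, StarPoly.eval]
  | smul c p hp => rw [← Pre.mk_smul, ofPre_smul, hp, StarPoly.eval]
  | mul p q hp hq => rw [← Pre.mk_mul, ofPre_mul, hp, hq, StarPoly.eval]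
  | adj p hp => rw [← Pre.mk_star, ofPre_star, hp, StarPoly.eval]

theorem norm_eval_gen (p : StarPoly X) : ‖p.eval (gen R)‖ = ‖Pre.mk R p‖ := by
  rw [← ofPre_mk, norm_ofPre]

section lift

variable {D : Type} [NonUnitalCStarAlgebra D] (s : X → D)
  (h : ∀ p : StarPoly X, ‖p.eval s‖ ≤ ‖p.eval (gen R)‖)

theorem eval_congr (h : ∀ p : StarPoly X, ‖p.eval s‖ ≤ ‖p.eval (gen R)‖) {p q : StarPoly X} (hpq : Pre.mk R p = Pre.mk R q) : p.eval s = q.eval s := by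
  have h1 := h (.add p (.neg q))
  have h2 : (StarPoly.add p (.neg q)).eval (gen R) = 0 := by
    simp only [StarPoly.eval, ← ofPre_mk, hpq]
    exact add_neg_cancel _
  rw [h2, norm_zero, norm_le_zero_iff, StarPoly.eval, StarPoly.eval, ← sub_eq_add_neg] at h1
  exact sub_eq_zero.1 h1

/-- Evaluation at `s` on the dense `*`-algebra, as a bounded linear map. -/
def preLift : R.Pre →L[ℂ] D :=
  LinearMap.mkContinuous
    { toFun := Quotient.lift (fun p => p.eval s) (fun _ _ hpq => eval_congr s h (Quotient.sound hpq))
      map_add' := by refine Pre.ind fun p => Pre.ind fun q => rfl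
      map_smul' := fun c => by refine Pre.ind fun p => rfl } 1
    (by refine Pre.ind fun p => ?_
        rw [one_mul, ← norm_eval_gen]
        exact h p)

/-- Evaluation at `s`, extended by continuity. -/
def liftCLM : UniversalCStarAlgebra R →L[ℂ] D :=
  (preLift s h).extend (ofPreCLM (R := R))

theorem liftCLM_ofPre_mk (p : StarPoly X) : liftCLM s h (ofPre (Pre.mk R p)) = p.eval s :=
  (preLift s h).extend_eq (e := ofPreCLM (R := R)) denseRange_ofPre (Completion.isUniformInducing_coe R.Pre) (Pre.mk R p)

/-- The `*`-homomorphism from the universal C*-algebra determined by a family `s` whose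
`*`-polynomials are dominated in norm by those of the universal family. -/
def liftOfLE : UniversalCStarAlgebra R →⋆ₙₐ[ℂ] D where
  toFun := liftCLM s h
  map_smul' c a := map_smul _ _ _
  map_zero' := map_zero _
  map_add' a b := map_add _ _ _
  map_mul' a b := by
    refine induction_on₂ (P := fun a b => liftCLM s h (a * b) = liftCLM s h a * liftCLM s h b) a b
      (isClosed_eq (by fun_prop) (by fun_prop)) (Pre.ind fun p => Pre.ind fun q => ?_)
    rw [← ofPre_mul, Pre.mk_mul, liftCLM_ofPre_mk, liftCLM_ofPre_mk, liftCLM_ofPre_mk]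
    rfl
  map_star' a := by
    refine induction_on (P := fun a => liftCLM s h (star a) = star (liftCLM s h a)) a
      (isClosed_eq (by fun_prop) (by fun_prop)) (Pre.ind fun p => ?_)
    rw [← ofPre_star, Pre.mk_star, liftCLM_ofPre_mk, liftCLM_ofPre_mk]
    rfl

theorem liftOfLE_gen (x : X) : liftOfLE s h (gen R x) = s x :=
  liftCLM_ofPre_mk s h (.gen x)

end lift

/-- The universal property: a family satisfying the relation extends to a `*`-homomorphism. -/
def lift {D : Type} [NonUnitalCStarAlgebra D] (s : X → D) (hs : R.Holds s) :
    UniversalCStarAlgebra R →⋆ₙₐ[ℂ] D :=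
  liftOfLE s fun p => by rw [norm_eval_gen]; exact Pre.le_norm_mk p hs

@[simp]
theorem lift_gen {D : Type} [NonUnitalCStarAlgebra D] (s : X → D) (hs : R.Holds s) (x : X) :
    lift s hs (gen R x) = s x := liftOfLE_gen _ _ x

/-- The `*`-homomorphism induced by a map between generators which turns families satisfying one
relation into families satisfying the other one. -/
def map {R' : CStarRelation Y} [R'.IsBounded] (f : X → Y)
    (hf : ∀ (D : Type) [NonUnitalCStarAlgebra D] (s : Y → D), R'.Holds s → R.Holds (s ∘ f)) :
    UniversalCStarAlgebra R →⋆ₙₐ[ℂ] UniversalCStarAlgebra R' :=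
  liftOfLE (gen R' ∘ f) fun p => by
    rw [← StarPoly.eval_rename, norm_eval_gen, norm_eval_gen]
    refine Pre.norm_mk_le (norm_nonneg _) fun D _ s hs => ?_
    rw [StarPoly.eval_rename]
    exact Pre.le_norm_mk p (hf D s hs)

@[simp]
theorem map_gen {R' : CStarRelation Y} [R'.IsBounded] (f : X → Y)
    (hf : ∀ (D : Type) [NonUnitalCStarAlgebra D] (s : Y → D), R'.Holds s → R.Holds (s ∘ f))
    (x : X) : map f hf (gen R x) = gen R' (f x) := liftOfLE_gen _ _ x

/-- `*`-homomorphisms agreeing on the generators are equal. -/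
theorem hom_ext {D : Type} [NonUnitalCStarAlgebra D] {φ ψ : UniversalCStarAlgebra R →⋆ₙₐ[ℂ] D}
    (h : ∀ x, φ (gen R x) = ψ (gen R x)) : φ = ψ := by
  have key : ∀ χ : UniversalCStarAlgebra R →⋆ₙₐ[ℂ] D, Continuous χ := fun χ =>
    AddMonoidHomClass.continuous_of_bound χ 1 fun a => by
      rw [one_mul]; exact NonUnitalStarAlgHom.norm_apply_le χ a
  ext a
  refine induction_on (P := fun a => φ a = ψ a) a (isClosed_eq (key φ) (key ψ)) (Pre.ind fun p => ?_)
  rw [ofPre_mk]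
  induction p with
  | gen x => exact h x
  | zero => simp [StarPoly.eval]
  | add p q hp hq => simp [StarPoly.eval, hp, hq]
  | neg p hp => simp [StarPoly.eval, hp]
  | smul c p hp => simp [StarPoly.eval, hp]
  | mul p q hp hq => simp [StarPoly.eval, hp, hq]
  | adj p hp => simp [StarPoly.eval, hp, map_star]

theorem _root_.NonUnitalStarAlgHom.mul_apply_apply {A : Type} [NonUnitalCStarAlgebra A]
    (φ ψ : A →⋆ₙₐ[ℂ] A) (a : A) : (φ * ψ) a = φ (ψ a) := rfl

section action

variable {G : Type} [Group G] (f : G → X → X)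
  (hf : ∀ g (D : Type) [NonUnitalCStarAlgebra D] (s : X → D), R.Holds s → R.Holds (s ∘ f g))
  (f_one : ∀ x, f 1 x = x) (f_mul : ∀ g h x, f (g * h) x = f g (f h x))

/-- The action of a group on a universal C*-algebra induced by an action on the generators which
preserves the defining relation: `g` sends the generator of index `x` to the one of index
`f g x`. -/
def action : G →* (UniversalCStarAlgebra R →⋆ₙₐ[ℂ] UniversalCStarAlgebra R) where
  toFun g := map (f g) (hf g)
  map_one' := hom_ext fun x => by
    rw [map_gen, f_one]; rfl
  map_mul' g h := hom_ext fun x => by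
    rw [NonUnitalStarAlgHom.mul_apply_apply, map_gen, map_gen, map_gen, f_mul]

theorem action_gen (g : G) (x : X) : action f hf f_one f_mul g (gen R x) = gen R (f g x) :=
  map_gen (f g) (hf g) x

end action

/-- `*`-endomorphisms commute if they commute on generators. -/
theorem commute_of_gen {φ ψ : UniversalCStarAlgebra R →⋆ₙₐ[ℂ] UniversalCStarAlgebra R}
    (h : ∀ x, φ (ψ (gen R x)) = ψ (φ (gen R x))) (a : UniversalCStarAlgebra R) :
    φ (ψ a) = ψ (φ a) := by
  rw [← NonUnitalStarAlgHom.mul_apply_apply, ← NonUnitalStarAlgHom.mul_apply_apply]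
  congr 1
  exact hom_ext h

end UniversalCStarAlgebra

/-! ## The Cuntz algebra -/

/-- The relation defining the Cuntz algebra with generators indexed by the finite set `ι`: there is
an element `e` acting as a unit on all the `s i`, for which the `s i` are isometries whose range
projections add up to `e`. Thus `e` is the unit of the C*-algebra generated by the `s i`. -/
def cuntzRelation (ι : Type) [Fintype ι] : CStarRelation ι where
  Holds s := ∃ e, (∀ i, e * s i = s i ∧ s i * e = s i ∧ star (s i) * s i = e) ∧
    ∑ i, s i * star (s i) = e

instance (ι : Type) [Fintype ι] : (cuntzRelation ι).IsBounded where
  bound i := by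
    refine ⟨1, fun D _ s hs => ?_⟩
    obtain ⟨e, he, -⟩ := hs
    obtain ⟨-, h1, h2⟩ := he i
    have h3 : e * e = e := by
      calc e * e = star (s i) * s i * e := by rw [h2]
        _ = star (s i) * (s i * e) := mul_assoc _ _ _
        _ = e := by rw [h1, h2]
    have h4 : star e = e := by rw [← h2, star_mul, star_star]
    have h5 : ‖e‖ * ‖e‖ = ‖e‖ := by
      conv_rhs => rw [← h3]
      nth_rewrite 3 [← h4]
      rw [CStarRing.norm_star_mul_self]
    have h6 : ‖e‖ ≤ 1 := by
      by_contra! h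
      nlinarith
    have h7 : ‖s i‖ * ‖s i‖ = ‖e‖ := by rw [← h2, CStarRing.norm_star_mul_self]
    nlinarith [norm_nonneg (s i)]

/-- The Cuntz algebra `O_n`, with `n` the cardinality of `ι`: the universal unital C*-algebra
generated by isometries `s i` with `∑ i, s i * star (s i) = 1`. -/
abbrev CuntzAlgebra (ι : Type) [Fintype ι] : Type := UniversalCStarAlgebra (cuntzRelation ι)

/-! ## Free products -/

/-- Families consisting of a `*`-homomorphism on each `A i`. -/
def freeProductRelation {ι : Type} (A : ι → Type) [∀ i, NonUnitalCStarAlgebra (A i)] :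
    CStarRelation (Σ i, A i) where
  Holds {D} _ s := ∃ φ : ∀ i, A i →⋆ₙₐ[ℂ] D, ∀ i a, s ⟨i, a⟩ = φ i a

instance {ι : Type} (A : ι → Type) [∀ i, NonUnitalCStarAlgebra (A i)] :
    (freeProductRelation A).IsBounded where
  bound x := by
    refine ⟨‖x.2‖, fun D _ s ⟨φ, hφ⟩ => ?_⟩
    rw [show s x = φ x.1 x.2 from hφ x.1 x.2]
    exact NonUnitalStarAlgHom.norm_apply_le (φ x.1) x.2

/-- The non-unital free product of a family of C*-algebras. -/
abbrev FreeProduct {ι : Type} (A : ι → Type) [∀ i, NonUnitalCStarAlgebra (A i)] : Type :=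
  UniversalCStarAlgebra (freeProductRelation A)

/-! ## Crossed products by discrete groups -/

section CrossedProduct

variable {G A : Type} [Group G] [NonUnitalCStarAlgebra A]

/-- Families `s (g, a)`, to be thought of as `a u_g`, which define a `*`-representation of the
convolution algebra of finitely supported functions `G → A`: they are linear in `a` and satisfy
`(a u_g) (b u_h) = a α_g(b) u_{gh}` and `(a u_g)^* = α_{g⁻¹}(a^*) u_{g⁻¹}`. -/
def crossedProductRelation (α : G →* (A →⋆ₙₐ[ℂ] A)) : CStarRelation (G × A) where
  Holds {D} _ s := ∃ φ : G → A →ₗ[ℂ] D, (∀ g a, s (g, a) = φ g a) ∧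
    (∀ g h a b, φ g a * φ h b = φ (g * h) (a * α g b)) ∧
    ∀ g a, star (φ g a) = φ g⁻¹ (α g⁻¹ (star a))

instance (α : G →* (A →⋆ₙₐ[ℂ] A)) : (crossedProductRelation α).IsBounded where
  bound x := by
    obtain ⟨g, a⟩ := x
    refine ⟨‖a‖, fun D _ s ⟨φ, hs, hmul, hstar⟩ => ?_⟩
    let π : A →⋆ₙₐ[ℂ] D :=
      { toFun := φ 1
        map_smul' := fun c a => map_smul _ _ _
        map_zero' := map_zero _
        map_add' := fun a b => map_add _ _ _
        map_mul' := fun a b => by rw [hmul, mul_one, map_one]; rfl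
        map_star' := fun a => by rw [hstar, inv_one, map_one]; rfl }
    have h1 : star (φ g a) * φ g a = π (α g⁻¹ (star a * a)) := by
      rw [hstar, hmul, inv_mul_cancel, ← map_mul]; rfl
    have h2 : ‖φ g a‖ * ‖φ g a‖ ≤ ‖a‖ * ‖a‖ := by
      rw [← CStarRing.norm_star_mul_self, ← CStarRing.norm_star_mul_self (x := a), h1]
      exact (NonUnitalStarAlgHom.norm_apply_le π _).trans
        (NonUnitalStarAlgHom.norm_apply_le (α g⁻¹) _)
    rw [hs]
    exact (mul_self_le_mul_self_iff (norm_nonneg _) (norm_nonneg _)).2 h2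

/-- The full crossed product of a C*-algebra by an action of a discrete group: the enveloping
C*-algebra of the convolution algebra. -/
abbrev CrossedProduct (α : G →* (A →⋆ₙₐ[ℂ] A)) : Type :=
  UniversalCStarAlgebra (crossedProductRelation α)

end CrossedProduct

/-! ## Double crossed products by `ℤ/N` -/

section DoubleCrossedProduct

variable {N : ℕ} [NeZero N] {A : Type} [NonUnitalCStarAlgebra A]

/-- Given commuting actions `α`, `β` of `ℤ/N` on `A`, the action of `ℤ/N` on the crossed product of
`A` by `α` which sends `a u_g` to `ω ^ (h g) β_h(a) u_g`, where `ω = exp (2 π i / N)`. -/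
def extendedAction (α β : Multiplicative (ZMod N) →* (A →⋆ₙₐ[ℂ] A))
    (hαβ : ∀ g h a, α g (β h a) = β h (α g a)) :
    Multiplicative (ZMod N) →* (CrossedProduct α →⋆ₙₐ[ℂ] CrossedProduct α) :=
  UniversalCStarAlgebra.action
    (fun h x => (x.1, ZMod.stdAddChar (h.toAdd * x.1.toAdd) • β h x.2))
    (by
      rintro h D _ s ⟨φ, hs, hmul, hstar⟩
      refine ⟨fun g => (ZMod.stdAddChar (h.toAdd * g.toAdd) : ℂ) • φ g ∘ₗ (β h : A →ₗ[ℂ] A),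
        fun g a => ?_, fun g g' a b => ?_, fun g a => ?_⟩
      · simp [hs]
      · change ((ZMod.stdAddChar (h.toAdd * g.toAdd) : ℂ) • φ g (β h a)) *
          ((ZMod.stdAddChar (h.toAdd * g'.toAdd) : ℂ) • φ g' (β h b)) =
          (ZMod.stdAddChar (h.toAdd * (g * g').toAdd) : ℂ) • φ (g * g') (β h (a * α g b))
        rw [smul_mul_smul_comm, hmul, hαβ, map_mul (β h), toAdd_mul, mul_add,
          AddChar.map_add_eq_mul]
      · change star ((ZMod.stdAddChar (h.toAdd * g.toAdd) : ℂ) • φ g (β h a)) =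
          (ZMod.stdAddChar (h.toAdd * (g⁻¹).toAdd) : ℂ) • φ g⁻¹ (β h (α g⁻¹ (star a)))
        rw [star_smul, hstar, ← hαβ, map_star (β h), toAdd_inv, mul_neg, AddChar.map_neg_eq_conj]
        rfl)
    (fun x => by simp)
    (fun h h' x => by
      rw [map_smul, smul_smul, map_mul β, toAdd_mul, add_mul, AddChar.map_add_eq_mul]
      rfl)

/-- The iterated crossed product `A ⋊_α ℤ/N ⋊_β ℤ/N`. -/
abbrev DoubleCrossedProduct (α β : Multiplicative (ZMod N) →* (A →⋆ₙₐ[ℂ] A))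
    (hαβ : ∀ g h a, α g (β h a) = β h (α g a)) : Type :=
  CrossedProduct (extendedAction α β hαβ)

end DoubleCrossedProduct

/-! ## Quantum graphs and their quantum Cuntz-Krieger algebras -/

/-- A finite quantum space: a finite dimensional C*-algebra `B` with a `δ`-form. The linear map
`comul` is the adjoint `m^*` of the multiplication `m : B ⊗ B → B` with respect to the inner product
`⟪x, y⟫ = state (star x * y)` on `B` and the corresponding inner product on `B ⊗ B`. -/
structure FiniteQuantumSpace (B : Type) [CStarAlgebra B] [FiniteDimensional ℂ B] where
  state : B →ₗ[ℂ] ℂ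
  state_nonneg : ∀ b, 0 ≤ state (star b * b)
  state_faithful : ∀ b, state (star b * b) = 0 → b = 0
  state_one : state 1 = 1
  comul : B →ₗ[ℂ] B ⊗[ℂ] B
  /-- `⟪x ⊗ y, m^* b⟫ = ⟪x * y, b⟫` -/
  comul_adjoint : ∀ x y b,
    LinearMap.mul' ℂ ℂ (TensorProduct.map (state ∘ₗ LinearMap.mulLeft ℂ (star x))
      (state ∘ₗ LinearMap.mulLeft ℂ (star y)) (comul b)) = state (star (x * y) * b)
  δ : ℝ
  δ_pos : 0 < δ
  /-- `m m^* = δ² id` -/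
  mul_comul : ∀ b, LinearMap.mul' ℂ B (comul b) = (δ : ℂ) ^ 2 • b

/-- A directed quantum graph on a finite quantum space, given by its quantum adjacency matrix. -/
structure QuantumGraph {B : Type} [CStarAlgebra B] [FiniteDimensional ℂ B]
    (Q : FiniteQuantumSpace B) where
  adj : B →ₗ[ℂ] B
  /-- `m (A ⊗ A) m^* = δ² A` -/
  adj_idem : LinearMap.mul' ℂ B ∘ₗ TensorProduct.map adj adj ∘ₗ Q.comul = (Q.δ : ℂ) ^ 2 • adj

/-- The linear map `s^*(b) = s(b^*)^*` -/
def LinearMap.starConj {B D : Type} [CStarAlgebra B] [NonUnitalCStarAlgebra D] (s : B →ₗ[ℂ] D) :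
    B →ₗ[ℂ] D where
  toFun b := star (s (star b))
  map_add' a b := by simp
  map_smul' c b := by simp

namespace QuantumGraph

variable {B : Type} [CStarAlgebra B] [FiniteDimensional ℂ B] {Q : FiniteQuantumSpace B}

/-- Quantum Cuntz-Krieger families of a directed quantum graph. -/
structure IsCuntzKriegerFamily (𝒢 : QuantumGraph Q) {D : Type} [NonUnitalCStarAlgebra D]
    (s : B →ₗ[ℂ] D) : Prop where
  /-- `μ (id ⊗ μ) (s ⊗ s^* ⊗ s) (id ⊗ m^*) m^* = s` -/
  isometry : LinearMap.mul' ℂ D ∘ₗ TensorProduct.map LinearMap.id (LinearMap.mul' ℂ D) ∘ₗ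
    TensorProduct.map s (TensorProduct.map s.starConj s) ∘ₗ
    TensorProduct.map LinearMap.id Q.comul ∘ₗ Q.comul = s
  /-- `μ (s^* ⊗ s) m^* = μ (s ⊗ s^*) m^* A` -/
  adjacency : LinearMap.mul' ℂ D ∘ₗ TensorProduct.map s.starConj s ∘ₗ Q.comul =
    LinearMap.mul' ℂ D ∘ₗ TensorProduct.map s s.starConj ∘ₗ Q.comul ∘ₗ 𝒢.adj

/-- The relation defining the quantum Cuntz-Krieger algebra. -/
def relation (𝒢 : QuantumGraph Q) : CStarRelation B where
  Holds {D} _ s := ∃ S : B →ₗ[ℂ] D, (∀ b, s b = S b) ∧ 𝒢.IsCuntzKriegerFamily S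

/-- The quantum Cuntz-Krieger algebra of a directed quantum graph: the universal C*-algebra
generated by a quantum Cuntz-Krieger family. -/
abbrev FO (𝒢 : QuantumGraph Q) [𝒢.relation.IsBounded] : Type := UniversalCStarAlgebra 𝒢.relation

/-- The complete quantum graph `K(B, ψ)`, with `A(b) = δ² ψ(b) 1`. -/
def complete (Q : FiniteQuantumSpace B) : QuantumGraph Q where
  adj := (Q.δ : ℂ) ^ 2 • (LinearMap.toSpanSingleton ℂ B 1 ∘ₗ Q.state)
  adj_idem := by
    have key : ∀ z : B ⊗[ℂ] B, LinearMap.mul' ℂ B (TensorProduct.map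
        ((Q.δ : ℂ) ^ 2 • (LinearMap.toSpanSingleton ℂ B 1 ∘ₗ Q.state))
        ((Q.δ : ℂ) ^ 2 • (LinearMap.toSpanSingleton ℂ B 1 ∘ₗ Q.state)) z) =
        ((Q.δ : ℂ) ^ 2 * (Q.δ : ℂ) ^ 2 * LinearMap.mul' ℂ ℂ (TensorProduct.map
          (Q.state ∘ₗ LinearMap.mulLeft ℂ (star 1))
          (Q.state ∘ₗ LinearMap.mulLeft ℂ (star 1)) z)) • (1 : B) := by
      intro z
      induction z with
      | zero => simp
      | tmul x y => simp [smul_smul]; ring_nf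
      | add x y hx hy => simp only [map_add, hx, hy, mul_add, add_smul]
    ext b
    simp only [LinearMap.comp_apply, key, Q.comul_adjoint]
    simp [smul_smul, mul_assoc]

/-- The trivial quantum graph `T(B, ψ)`, with `A = id`. -/
def trivial (Q : FiniteQuantumSpace B) : QuantumGraph Q where
  adj := LinearMap.id
  adj_idem := by
    ext b
    simp [Q.mul_comul]

/-- A linear map `θ : B → B` compatible with the involution, with `m^*` and with the quantum
adjacency matrix. Composition with `θ` preserves quantum Cuntz-Krieger families. -/
structure IsSymmetry (𝒢 : QuantumGraph Q) (θ : B →ₗ[ℂ] B) : Prop where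
  map_star : ∀ b, θ (star b) = star (θ b)
  comul_map : ∀ b, Q.comul (θ b) = TensorProduct.map θ θ (Q.comul b)
  adj_map : ∀ b, 𝒢.adj (θ b) = θ (𝒢.adj b)

theorem IsCuntzKriegerFamily.comp {𝒢 : QuantumGraph Q} {θ : B →ₗ[ℂ] B} (hθ : 𝒢.IsSymmetry θ)
    {D : Type} [NonUnitalCStarAlgebra D] {s : B →ₗ[ℂ] D} (hs : 𝒢.IsCuntzKriegerFamily s) :
    𝒢.IsCuntzKriegerFamily (s ∘ₗ θ) := by
  have h1 : (s ∘ₗ θ).starConj = s.starConj ∘ₗ θ := by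
    ext b
    simp [LinearMap.starConj, hθ.map_star]
  have h2 : ∀ (f g : B →ₗ[ℂ] D) (b : B), TensorProduct.map (f ∘ₗ θ) (g ∘ₗ θ) (Q.comul b) =
      TensorProduct.map f g (Q.comul (θ b)) := fun f g b => by
    rw [hθ.comul_map, TensorProduct.map_comp, LinearMap.comp_apply]
  constructor
  · have h3 : ∀ z : B ⊗[ℂ] B, TensorProduct.map (s ∘ₗ θ)
        (TensorProduct.map (s.starConj ∘ₗ θ) (s ∘ₗ θ))
          (TensorProduct.map LinearMap.id Q.comul z) =
        TensorProduct.map s (TensorProduct.map s.starConj s)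
          (TensorProduct.map LinearMap.id Q.comul (TensorProduct.map θ θ z)) := by
      intro z
      induction z with
      | zero => simp
      | tmul x y => simp [h2]
      | add x y hx hy => simp only [map_add, hx, hy]
    ext b
    have h4 := LinearMap.congr_fun hs.isometry (θ b)
    simp only [LinearMap.comp_apply] at h4 ⊢
    rw [h1, h3, ← hθ.comul_map, h4]
  · ext b
    have h4 := LinearMap.congr_fun hs.adjacency (θ b)
    simp only [LinearMap.comp_apply] at h4 ⊢
    rw [h1, h2, h2, h4, hθ.adj_map]

/-- The action on the quantum Cuntz-Krieger algebra induced by an action of a group by symmetries,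
that is, `S(b) ↦ S(θ_g(b))`. -/
def action (𝒢 : QuantumGraph Q) [𝒢.relation.IsBounded] {G : Type} [Group G]
    (θ : G → B →ₗ[ℂ] B) (hθ : ∀ g, 𝒢.IsSymmetry (θ g)) (θ_one : ∀ b, θ 1 b = b)
    (θ_mul : ∀ g h b, θ (g * h) b = θ g (θ h b)) : G →* (𝒢.FO →⋆ₙₐ[ℂ] 𝒢.FO) :=
  UniversalCStarAlgebra.action (fun g => θ g) (by
    rintro g D _ s ⟨S, hs, hS⟩
    exact ⟨S ∘ₗ θ g, fun b => hs (θ g b), hS.comp (hθ g)⟩) θ_one θ_mul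

end QuantumGraph

/-! ## The quantum graphs on a full matrix algebra -/

section MatrixGraphs

variable (N : ℕ) [NeZero N]

/-- The matrix algebra `M_N(ℂ)`, with rows and columns indexed by `ℤ/N`. -/
abbrev MatN : Type := CStarMatrix (ZMod N) (ZMod N) ℂ

instance : FiniteDimensional ℂ (MatN N) :=
  inferInstanceAs (FiniteDimensional ℂ (Matrix (ZMod N) (ZMod N) ℂ))

/-- The matrix units of `M_N(ℂ)`. -/
def matUnit (i j : ZMod N) : MatN N := CStarMatrix.ofMatrix (Matrix.single i j 1)

variable {N} in
theorem matUnit_apply (i j k l : ZMod N) :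
    matUnit N i j k l = if i = k ∧ j = l then 1 else 0 := by
  simp [matUnit, Matrix.single_apply]

variable {N} in
theorem sum_matUnit (b : MatN N) : ∑ i, ∑ j, b i j • matUnit N i j = b := by
  refine Eq.trans ?_ (Matrix.matrix_eq_sum_single (CStarMatrix.ofMatrix.symm b)).symm
  refine Finset.sum_congr rfl fun i _ => Finset.sum_congr rfl fun j _ => ?_
  ext k l
  rw [CStarMatrix.smul_apply, matUnit_apply]
  change _ = Matrix.single i j (b i j) k l
  simp [Matrix.single_apply]

/-- The normalized trace on `M_N(ℂ)`. -/
def normTrace : MatN N →ₗ[ℂ] ℂ where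
  toFun b := (N : ℂ)⁻¹ * ∑ i, b i i
  map_add' a b := by simp [Finset.sum_add_distrib, mul_add]
  map_smul' c a := by simp [← Finset.mul_sum, mul_left_comm]

/-- The adjoint of the multiplication map of `M_N(ℂ)` for the normalized trace:
`m^*(e_ij) = N ∑ k, e_ik ⊗ e_kj`. -/
def matComul : MatN N →ₗ[ℂ] MatN N ⊗[ℂ] MatN N where
  toFun b := (N : ℂ) • ∑ i, ∑ j, b i j • ∑ k, matUnit N i k ⊗ₜ[ℂ] matUnit N k j
  map_add' a b := by simp [Finset.sum_add_distrib, add_smul]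
  map_smul' c a := by
    simp only [CStarMatrix.smul_apply, smul_eq_mul, mul_smul, ← Finset.smul_sum, RingHom.id_apply]
    rw [smul_comm]

variable {N} in
theorem matComul_matUnit (i j : ZMod N) :
    matComul N (matUnit N i j) = (N : ℂ) • ∑ k, matUnit N i k ⊗ₜ[ℂ] matUnit N k j := by
  simp only [matComul, LinearMap.coe_mk, AddHom.coe_mk]
  congr 1
  rw [Finset.sum_eq_single i, Finset.sum_eq_single j]
  · simp [matUnit_apply]
  · intro b _ hb; simp [matUnit_apply, hb.symm]
  · simp
  · intro b _ hb; simp [matUnit_apply, hb.symm]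
  · simp

variable {N} in
theorem matN_hom_ext {M : Type*} [AddCommMonoid M] [Module ℂ M] {f g : MatN N →ₗ[ℂ] M}
    (h : ∀ i j, f (matUnit N i j) = g (matUnit N i j)) : f = g := by
  ext b
  rw [← sum_matUnit b]
  simp only [map_sum, map_smul, h]

variable {N} in
theorem normTrace_star_mul_self (b : MatN N) :
    normTrace N (star b * b) = ((N : ℝ)⁻¹ * ∑ i, ∑ j, ‖b j i‖ ^ 2 : ℝ) := by
  simp only [normTrace, LinearMap.coe_mk, AddHom.coe_mk, CStarMatrix.mul_apply,
    CStarMatrix.star_apply, Complex.star_def, Complex.conj_mul']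
  push_cast
  rfl

variable {N} in
theorem matUnit_mul (i j k l : ZMod N) :
    matUnit N i j * matUnit N k l = if j = k then matUnit N i l else 0 := by
  split_ifs with h
  · subst h
    exact (Matrix.single_mul_single_same (1 : ℂ) i j l 1).trans (by rw [one_mul]; rfl)
  · exact Matrix.single_mul_single_of_ne (1 : ℂ) i j k h 1

variable {N} in
theorem star_matUnit (i j : ZMod N) : star (matUnit N i j) = matUnit N j i := by
  ext k l
  rw [CStarMatrix.star_apply, matUnit_apply, matUnit_apply]
  simp [and_comm, apply_ite]

/-- The finite quantum space `(M_N(ℂ), tr)`, where `tr` is the normalized trace, which is a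
`δ`-form with `δ = N`. -/
def matSpace : FiniteQuantumSpace (MatN N) where
  state := normTrace N
  state_nonneg b := by
    rw [normTrace_star_mul_self]
    exact_mod_cast mul_nonneg (by positivity) (by positivity)
  state_faithful b hb := by
    rw [normTrace_star_mul_self] at hb
    have h1 : (N : ℝ)⁻¹ ≠ 0 := inv_ne_zero (by exact_mod_cast NeZero.ne N)
    have h2 : ∑ i, ∑ j, ‖b j i‖ ^ 2 = 0 := by
      have h3 : (N : ℝ)⁻¹ * ∑ i, ∑ j, ‖b j i‖ ^ 2 = 0 := by exact_mod_cast hb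
      exact (mul_eq_zero.1 h3).resolve_left h1
    ext j i
    rw [Finset.sum_eq_zero_iff_of_nonneg (fun _ _ => by positivity)] at h2
    have h3 := h2 i (Finset.mem_univ _)
    rw [Finset.sum_eq_zero_iff_of_nonneg (fun _ _ => by positivity)] at h3
    simpa using h3 j (Finset.mem_univ _)
  state_one := by
    have : (N : ℂ) ≠ 0 := by exact_mod_cast NeZero.ne N
    simp [normTrace, ZMod.card, this]
  comul := matComul N
  comul_adjoint x y b := by
    suffices h : LinearMap.mul' ℂ ℂ ∘ₗ TensorProduct.map (normTrace N ∘ₗ LinearMap.mulLeft ℂ (star x))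
        (normTrace N ∘ₗ LinearMap.mulLeft ℂ (star y)) ∘ₗ matComul N =
        normTrace N ∘ₗ LinearMap.mulLeft ℂ (star (x * y)) from LinearMap.congr_fun h b
    refine matN_hom_ext fun i j => ?_
    have hN : (N : ℂ) ≠ 0 := by exact_mod_cast NeZero.ne N
    have h1 : ∀ (z : MatN N) (i j : ZMod N),
        normTrace N (star z * matUnit N i j) = (N : ℂ)⁻¹ * star (z i j) := by
      intro z i j
      simp only [normTrace, LinearMap.coe_mk, AddHom.coe_mk, CStarMatrix.mul_apply,
        CStarMatrix.star_apply, matUnit_apply]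
      congr 1
      rw [Finset.sum_eq_single j, Finset.sum_eq_single i]
      · simp
      · intro b _ hb; simp [hb.symm]
      · simp
      · intro b _ hb; simp [hb.symm]
      · simp
    simp only [LinearMap.comp_apply, matComul_matUnit, map_smul, map_sum, TensorProduct.map_tmul,
      LinearMap.mulLeft_apply, LinearMap.mul'_apply, h1, CStarMatrix.mul_apply]
    simp only [star_sum, star_mul, Finset.mul_sum, smul_eq_mul]
    refine Finset.sum_congr rfl fun k _ => ?_
    field_simp
  δ := N
  δ_pos := by exact_mod_cast Nat.pos_of_ne_zero (NeZero.ne N)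
  mul_comul b := by
    suffices h : LinearMap.mul' ℂ (MatN N) ∘ₗ matComul N = ((N : ℝ) : ℂ) ^ 2 • LinearMap.id from
      LinearMap.congr_fun h b
    refine matN_hom_ext fun i j => ?_
    simp only [LinearMap.comp_apply, matComul_matUnit, map_smul, map_sum, LinearMap.mul'_apply,
      matUnit_mul]
    simp [ZMod.card, ← Nat.cast_smul_eq_nsmul ℂ, smul_smul, sq]

variable {N} in
theorem norm_le_one_of_partialIsometry {D : Type} [NonUnitalCStarAlgebra D] {v : D}
    (hv : v * star v * v = v) : ‖v‖ ≤ 1 := by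
  have h1 : ‖star v * v‖ * ‖star v * v‖ = ‖star v * v‖ := by
    rw [← CStarRing.norm_star_mul_self (x := star v * v)]
    congr 1
    rw [star_mul, star_star, mul_assoc, ← mul_assoc v, hv]
  rw [CStarRing.norm_star_mul_self] at h1
  by_contra! h
  have : 1 < ‖v‖ * ‖v‖ := by nlinarith
  nlinarith

/-- The quantum Cuntz-Krieger relation bounds the generators: the matrix with entries
`S(N e_ij)` is a partial isometry. -/
instance (𝒢 : QuantumGraph (matSpace N)) : 𝒢.relation.IsBounded where
  bound b := by
    refine ⟨∑ i, ∑ j, ‖b i j‖ * ‖(N : ℂ)⁻¹‖, fun D _ s ⟨S, hs, hS⟩ => ?_⟩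
    have hN : (N : ℂ) ≠ 0 := by exact_mod_cast NeZero.ne N
    let _ := CStarAlgebra.spectralOrder D
    have _ := CStarAlgebra.spectralOrderedRing D
    let V : CStarMatrix (ZMod N) (ZMod N) D :=
      CStarMatrix.ofMatrix fun i j => S ((N : ℂ) • matUnit N i j)
    have hV : V * star V * V = V := by
      ext i j
      have h := LinearMap.congr_fun hS.isometry ((N : ℂ) • matUnit N i j)
      simp only [LinearMap.comp_apply, map_smul, matComul_matUnit, map_sum, matSpace,
        TensorProduct.map_tmul, LinearMap.id_apply, LinearMap.mul'_apply, TensorProduct.tmul_smul,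
        TensorProduct.tmul_sum] at h
      have h1 : ∀ i j, V i j = (N : ℂ) • S (matUnit N i j) := fun i j => map_smul S _ _
      have h2 : ∀ i j, star (V j i) = (N : ℂ) • S.starConj (matUnit N i j) := fun i j => by
        rw [h1, star_smul, ← star_matUnit i j, Complex.star_def, Complex.conj_natCast]
        rfl
      rw [h1, ← h, CStarMatrix.mul_apply]
      simp only [CStarMatrix.mul_apply, CStarMatrix.star_apply, h2]
      simp only [h1, Finset.sum_mul, Finset.smul_sum, smul_mul_assoc, mul_smul_comm, mul_assoc]
      rw [Finset.sum_comm]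
    have hV1 : ∀ i j, ‖S ((N : ℂ) • matUnit N i j)‖ ≤ 1 := fun i j =>
      (CStarMatrix.norm_entry_le_norm (M := V) (i := i) (j := j)).trans
        (norm_le_one_of_partialIsometry hV)
    rw [hs]
    conv_lhs => rw [← sum_matUnit b]
    simp only [map_sum]
    refine (norm_sum_le _ _).trans (Finset.sum_le_sum fun i _ => (norm_sum_le _ _).trans
      (Finset.sum_le_sum fun j _ => ?_))
    rw [map_smul, norm_smul]
    refine mul_le_mul_of_nonneg_left ?_ (norm_nonneg _)
    have h := hV1 i j
    rw [map_smul, norm_smul] at h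
    rw [norm_inv]
    exact (le_inv_mul_iff₀ (norm_pos_iff.2 hN)).2 (by simpa using h) |>.trans_eq (by simp)

/-- The `ℤ/N`-action `e_kl ↦ ω ^ (g (k - l)) e_kl` on `M_N(ℂ)`, where `ω = exp (2 π i / N)`. This is
conjugation by the `g`-th power of the generalized Pauli matrix `X`, `X |j⟩ = ω ^ j |j⟩`. -/
def phase (g : Multiplicative (ZMod N)) : MatN N →ₗ[ℂ] MatN N where
  toFun b := CStarMatrix.ofMatrix fun k l => ZMod.stdAddChar (g.toAdd * (k - l)) * b k l
  map_add' a b := by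
    ext k l
    exact mul_add _ (a k l) (b k l)
  map_smul' c a := by
    ext k l
    exact mul_left_comm _ c (a k l)

/-- The `ℤ/N`-action `e_kl ↦ e_{k - g, l - g}` on `M_N(ℂ)`. This is conjugation by the `g`-th power
of the adjoint of the generalized Pauli matrix `Z`, `Z |j⟩ = |j + 1⟩`. -/
def shift (g : Multiplicative (ZMod N)) : MatN N →ₗ[ℂ] MatN N where
  toFun b := CStarMatrix.ofMatrix fun k l => b (k + g.toAdd) (l + g.toAdd)
  map_add' _ _ := rfl
  map_smul' _ _ := rfl

variable {N} in
theorem phase_apply (g : Multiplicative (ZMod N)) (b : MatN N) (k l : ZMod N) :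
    phase N g b k l = ZMod.stdAddChar (g.toAdd * (k - l)) * b k l := rfl

variable {N} in
theorem shift_apply (g : Multiplicative (ZMod N)) (b : MatN N) (k l : ZMod N) :
    shift N g b k l = b (k + g.toAdd) (l + g.toAdd) := rfl

variable {N} in
theorem phase_matUnit (g : Multiplicative (ZMod N)) (i j : ZMod N) :
    phase N g (matUnit N i j) = (ZMod.stdAddChar (g.toAdd * (i - j)) : ℂ) • matUnit N i j := by
  ext k l
  rw [phase_apply, CStarMatrix.smul_apply, matUnit_apply]
  split_ifs with h
  · rw [h.1, h.2]; rfl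
  · simp

variable {N} in
theorem shift_matUnit (g : Multiplicative (ZMod N)) (i j : ZMod N) :
    shift N g (matUnit N i j) = matUnit N (i - g.toAdd) (j - g.toAdd) := by
  ext k l
  rw [shift_apply, matUnit_apply, matUnit_apply]
  simp only [sub_eq_iff_eq_add]

variable {N} in
theorem phase_star (g : Multiplicative (ZMod N)) (b : MatN N) :
    phase N g (star b) = star (phase N g b) := by
  ext k l
  rw [phase_apply, CStarMatrix.star_apply, CStarMatrix.star_apply, phase_apply, star_mul',
    Complex.star_def, ← AddChar.map_neg_eq_conj, ← mul_neg, neg_sub]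

variable {N} in
theorem shift_star (g : Multiplicative (ZMod N)) (b : MatN N) :
    shift N g (star b) = star (shift N g b) := by
  ext k l
  rfl

variable {N} in
theorem phase_comul (g : Multiplicative (ZMod N)) (b : MatN N) :
    matComul N (phase N g b) = TensorProduct.map (phase N g) (phase N g) (matComul N b) := by
  suffices h : matComul N ∘ₗ phase N g =
      TensorProduct.map (phase N g) (phase N g) ∘ₗ matComul N from LinearMap.congr_fun h b
  refine matN_hom_ext fun i j => ?_
  simp only [LinearMap.comp_apply, phase_matUnit, map_smul, map_sum, matComul_matUnit,
    TensorProduct.map_tmul, TensorProduct.smul_tmul_smul, ← AddChar.map_add_eq_mul, ← mul_add,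
    sub_add_sub_cancel]
  rw [← Finset.smul_sum, smul_comm]

variable {N} in
theorem shift_comul (g : Multiplicative (ZMod N)) (b : MatN N) :
    matComul N (shift N g b) = TensorProduct.map (shift N g) (shift N g) (matComul N b) := by
  suffices h : matComul N ∘ₗ shift N g =
      TensorProduct.map (shift N g) (shift N g) ∘ₗ matComul N from LinearMap.congr_fun h b
  refine matN_hom_ext fun i j => ?_
  simp only [LinearMap.comp_apply, shift_matUnit, map_smul, map_sum, matComul_matUnit,
    TensorProduct.map_tmul]
  congr 1
  exact (Equiv.sum_comp (Equiv.subRight g.toAdd)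
    (fun k => matUnit N (i - g.toAdd) k ⊗ₜ[ℂ] matUnit N k (j - g.toAdd))).symm

variable {N} in
theorem phase_complete (g : Multiplicative (ZMod N)) :
    (QuantumGraph.complete (matSpace N)).IsSymmetry (phase N g) where
  map_star := phase_star g
  comul_map := phase_comul g
  adj_map b := by
    have h1 : phase N g 1 = 1 := by
      ext k l
      rw [phase_apply, CStarMatrix.one_apply]
      split_ifs with h <;> simp [h]
    have h2 : normTrace N (phase N g b) = normTrace N b := by
      simp [normTrace, phase_apply]
    simp [QuantumGraph.complete, matSpace, h1, h2]

variable {N} in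
theorem shift_complete (g : Multiplicative (ZMod N)) :
    (QuantumGraph.complete (matSpace N)).IsSymmetry (shift N g) where
  map_star := shift_star g
  comul_map := shift_comul g
  adj_map b := by
    have h1 : shift N g 1 = 1 := by
      ext k l
      rw [shift_apply, CStarMatrix.one_apply, CStarMatrix.one_apply]
      simp
    have h2 : normTrace N (shift N g b) = normTrace N b := by
      simp only [normTrace, LinearMap.coe_mk, AddHom.coe_mk, shift_apply]
      congr 1
      exact Equiv.sum_comp (Equiv.addRight g.toAdd) fun i => b i i
    simp [QuantumGraph.complete, matSpace, h1, h2]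

variable {N} in
theorem phase_trivial (g : Multiplicative (ZMod N)) :
    (QuantumGraph.trivial (matSpace N)).IsSymmetry (phase N g) :=
  ⟨phase_star g, phase_comul g, fun _ => rfl⟩

variable {N} in
theorem shift_trivial (g : Multiplicative (ZMod N)) :
    (QuantumGraph.trivial (matSpace N)).IsSymmetry (shift N g) :=
  ⟨shift_star g, shift_comul g, fun _ => rfl⟩

variable {N} in
theorem phase_one (b : MatN N) : phase N 1 b = b := by
  ext k l
  simp [phase_apply]

variable {N} in
theorem shift_one (b : MatN N) : shift N 1 b = b := by
  ext k l
  simp [shift_apply]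

variable {N} in
theorem phase_mul (g h : Multiplicative (ZMod N)) (b : MatN N) :
    phase N (g * h) b = phase N g (phase N h b) := by
  ext k l
  simp only [phase_apply, toAdd_mul, add_mul, AddChar.map_add_eq_mul, mul_assoc]

variable {N} in
theorem shift_mul (g h : Multiplicative (ZMod N)) (b : MatN N) :
    shift N (g * h) b = shift N g (shift N h b) := by
  ext k l
  simp only [shift_apply, toAdd_mul, add_assoc]

variable {N} in
theorem phase_shift (g h : Multiplicative (ZMod N)) (b : MatN N) :
    phase N g (shift N h b) = shift N h (phase N g b) := by
  ext k l
  simp only [phase_apply, shift_apply, add_sub_add_right_eq_sub]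

/-- `FO(K(M_N(ℂ), tr))` -/
abbrev FOComplete : Type := (QuantumGraph.complete (matSpace N)).FO

/-- `FO(TM_N)` -/
abbrev FOTrivial : Type := (QuantumGraph.trivial (matSpace N)).FO

/-- The action of `ℤ/N` on `FO(K(M_N(ℂ), tr))` generated by `α₁(S_kl) = ω ^ (k - l) S_kl`. -/
def alphaOneComplete : Multiplicative (ZMod N) →* (FOComplete N →⋆ₙₐ[ℂ] FOComplete N) :=
  (QuantumGraph.complete (matSpace N)).action (phase N) phase_complete phase_one phase_mul

/-- The action of `ℤ/N` on `FO(K(M_N(ℂ), tr))` generated by `α₂(S_kl) = S_{k-1, l-1}`. -/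
def alphaTwoComplete : Multiplicative (ZMod N) →* (FOComplete N →⋆ₙₐ[ℂ] FOComplete N) :=
  (QuantumGraph.complete (matSpace N)).action (shift N) shift_complete shift_one shift_mul

theorem alphaComplete_comm (g h : Multiplicative (ZMod N)) (a : FOComplete N) :
    alphaOneComplete N g (alphaTwoComplete N h a) = alphaTwoComplete N h (alphaOneComplete N g a) :=
  UniversalCStarAlgebra.commute_of_gen (fun x => by
    simp only [alphaOneComplete, alphaTwoComplete, QuantumGraph.action,
      UniversalCStarAlgebra.action_gen, phase_shift]) a

/-- The action of `ℤ/N` on `FO(TM_N)` generated by `α₁(S_kl) = ω ^ (k - l) S_kl`. -/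
def alphaOneTrivial : Multiplicative (ZMod N) →* (FOTrivial N →⋆ₙₐ[ℂ] FOTrivial N) :=
  (QuantumGraph.trivial (matSpace N)).action (phase N) phase_trivial phase_one phase_mul

/-- The action of `ℤ/N` on `FO(TM_N)` generated by `α₂(S_kl) = S_{k-1, l-1}`. -/
def alphaTwoTrivial : Multiplicative (ZMod N) →* (FOTrivial N →⋆ₙₐ[ℂ] FOTrivial N) :=
  (QuantumGraph.trivial (matSpace N)).action (shift N) shift_trivial shift_one shift_mul

theorem alphaTrivial_comm (g h : Multiplicative (ZMod N)) (a : FOTrivial N) :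
    alphaOneTrivial N g (alphaTwoTrivial N h a) = alphaTwoTrivial N h (alphaOneTrivial N g a) :=
  UniversalCStarAlgebra.commute_of_gen (fun x => by
    simp only [alphaOneTrivial, alphaTwoTrivial, QuantumGraph.action,
      UniversalCStarAlgebra.action_gen, phase_shift]) a

end MatrixGraphs

/-! ## The Cuntz algebra `O_{N²}` and the free product of `N²` copies of `C(S¹)` -/

section Classical

variable (N : ℕ) [NeZero N]

/-- The Cuntz algebra `O_{N²}`, with generators `S_kl` indexed by `k, l ∈ ℤ/N`. -/
abbrev CuntzSq : Type := CuntzAlgebra (ZMod N × ZMod N)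

/-- The non-unital free product of `N²` copies of `C(S¹)`, indexed by `k, l ∈ ℤ/N`. -/
abbrev FreeCircleSq : Type := FreeProduct fun _ : ZMod N × ZMod N => C(Circle, ℂ)

/-- The action of a group on the Cuntz algebra by permutations of the generators. -/
def cuntzAction {ι G : Type} [Fintype ι] [Group G] (σ : G →* Equiv.Perm ι) :
    G →* (CuntzAlgebra ι →⋆ₙₐ[ℂ] CuntzAlgebra ι) :=
  UniversalCStarAlgebra.action (fun g => σ g) (by
    rintro g D _ s ⟨e, h, hsum⟩
    exact ⟨e, fun i => h (σ g i), (Equiv.sum_comp (σ g) fun i => s i * star (s i)).trans hsum⟩)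
    (fun x => by simp) (fun g h x => by simp)

/-- The action of a group on a free product of copies of one C*-algebra by permutations of the
copies. -/
def freeProductAction {ι G A : Type} [Group G] [NonUnitalCStarAlgebra A]
    (σ : G →* Equiv.Perm ι) :
    G →* (FreeProduct (fun _ : ι => A) →⋆ₙₐ[ℂ] FreeProduct (fun _ : ι => A)) :=
  UniversalCStarAlgebra.action (fun g x => ⟨σ g x.1, x.2⟩) (by
    rintro g D _ s ⟨φ, h⟩
    exact ⟨fun i => φ (σ g i), fun i a => h (σ g i) a⟩)
    (fun x => by simp) (fun g h x => by simp)

/-- The permutations `(k, l) ↦ (k - g, l)`. -/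
def permOne : Multiplicative (ZMod N) →* Equiv.Perm (ZMod N × ZMod N) where
  toFun g := (Equiv.subRight g.toAdd).prodCongr (Equiv.refl _)
  map_one' := by ext x <;> simp
  map_mul' g h := by ext x <;> simp [sub_sub, add_comm]

/-- The permutations `(k, l) ↦ (k, l - g)`. -/
def permTwo : Multiplicative (ZMod N) →* Equiv.Perm (ZMod N × ZMod N) where
  toFun g := (Equiv.refl _).prodCongr (Equiv.subRight g.toAdd)
  map_one' := by ext x <;> simp
  map_mul' g h := by ext x <;> simp [sub_sub, add_comm]

theorem permOne_permTwo (g h : Multiplicative (ZMod N)) (x : ZMod N × ZMod N) :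
    permOne N g (permTwo N h x) = permTwo N h (permOne N g x) := rfl

/-- The action of `ℤ/N` on `O_{N²}` generated by `β₁(S_kl) = S_{k-1, l}`. -/
def betaOneCuntz : Multiplicative (ZMod N) →* (CuntzSq N →⋆ₙₐ[ℂ] CuntzSq N) :=
  cuntzAction (permOne N)

/-- The action of `ℤ/N` on `O_{N²}` generated by `β₂(S_kl) = S_{k, l-1}`. -/
def betaTwoCuntz : Multiplicative (ZMod N) →* (CuntzSq N →⋆ₙₐ[ℂ] CuntzSq N) :=
  cuntzAction (permTwo N)

theorem betaCuntz_comm (g h : Multiplicative (ZMod N)) (a : CuntzSq N) :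
    betaOneCuntz N g (betaTwoCuntz N h a) = betaTwoCuntz N h (betaOneCuntz N g a) :=
  UniversalCStarAlgebra.commute_of_gen (fun x => by
    simp only [betaOneCuntz, betaTwoCuntz, cuntzAction, UniversalCStarAlgebra.action_gen,
      permOne_permTwo]) a

/-- The action of `ℤ/N` on the free product of `N²` copies of `C(S¹)` generated by
`β₁(S_kl) = S_{k-1, l}`, where `S_kl` is the canonical unitary of the copy with index `(k, l)`. -/
def betaOneFree : Multiplicative (ZMod N) →* (FreeCircleSq N →⋆ₙₐ[ℂ] FreeCircleSq N) :=
  freeProductAction (permOne N)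

/-- The action of `ℤ/N` on the free product of `N²` copies of `C(S¹)` generated by
`β₂(S_kl) = S_{k, l-1}`. -/
def betaTwoFree : Multiplicative (ZMod N) →* (FreeCircleSq N →⋆ₙₐ[ℂ] FreeCircleSq N) :=
  freeProductAction (permTwo N)

theorem betaFree_comm (g h : Multiplicative (ZMod N)) (a : FreeCircleSq N) :
    betaOneFree N g (betaTwoFree N h a) = betaTwoFree N h (betaOneFree N g a) :=
  UniversalCStarAlgebra.commute_of_gen (fun x => by
    simp only [betaOneFree, betaTwoFree, freeProductAction, UniversalCStarAlgebra.action_gen,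
      permOne_permTwo]) a

end Classical

end

/-!
With the generalized Pauli matrices `X`, `Z`, the unitaries `U_ab = X⁻ᵃ Zᵇ` form a unitary error
basis of `M_N(ℂ)`. Let `A` be `𝒪_{N²}` or the free product of circles, with generators `T_ab`, let
`B` be the corresponding quantum Cuntz-Krieger algebra and let `V ∈ M_N(B)` be the matrix of its
generators. The defining relations of `B` are matrix identities, namely `V V⋆ V = V` together with
`V⋆ V = N ∑ k, (V V⋆)_kk ⊗ 1` (complete graph) or `V⋆ V = V V⋆` (trivial graph). As in quantum
teleportation, the orthogonality relations of the error basis yield `*`-homomorphisms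
`ρ : A → M_N(B)`, `T_x ↦ U_x V U_x⋆`, and `σ : B → M_N(A)`, `V ↦ N⁻¹ ∑ x, T_x ⊗ |U_x⟩⟩⟨⟨U_x|`,
and the composites of `ρ` and `σ` compress to the identity at the maximally entangled vector.

Moreover `ρ` carries the two actions of `ℤ/N` on `A` to the conjugations by the powers of `X` and
`Z⋆`, so `ρ` and `M_N(ℂ)` together define a representation of the iterated crossed product of `A`.
Its range is `M_N(B)` because `σ` exhibits every entry `b ∈ B` as a sum of entries of elements of
`ρ(A)`. It is faithful because the expectation `E(m) = N⁻¹ ∑ i j, σ(m_ij)_ij` satisfies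
`E(ρ(a) w) = tr(w) a` for matrices `w` of scalars and the words in `X` and `Z` are orthonormal for
the trace. The roles of `(A, ρ)` and `(B, σ)` can be exchanged, which gives the other isomorphism.
-/

noncomputable section

open scoped CStarAlgebra

section Generation

variable {A : Type*} [NonUnitalCStarAlgebra A]

theorem mem_of_dense_adjoin {s : Set A} (hs : Dense (NonUnitalStarAlgebra.adjoin ℂ s : Set A))
    {S : NonUnitalStarSubalgebra ℂ A} (hS : IsClosed (S : Set A)) (hsS : s ⊆ S) (a : A) : a ∈ S :=
  closure_minimal (NonUnitalStarAlgebra.adjoin_le hsS) hS (hs a)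

/-- A `*`-homomorphism of C*-algebras as a continuous linear map. -/
def starHomCLM {B : Type*} [NonUnitalCStarAlgebra B] (φ : A →⋆ₙₐ[ℂ] B) : A →L[ℂ] B :=
  ⟨(φ : A →ₗ[ℂ] B), map_continuous φ⟩

end Generation

namespace UniversalCStarAlgebra

open CStarRelation

variable {X : Type} {R : CStarRelation X} [R.IsBounded]

theorem dense_adjoin_range_gen :
    Dense (NonUnitalStarAlgebra.adjoin ℂ (Set.range (gen R)) : Set (UniversalCStarAlgebra R)) := by
  have eval_mem (p : StarPoly X) :
      p.eval (gen R) ∈ NonUnitalStarAlgebra.adjoin ℂ (Set.range (gen R)) := by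
    induction p with
    | gen x => exact NonUnitalStarAlgebra.subset_adjoin ℂ _ ⟨x, rfl⟩
    | zero => exact zero_mem _
    | add p q hp hq => exact add_mem hp hq
    | neg p hp => exact neg_mem hp
    | smul c p hp => exact SMulMemClass.smul_mem c hp
    | mul p q hp hq => exact mul_mem hp hq
    | adj p hp => exact star_mem hp
  refine denseRange_ofPre.mono (Set.range_subset_iff.2 (Pre.ind fun p => ?_))
  rw [ofPre_mk]
  exact eval_mem p

/-- This is how one checks that the universal family itself satisfies a relation. -/
theorem eq_of_forall_hom_eq {x y : UniversalCStarAlgebra R}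
    (h : ∀ (D : Type) [NonUnitalCStarAlgebra D] (π : UniversalCStarAlgebra R →⋆ₙₐ[ℂ] D),
      R.Holds (fun i => π (gen R i)) → π x = π y) : x = y := by
  refine sub_eq_zero.1 (norm_le_zero_iff.1 (le_of_forall_pos_le_add fun ε hε => ?_))
  obtain ⟨a, hp⟩ := denseRange_ofPre.exists_dist_lt (x - y) (half_pos hε)
  obtain ⟨p, rfl⟩ : ∃ p, Pre.mk R p = a := Quotient.exists_rep a
  rw [ofPre_mk, dist_eq_norm] at hp
  have norm_le : ‖p.eval (gen R)‖ ≤ ε / 2 := by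
    rw [norm_eval_gen]
    refine Pre.norm_mk_le (half_pos hε).le fun D _ s hs => ?_
    have lift_eq : lift s hs x = lift s hs y := h D (lift s hs) (by simpa only [lift_gen] using hs)
    have lift_eval : lift s hs (p.eval (gen R)) = p.eval s := by
      rw [← ofPre_mk]
      exact liftCLM_ofPre_mk s _ p
    calc ‖p.eval s‖ = ‖lift s hs (x - y - p.eval (gen R))‖ := by
          rw [map_sub, map_sub, lift_eq, sub_self, zero_sub, norm_neg, lift_eval]
      _ ≤ ε / 2 := (NonUnitalStarAlgHom.norm_apply_le _ _).trans hp.le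
  calc ‖x - y‖ = ‖x - y - p.eval (gen R) + p.eval (gen R)‖ := by rw [sub_add_cancel]
    _ ≤ ε / 2 + ε / 2 := (norm_add_le _ _).trans (add_le_add hp.le norm_le)
    _ = 0 + ε := by ring

end UniversalCStarAlgebra

namespace CrossedProduct

open UniversalCStarAlgebra

section Monomial

variable {G A : Type} [Group G] [NonUnitalCStarAlgebra A] {α : G →* (A →⋆ₙₐ[ℂ] A)}

theorem gen_add (g : G) (a b : A) : gen (crossedProductRelation α) (g, a + b) =
    gen (crossedProductRelation α) (g, a) + gen (crossedProductRelation α) (g, b) :=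
  eq_of_forall_hom_eq fun D _ π ⟨φ, hφ, _⟩ => by simp only [map_add, hφ]

theorem gen_smul (g : G) (c : ℂ) (a : A) : gen (crossedProductRelation α) (g, c • a) =
    c • gen (crossedProductRelation α) (g, a) :=
  eq_of_forall_hom_eq fun D _ π ⟨φ, hφ, _⟩ => by simp only [map_smul, hφ]

theorem gen_mul_gen (g h : G) (a b : A) :
    gen (crossedProductRelation α) (g, a) * gen (crossedProductRelation α) (h, b) =
      gen (crossedProductRelation α) (g * h, a * α g b) :=
  eq_of_forall_hom_eq fun D _ π ⟨φ, hφ, hmul, _⟩ => by simp only [map_mul, hφ, hmul]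

theorem star_gen (g : G) (a : A) : star (gen (crossedProductRelation α) (g, a)) =
    gen (crossedProductRelation α) (g⁻¹, α g⁻¹ (star a)) :=
  eq_of_forall_hom_eq fun D _ π ⟨φ, hφ, _, hstar⟩ => by simp only [map_star, hφ, hstar]

theorem norm_gen_le (g : G) (a : A) : ‖gen (crossedProductRelation α) (g, a)‖ ≤ ‖a‖ := by
  let π : A →⋆ₙₐ[ℂ] CrossedProduct α :=
    { toFun a := gen (crossedProductRelation α) (1, a)
      map_smul' := gen_smul 1
      map_zero' := by simpa using gen_smul (α := α) 1 0 0
      map_add' := gen_add 1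
      map_mul' a b := by rw [gen_mul_gen, mul_one, map_one]; rfl
      map_star' a := by rw [star_gen, inv_one, map_one]; rfl }
  refine (mul_self_le_mul_self_iff (norm_nonneg _) (norm_nonneg _)).2 ?_
  calc ‖gen (crossedProductRelation α) (g, a)‖ * ‖gen (crossedProductRelation α) (g, a)‖
      = ‖π (α g⁻¹ (star a * a))‖ := by
        rw [← CStarRing.norm_star_mul_self, star_gen, gen_mul_gen, inv_mul_cancel, map_mul]; rfl
    _ ≤ ‖star a * a‖ :=
        (NonUnitalStarAlgHom.norm_apply_le π _).trans (NonUnitalStarAlgHom.norm_apply_le (α g⁻¹) _)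
    _ = ‖a‖ * ‖a‖ := CStarRing.norm_star_mul_self

variable (α) in
/-- The element `a u_g` of a crossed product, as a continuous linear function of `a`. -/
def monomial (g : G) : A →L[ℂ] CrossedProduct α :=
  LinearMap.mkContinuous
    { toFun a := gen (crossedProductRelation α) (g, a)
      map_add' := gen_add g
      map_smul' := gen_smul g } 1
    fun a => by rw [one_mul]; exact norm_gen_le g a

theorem monomial_mul_monomial (g h : G) (a b : A) :
    monomial α g a * monomial α h b = monomial α (g * h) (a * α g b) := gen_mul_gen g h a b

theorem mem_of_monomial_mem {P : Submodule ℂ (CrossedProduct α)}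
    (hP : IsClosed (P : Set (CrossedProduct α))) (hmem : ∀ g a, monomial α g a ∈ P)
    (x : CrossedProduct α) : x ∈ P := by
  let monomials : Subsemigroup (CrossedProduct α) :=
    { carrier := Set.range fun p : G × A => monomial α p.1 p.2
      mul_mem' := by
        rintro _ _ ⟨p, rfl⟩ ⟨q, rfl⟩
        exact ⟨(p.1 * q.1, p.2 * α p.1 q.2), (monomial_mul_monomial _ _ _ _).symm⟩ }
  have gen_mem : Set.range (gen (crossedProductRelation α)) ⊆ monomials := by
    rintro _ ⟨p, rfl⟩
    exact ⟨p, rfl⟩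
  have star_gen_mem : star (Set.range (gen (crossedProductRelation α))) ⊆ monomials := by
    rintro y ⟨p, hp⟩
    exact ⟨(p.1⁻¹, α p.1⁻¹ (star p.2)), by rw [← star_star y, ← hp]; exact (star_gen _ _).symm⟩
  refine closure_minimal (fun y hy => ?_) hP (dense_adjoin_range_gen x)
  rw [SetLike.mem_coe, ← NonUnitalStarSubalgebra.mem_toNonUnitalSubalgebra,
    ← NonUnitalSubalgebra.mem_toSubmodule, NonUnitalStarAlgebra.adjoin_eq_span] at hy
  refine Submodule.span_le.2 ?_ hy
  intro z hz
  obtain ⟨p, rfl⟩ := Subsemigroup.closure_le.2 (Set.union_subset gen_mem star_gen_mem) hz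
  exact hmem p.1 p.2

theorem clm_ext {F : Type*} [AddCommGroup F] [Module ℂ F] [TopologicalSpace F] [T1Space F]
    [IsTopologicalAddGroup F] {f f' : CrossedProduct α →L[ℂ] F}
    (h : ∀ g a, f (monomial α g a) = f' (monomial α g a)) : f = f' := by
  ext x
  have mem_ker : x ∈ (f - f').ker :=
    mem_of_monomial_mem (f - f').isClosed_ker (fun g a => sub_eq_zero.2 (h g a)) x
  exact sub_eq_zero.1 mem_ker

end Monomial

section Lift

variable {G A E : Type} [Group G] [NonUnitalCStarAlgebra A] [CStarAlgebra E]
  {α : G →* (A →⋆ₙₐ[ℂ] A)} (ρ : A →⋆ₙₐ[ℂ] E) (u : G →* unitary E)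
  (hρu : ∀ g a, (u g : E) * ρ a = ρ (α g a) * u g)

/-- The `*`-homomorphism `a u_g ↦ ρ(a) u(g)` defined by a covariant pair `(ρ, u)`. -/
def lift : CrossedProduct α →⋆ₙₐ[ℂ] E :=
  UniversalCStarAlgebra.lift (R := crossedProductRelation α) (fun p => ρ p.2 * u p.1)
    ⟨fun g => LinearMap.mulRight ℂ (u g : E) ∘ₗ (ρ : A →ₗ[ℂ] E), fun _ _ => rfl,
      fun g h a b => by
        change ρ a * u g * (ρ b * u h) = ρ (a * α g b) * u (g * h)
        rw [map_mul ρ, map_mul u, Submonoid.coe_mul, mul_assoc, ← mul_assoc (u g : E), hρu]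
        simp only [mul_assoc],
      fun g a => by
        change star (ρ a * u g) = ρ (α g⁻¹ (star a)) * u g⁻¹
        rw [star_mul, ← hρu, map_star ρ, map_inv, ← Unitary.star_eq_inv, Unitary.coe_star]⟩

theorem lift_monomial (g : G) (a : A) : lift ρ u hρu (monomial α g a) = ρ a * u g :=
  UniversalCStarAlgebra.lift_gen _ _ _

variable [Fintype G] (c : E →L[ℂ] A)

variable (α) in
/-- The expectation `m ↦ ∑ g, c(m u(g)⁻¹) u_g` onto the crossed product extending an expectation
`c` onto the algebra which is acted on. -/
def coeffSum : E →L[ℂ] CrossedProduct α :=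
  ∑ g, monomial α g ∘L c ∘L (ContinuousLinearMap.mul ℂ E).flip (u g⁻¹ : E)

theorem coeffSum_apply (m : E) : coeffSum α u c m = ∑ g, monomial α g (c (m * u g⁻¹)) := by
  simp [coeffSum]

variable [DecidableEq G]

theorem coeffSum_lift {c : E →L[ℂ] A} (hc : ∀ g a, c (ρ a * u g) = if g = 1 then a else 0)
    (x : CrossedProduct α) : coeffSum α u c (lift ρ u hρu x) = x := by
  suffices h : coeffSum α u c ∘L starHomCLM (lift ρ u hρu) = .id ℂ _ from congr($h x)
  refine clm_ext fun g a => ?_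
  have coeff (h : G) : c (lift ρ u hρu (monomial α g a) * u h⁻¹) = if g = h then a else 0 := by
    rw [lift_monomial, mul_assoc, ← Submonoid.coe_mul, ← map_mul, hc]
    simp only [mul_inv_eq_one]
  change coeffSum α u c (lift ρ u hρu (monomial α g a)) = monomial α g a
  rw [coeffSum_apply, Finset.sum_eq_single g, coeff, if_pos rfl]
  · intro h _ hne
    rw [coeff, if_neg hne.symm, map_zero]
  · exact fun hg => absurd (Finset.mem_univ g) hg

end Lift

end CrossedProduct

section UnitaryErrorBasis

/-- Unitary error bases of `M_n(ℂ)`: families of unitaries which are an orthogonal basis for the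
trace inner product. -/
structure IsUnitaryErrorBasis {n ι : Type*} [Fintype n] [DecidableEq n] [Fintype ι] [DecidableEq ι]
    (U : ι → unitary (CStarMatrix n n ℂ)) : Prop where
  orthogonal : ∀ x y, ∑ i, ∑ j, star ((U x : CStarMatrix n n ℂ) i j) * (U y : CStarMatrix n n ℂ) i j
    = if x = y then (Fintype.card n : ℂ) else 0
  complete : ∀ i j k l,
    ∑ x, star ((U x : CStarMatrix n n ℂ) i j) * (U x : CStarMatrix n n ℂ) k l
      = if i = k ∧ j = l then (Fintype.card n : ℂ) else 0

theorem cstarMatrix_sum_apply {m n ι A : Type*} [AddCommMonoid A] (s : Finset ι)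
    (M : ι → CStarMatrix m n A) (i : m) (j : n) : (∑ x ∈ s, M x) i j = ∑ x ∈ s, M x i j :=
  Matrix.sum_apply i j s M

theorem IsUnitaryErrorBasis.span_eq_top {n ι : Type*} [Fintype n] [DecidableEq n] [Fintype ι]
    [DecidableEq ι] {U : ι → unitary (CStarMatrix n n ℂ)} (hU : IsUnitaryErrorBasis U) :
    Submodule.span ℂ (Set.range fun x => (U x : CStarMatrix n n ℂ)) = ⊤ := by
  refine Submodule.eq_top_iff'.2 fun w => ?_
  suffices expansion : w = ∑ x, ((Fintype.card n : ℂ)⁻¹ * ∑ i, ∑ j,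
      star ((U x : CStarMatrix n n ℂ) i j) * w i j) • (U x : CStarMatrix n n ℂ) by
    rw [expansion]
    exact sum_mem fun x _ => Submodule.smul_mem _ _ (Submodule.subset_span ⟨x, rfl⟩)
  ext k l
  have card_ne_zero : (Fintype.card n : ℂ) ≠ 0 :=
    Nat.cast_ne_zero.2 (Fintype.card_pos_iff.2 ⟨k⟩).ne'
  rw [cstarMatrix_sum_apply]
  calc w k l = (Fintype.card n : ℂ)⁻¹ * ∑ i, ∑ j, ∑ x,
        star ((U x : CStarMatrix n n ℂ) i j) * (U x : CStarMatrix n n ℂ) k l * w i j := by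
        simp only [← Finset.sum_mul, hU.complete, ite_mul, zero_mul, ite_and, Finset.sum_ite_eq',
          Finset.sum_ite_irrel, Finset.mem_univ, if_true, Finset.sum_const_zero]
        rw [inv_mul_cancel_left₀ card_ne_zero]
    _ = _ := by
        simp only [CStarMatrix.smul_apply, smul_eq_mul, Finset.mul_sum, Finset.sum_mul]
        rw [Finset.sum_comm_cycle]
        refine Finset.sum_congr rfl fun x _ => Finset.sum_congr rfl fun i _ =>
          Finset.sum_congr rfl fun j _ => by ring

end UnitaryErrorBasis

section Pauli

variable {N : ℕ} [NeZero N]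

theorem star_stdAddChar (t : ZMod N) : star (ZMod.stdAddChar t : ℂ) = ZMod.stdAddChar (-t) :=
  (AddChar.map_neg_eq_conj _ _).symm

theorem sum_stdAddChar_mul (t : ZMod N) :
    ∑ i, (ZMod.stdAddChar (i * t) : ℂ) = if t = 0 then (N : ℂ) else 0 := by
  rw [AddChar.sum_mulShift t (ZMod.isPrimitive_stdAddChar N), ZMod.card]
  simp only [Nat.cast_ite, Nat.cast_zero]

theorem mem_unitary_of_star_eq_map_inv {G M : Type*} [Group G] [Monoid M] [StarMul M] (f : G →* M)
    (hf : ∀ g, star (f g) = f g⁻¹) (g : G) : f g ∈ unitary M := by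
  rw [Unitary.mem_iff, hf, ← map_mul, ← map_mul, inv_mul_cancel, mul_inv_cancel, map_one]
  exact ⟨rfl, rfl⟩

/-- The clock matrices `diag(ω ^ (g i))`, the powers of the generalized Pauli matrix `X`. -/
def clockMatrix : Multiplicative (ZMod N) →* MatN N where
  toFun g := CStarMatrix.ofMatrix fun i k => if i = k then ZMod.stdAddChar (g.toAdd * i) else 0
  map_one' := by
    ext i k
    change (if i = k then (ZMod.stdAddChar (0 * i) : ℂ) else 0) = if i = k then 1 else 0
    rw [zero_mul, AddChar.map_zero_eq_one]
  map_mul' g h := by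
    ext i k
    rw [CStarMatrix.mul_apply]
    change (if i = k then (ZMod.stdAddChar ((g.toAdd + h.toAdd) * i) : ℂ) else 0) =
      ∑ j, (if i = j then ZMod.stdAddChar (g.toAdd * i) else 0) *
        if j = k then (ZMod.stdAddChar (h.toAdd * j) : ℂ) else 0
    simp only [add_mul, AddChar.map_add_eq_mul, ite_mul, zero_mul, Finset.sum_ite_eq,
      Finset.mem_univ, if_true]
    rw [mul_ite, mul_zero]

/-- The shift matrices, the powers of the adjoint of the generalized Pauli matrix `Z`. -/
def shiftMatrix : Multiplicative (ZMod N) →* MatN N where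
  toFun h := CStarMatrix.ofMatrix fun i k => if k = i + h.toAdd then 1 else 0
  map_one' := by
    ext i k
    change (if k = i + 0 then (1 : ℂ) else 0) = if i = k then 1 else 0
    simp only [add_zero, eq_comm]
  map_mul' g h := by
    ext i k
    rw [CStarMatrix.mul_apply]
    change (if k = i + (g.toAdd + h.toAdd) then (1 : ℂ) else 0) =
      ∑ j, (if j = i + g.toAdd then 1 else 0) * if k = j + h.toAdd then (1 : ℂ) else 0
    simp only [ite_mul, one_mul, zero_mul, Finset.sum_ite_eq', Finset.mem_univ, if_true,
      add_assoc]

theorem clockMatrix_apply (g : Multiplicative (ZMod N)) (i k : ZMod N) :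
    clockMatrix g i k = if i = k then (ZMod.stdAddChar (g.toAdd * i) : ℂ) else 0 := rfl

theorem shiftMatrix_apply (h : Multiplicative (ZMod N)) (i k : ZMod N) :
    shiftMatrix h i k = if k = i + h.toAdd then (1 : ℂ) else 0 := rfl

/-- The clock matrices as a unitary representation of `ℤ/N`. -/
def clock : Multiplicative (ZMod N) →* unitary (MatN N) :=
  clockMatrix.codRestrict _ <| mem_unitary_of_star_eq_map_inv _ fun g => by
    ext i k
    rw [CStarMatrix.star_apply, clockMatrix_apply, clockMatrix_apply, apply_ite star,
      star_stdAddChar, star_zero, toAdd_inv, neg_mul]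
    split_ifs <;> simp_all

/-- The shift matrices as a unitary representation of `ℤ/N`. -/
def translation : Multiplicative (ZMod N) →* unitary (MatN N) :=
  shiftMatrix.codRestrict _ <| mem_unitary_of_star_eq_map_inv _ fun h => by
    ext i k
    rw [CStarMatrix.star_apply, shiftMatrix_apply, shiftMatrix_apply, apply_ite star, star_one,
      star_zero, toAdd_inv, ← sub_eq_add_neg]
    exact if_congr (by rw [eq_sub_iff_add_eq, eq_comm]) rfl rfl

theorem clock_apply (g : Multiplicative (ZMod N)) (i k : ZMod N) :
    (clock g : MatN N) i k = if i = k then (ZMod.stdAddChar (g.toAdd * i) : ℂ) else 0 := rfl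

theorem translation_apply (h : Multiplicative (ZMod N)) (i k : ZMod N) :
    (translation h : MatN N) i k = if k = i + h.toAdd then (1 : ℂ) else 0 := rfl

theorem clock_mul_translation_apply (g h : Multiplicative (ZMod N)) (i k : ZMod N) :
    (clock g * translation h : MatN N) i k =
      if k = i + h.toAdd then (ZMod.stdAddChar (g.toAdd * i) : ℂ) else 0 := by
  rw [CStarMatrix.mul_apply]
  simp only [clock_apply, ite_mul, zero_mul, Finset.sum_ite_eq, Finset.mem_univ, if_true]
  rw [translation_apply, mul_ite, mul_one, mul_zero]

theorem translation_mul_clock (g h : Multiplicative (ZMod N)) :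
    (translation h * clock g : MatN N) =
      (ZMod.stdAddChar (h.toAdd * g.toAdd) : ℂ) • (clock g * translation h : MatN N) := by
  ext i k
  rw [CStarMatrix.smul_apply, clock_mul_translation_apply, smul_eq_mul, mul_ite,
    ← AddChar.map_add_eq_mul, mul_comm h.toAdd, ← mul_add, add_comm h.toAdd, mul_zero]
  simp only [CStarMatrix.mul_apply, clock_apply, translation_apply, ite_mul, one_mul, zero_mul,
    Finset.sum_ite_eq', Finset.mem_univ, if_true]
  split_ifs <;> simp_all

/-- The unitary error basis of `M_N(ℂ)` consisting of the generalized Pauli matrices. -/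
def pauli (p : ZMod N × ZMod N) : unitary (MatN N) :=
  clock (.ofAdd (-p.1)) * translation (.ofAdd (-p.2))

theorem pauli_apply (a b i k : ZMod N) :
    (pauli (a, b) : MatN N) i k = if k = i - b then (ZMod.stdAddChar (-(a * i)) : ℂ) else 0 := by
  rw [pauli, Submonoid.coe_mul, clock_mul_translation_apply, toAdd_ofAdd, toAdd_ofAdd, neg_mul,
    sub_eq_add_neg]

theorem isUnitaryErrorBasis_pauli : IsUnitaryErrorBasis (pauli (N := N)) where
  orthogonal := by
    rintro ⟨a, b⟩ ⟨a', b'⟩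
    simp only [pauli_apply, apply_ite star, star_stdAddChar, star_zero, neg_neg, ZMod.card]
    calc _ = ∑ i, if b = b' then (ZMod.stdAddChar (i * (a - a')) : ℂ) else 0 := by
          refine Finset.sum_congr rfl fun i _ => ?_
          have char_eq : (ZMod.stdAddChar (i * (a - a')) : ℂ) =
              ZMod.stdAddChar (a * i) * ZMod.stdAddChar (-(a' * i)) := by
            rw [← AddChar.map_add_eq_mul]; ring_nf
          simp only [char_eq, ite_mul, zero_mul, Finset.sum_ite_eq', Finset.mem_univ, if_true,
            mul_ite, mul_zero, sub_right_inj, eq_comm]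
      _ = if b = b' then if a - a' = 0 then (N : ℂ) else 0 else 0 := by
          rw [Finset.sum_ite_irrel, Finset.sum_const_zero, sum_stdAddChar_mul]
      _ = _ := by
          simp only [← ite_and, Prod.mk.injEq, sub_eq_zero, and_comm]
  complete i j k l := by
    simp only [Fintype.sum_prod_type, pauli_apply, apply_ite star, star_stdAddChar, star_zero,
      neg_neg, ZMod.card]
    calc _ = ∑ a, if l = k - (i - j) then (ZMod.stdAddChar (a * (i - k)) : ℂ) else 0 := by
          refine Finset.sum_congr rfl fun a _ => ?_
          have char_eq : (ZMod.stdAddChar (a * (i - k)) : ℂ) =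
              ZMod.stdAddChar (a * i) * ZMod.stdAddChar (-(a * k)) := by
            rw [← AddChar.map_add_eq_mul]; ring_nf
          have eq_iff (b : ZMod N) : j = i - b ↔ b = i - j := by grind
          simp only [char_eq, eq_iff, ite_mul, zero_mul, Finset.sum_ite_eq', Finset.mem_univ,
            if_true]
          rw [mul_ite, mul_zero]
      _ = if l = k - (i - j) then if i - k = 0 then (N : ℂ) else 0 else 0 := by
          rw [Finset.sum_ite_irrel, Finset.sum_const_zero, sum_stdAddChar_mul]
      _ = _ := by
          rw [← ite_and]
          exact if_congr (by grind) rfl rfl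

theorem normTrace_clock_mul_translation (g h : Multiplicative (ZMod N)) :
    normTrace N (clock g * translation h) = if g = 1 ∧ h = 1 then 1 else 0 := by
  have N_ne_zero : (N : ℂ) ≠ 0 := Nat.cast_ne_zero.2 (NeZero.ne N)
  calc normTrace N (clock g * translation h)
      = (N : ℂ)⁻¹ * ∑ i, if h.toAdd = 0 then (ZMod.stdAddChar (i * g.toAdd) : ℂ) else 0 := by
        simp only [normTrace, LinearMap.coe_mk, AddHom.coe_mk, clock_mul_translation_apply,
          left_eq_add, mul_comm g.toAdd]
    _ = if g = 1 ∧ h = 1 then 1 else 0 := by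
        rw [Finset.sum_ite_irrel, Finset.sum_const_zero, sum_stdAddChar_mul, ← ite_and, mul_ite,
          inv_mul_cancel₀ N_ne_zero, mul_zero]
        simp only [toAdd_eq_zero, and_comm]

theorem normTrace_clock_mul_translation_mul_clock_inv (g h g' : Multiplicative (ZMod N)) :
    normTrace N (clock g * translation h * clock g'⁻¹ : MatN N) =
      if g = g' then if h = 1 then 1 else 0 else 0 := by
  rw [mul_assoc, translation_mul_clock, mul_smul_comm, map_smul, ← mul_assoc, ← Submonoid.coe_mul,
    ← map_mul clock, normTrace_clock_mul_translation, ← ite_and]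
  simp only [mul_inv_eq_one]
  split_ifs with hgh
  · rw [hgh.2, toAdd_one, zero_mul, AddChar.map_zero_eq_one, one_smul]
  · exact smul_zero _

theorem span_clock_mul_translation :
    Submodule.span ℂ (Set.range fun p : Multiplicative (ZMod N) × Multiplicative (ZMod N) =>
      (clock p.1 * translation p.2 : MatN N)) = ⊤ := by
  refine top_le_iff.1 (isUnitaryErrorBasis_pauli.span_eq_top.ge.trans (Submodule.span_mono ?_))
  rintro _ ⟨p, rfl⟩
  exact ⟨(.ofAdd (-p.1), .ofAdd (-p.2)), rfl⟩

end Pauli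

/-- The group homomorphism between the unitary groups induced by a unital `*`-homomorphism. -/
def unitaryMap {M E : Type*} [Ring M] [StarRing M] [Algebra ℂ M] [Ring E] [StarRing E] [Algebra ℂ E]
    (θ : M →⋆ₐ[ℂ] E) : unitary M →* unitary E :=
  (Unitary.map { (θ : M →* E) with map_star' := map_star θ }).toMonoidHom

namespace DoubleCrossedProduct

open CrossedProduct

variable {N : ℕ} [NeZero N] {A E : Type} [NonUnitalCStarAlgebra A] [CStarAlgebra E]
  {γ₁ γ₂ : Multiplicative (ZMod N) →* (A →⋆ₙₐ[ℂ] A)} (hγ : ∀ g h a, γ₁ g (γ₂ h a) = γ₂ h (γ₁ g a))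
  (ρ : A →⋆ₙₐ[ℂ] E) (θ : MatN N →⋆ₐ[ℂ] E)
  (hclock : ∀ g a, θ (clock g) * ρ a = ρ (γ₁ g a) * θ (clock g))
  (htranslation : ∀ h a, θ (translation h) * ρ a = ρ (γ₂ h a) * θ (translation h))

theorem extendedAction_monomial (h g : Multiplicative (ZMod N)) (a : A) :
    extendedAction γ₁ γ₂ hγ h (monomial γ₁ g a) =
      (ZMod.stdAddChar (h.toAdd * g.toAdd) : ℂ) • monomial γ₁ g (γ₂ h a) := by
  rw [← map_smul]
  exact UniversalCStarAlgebra.action_gen ..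

/-- The `*`-homomorphism `a u_g ↦ ρ(a) θ(clock g)`. -/
def innerLift : CrossedProduct γ₁ →⋆ₙₐ[ℂ] E :=
  CrossedProduct.lift ρ ((unitaryMap θ).comp clock) hclock

theorem innerLift_monomial (g : Multiplicative (ZMod N)) (a : A) :
    innerLift ρ θ hclock (monomial γ₁ g a) = ρ a * θ (clock g) :=
  lift_monomial ρ _ _ g a

include htranslation in
theorem translation_mul_innerLift (h : Multiplicative (ZMod N)) (x : CrossedProduct γ₁) :
    θ (translation h) * innerLift ρ θ hclock x =
      innerLift ρ θ hclock (extendedAction γ₁ γ₂ hγ h x) * θ (translation h) := by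
  suffices eq : ContinuousLinearMap.mul ℂ E (θ (translation h)) ∘L
      starHomCLM (innerLift ρ θ hclock) =
    (ContinuousLinearMap.mul ℂ E).flip (θ (translation h)) ∘L
      starHomCLM ((innerLift ρ θ hclock).comp (extendedAction γ₁ γ₂ hγ h)) from congr($eq x)
  refine clm_ext fun g a => ?_
  change θ (translation h) * innerLift ρ θ hclock (monomial γ₁ g a) =
    innerLift ρ θ hclock (extendedAction γ₁ γ₂ hγ h (monomial γ₁ g a)) * θ (translation h)
  calc _ = θ (translation h) * ρ a * θ (clock g) := by rw [innerLift_monomial, mul_assoc]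
    _ = ρ (γ₂ h a) * θ (translation h * clock g : MatN N) := by
      rw [htranslation, map_mul, mul_assoc]
    _ = (ZMod.stdAddChar (h.toAdd * g.toAdd) : ℂ) •
        (ρ (γ₂ h a) * θ (clock g) * θ (translation h)) := by
      rw [translation_mul_clock, map_smul, map_mul θ, mul_smul_comm, mul_assoc]
    _ = _ := by rw [extendedAction_monomial, map_smul, innerLift_monomial, smul_mul_assoc]

/-- The `*`-homomorphism `a u_g v_h ↦ ρ(a) θ(clock g * translation h)`. -/
def lift : DoubleCrossedProduct γ₁ γ₂ hγ →⋆ₙₐ[ℂ] E :=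
  CrossedProduct.lift (innerLift ρ θ hclock) ((unitaryMap θ).comp translation)
    (translation_mul_innerLift hγ ρ θ hclock htranslation)

theorem lift_monomial_monomial (g h : Multiplicative (ZMod N)) (a : A) :
    lift hγ ρ θ hclock htranslation (monomial _ h (monomial γ₁ g a)) =
      ρ a * θ (clock g * translation h) := by
  refine (lift_monomial _ _ _ h _).trans ?_
  rw [innerLift_monomial, mul_assoc, map_mul]
  rfl

theorem lift_mem {P : NonUnitalStarSubalgebra ℂ E} (hP : IsClosed (P : Set E))
    (hmem : ∀ a w, ρ a * θ w ∈ P) (x : DoubleCrossedProduct γ₁ γ₂ hγ) :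
    lift hγ ρ θ hclock htranslation x ∈ P := by
  let liftCLM := starHomCLM (lift hγ ρ θ hclock htranslation)
  refine mem_of_monomial_mem (P := P.toSubmodule.comap liftCLM.toLinearMap)
    (hP.preimage liftCLM.continuous) (fun h y => ?_) x
  refine mem_of_monomial_mem (hP.preimage (liftCLM ∘L monomial _ h).continuous)
    (P := P.toSubmodule.comap (liftCLM ∘L monomial _ h).toLinearMap) (fun g a => ?_) y
  change lift hγ ρ θ hclock htranslation (monomial _ h (monomial γ₁ g a)) ∈ P
  rw [lift_monomial_monomial]
  exact hmem a _

theorem mul_mem_range_lift (a : A) (w : MatN N) :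
    ρ a * θ w ∈ NonUnitalStarAlgHom.range (lift hγ ρ θ hclock htranslation) := by
  induction (span_clock_mul_translation (N := N)).ge (Submodule.mem_top (x := w))
    using Submodule.span_induction with
  | mem w hw =>
    obtain ⟨⟨g, h⟩, rfl⟩ := hw
    exact ⟨_, lift_monomial_monomial hγ ρ θ hclock htranslation g h a⟩
  | zero => rw [map_zero, mul_zero]; exact zero_mem _
  | add w w' _ _ hw hw' => rw [map_add, mul_add]; exact add_mem hw hw'
  | smul c w _ hw => rw [map_smul, mul_smul_comm]; exact SMulMemClass.smul_mem c hw

theorem mul_mul_mem_range_lift (w : MatN N) (a : A) (w' : MatN N) :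
    θ w * ρ a * θ w' ∈ NonUnitalStarAlgHom.range (lift hγ ρ θ hclock htranslation) := by
  induction (span_clock_mul_translation (N := N)).ge (Submodule.mem_top (x := w))
    using Submodule.span_induction with
  | mem w hw =>
    obtain ⟨⟨g, h⟩, rfl⟩ := hw
    have commute : θ (clock g * translation h) * ρ a =
        ρ (γ₁ g (γ₂ h a)) * θ (clock g * translation h) := by
      rw [map_mul, mul_assoc, htranslation, ← mul_assoc, hclock, mul_assoc]
    rw [commute, mul_assoc, ← map_mul]
    exact mul_mem_range_lift ..
  | zero => rw [map_zero, zero_mul, zero_mul]; exact zero_mem _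
  | add w₁ w₂ _ _ h₁ h₂ => rw [map_add, add_mul, add_mul]; exact add_mem h₁ h₂
  | smul c w _ hw => rw [map_smul, smul_mul_assoc, smul_mul_assoc]; exact SMulMemClass.smul_mem c hw

theorem lift_injective {c : E →L[ℂ] A} (hc : ∀ a w, c (ρ a * θ w) = normTrace N w • a) :
    Function.Injective (lift hγ ρ θ hclock htranslation) := by
  let innerExpectation := coeffSum γ₁ ((unitaryMap θ).comp clock) c
  refine Function.LeftInverse.injective (coeffSum_lift (c := innerExpectation) _ _ _ fun h x => ?_)
  suffices eq : innerExpectation ∘L (ContinuousLinearMap.mul ℂ E).flip (θ (translation h)) ∘L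
      starHomCLM (innerLift ρ θ hclock) = if h = 1 then .id ℂ _ else 0 by
    refine congr($eq x).trans ?_
    split_ifs <;> rfl
  refine clm_ext fun g a => ?_
  calc innerExpectation (innerLift ρ θ hclock (monomial γ₁ g a) * θ (translation h))
      = ∑ g', monomial γ₁ g' (c (ρ a * θ (clock g * translation h * clock g'⁻¹ : MatN N))) := by
        rw [coeffSum_apply, innerLift_monomial]
        simp only [map_mul θ, mul_assoc]
        rfl
    _ = (if h = 1 then (1 : ℂ) else 0) • monomial γ₁ g a := by
        simp only [hc, normTrace_clock_mul_translation_mul_clock_inv, ite_smul, zero_smul,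
          apply_ite (monomial _ _), map_zero, Finset.sum_ite_eq, Finset.mem_univ, if_true, map_smul]
    _ = _ := by split_ifs <;> simp

include hclock htranslation in
theorem nonempty_equiv {C : Type} [NonUnitalCStarAlgebra C] {φ : C →⋆ₙₐ[ℂ] E}
    (hφ : Function.Injective φ) (hρθ : ∀ a w, ρ a * θ w ∈ NonUnitalStarAlgHom.range φ)
    (hmem : ∀ P : NonUnitalStarSubalgebra ℂ E, (∀ w a w', θ w * ρ a * θ w' ∈ P) → ∀ x, φ x ∈ P)
    {c : E →L[ℂ] A} (hc : ∀ a w, c (ρ a * θ w) = normTrace N w • a) :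
    Nonempty (C ≃⋆ₐ[ℂ] DoubleCrossedProduct γ₁ γ₂ hγ) := by
  let Φ := lift hγ ρ θ hclock htranslation
  have isClosed_range : IsClosed (NonUnitalStarAlgHom.range φ : Set E) := by
    rw [NonUnitalStarAlgHom.coe_range]
    exact (NonUnitalStarAlgHom.isometry φ hφ).isClosedEmbedding.isClosed_range
  have range_eq : NonUnitalStarAlgHom.range Φ = NonUnitalStarAlgHom.range φ := by
    apply le_antisymm
    · rintro _ ⟨x, rfl⟩
      exact lift_mem hγ ρ θ hclock htranslation isClosed_range hρθ x
    · rintro _ ⟨x, rfl⟩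
      exact hmem _ (mul_mul_mem_range_lift hγ ρ θ hclock htranslation) x
  have equiv := StarAlgEquiv.ofInjective' Φ (lift_injective hγ ρ θ hclock htranslation hc)
  rw [range_eq] at equiv
  exact ⟨(StarAlgEquiv.ofInjective' φ hφ).trans equiv.symm⟩

end DoubleCrossedProduct

section MatrixCStarAlgebra

variable {n A B : Type*} [Fintype n] [NonUnitalCStarAlgebra A] [NonUnitalCStarAlgebra B]

instance (priority := low) cstarMatrixNonUnitalCStarAlgebra :
    NonUnitalCStarAlgebra (CStarMatrix n n A) :=
  @CStarMatrix.instNonUnitalCStarAlgebra A _ (CStarAlgebra.spectralOrder A)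
    (CStarAlgebra.spectralOrderedRing A) n _

instance (priority := low) cstarMatrixCStarAlgebra {D : Type*} [DecidableEq n] [CStarAlgebra D] :
    CStarAlgebra (CStarMatrix n n D) :=
  @CStarMatrix.instCStarAlgebra D _ (CStarAlgebra.spectralOrder D)
    (CStarAlgebra.spectralOrderedRing D) n _ _

/-- The entry of a matrix at a given position, as a continuous linear map. -/
def entryCLM (i j : n) : CStarMatrix n n A →L[ℂ] A :=
  LinearMap.mkContinuous
    { toFun m := m i j, map_add' _ _ := rfl, map_smul' _ _ := rfl } 1 fun m => by
      let _ := CStarAlgebra.spectralOrder A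
      have _ := CStarAlgebra.spectralOrderedRing A
      rw [one_mul]
      exact CStarMatrix.norm_entry_le_norm (M := m)

theorem mapₙₐ_injective {φ : A →⋆ₙₐ[ℂ] B} (hφ : Function.Injective φ) :
    Function.Injective (CStarMatrix.mapₙₐ (n := n) φ) := fun _ _ h =>
  CStarMatrix.ext fun i j => hφ congr($h i j)

end MatrixCStarAlgebra

section ScalarMatrices

variable {n B : Type*} [Fintype n] [NonUnitalCStarAlgebra B]

/-- Matrices over a C*-algebra as matrices over its unitization. -/
def unitizationMatrix : CStarMatrix n n B →⋆ₙₐ[ℂ] CStarMatrix n n B⁺¹ :=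
  CStarMatrix.mapₙₐ (Unitization.inrNonUnitalStarAlgHom ℂ B)

theorem unitizationMatrix_injective :
    Function.Injective (unitizationMatrix (n := n) (B := B)) :=
  mapₙₐ_injective Unitization.inr_injective

/-- The product of a matrix of scalars with a matrix over a C*-algebra without unit. -/
def scalarMul (w : CStarMatrix n n ℂ) (m : CStarMatrix n n B) : CStarMatrix n n B :=
  CStarMatrix.ofMatrix fun i j => ∑ k, w i k • m k j

/-- The product of a matrix over a C*-algebra without unit with a matrix of scalars. -/
def mulScalar (m : CStarMatrix n n B) (w : CStarMatrix n n ℂ) : CStarMatrix n n B :=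
  CStarMatrix.ofMatrix fun i j => ∑ k, w k j • m i k

theorem scalarMul_apply (w : CStarMatrix n n ℂ) (m : CStarMatrix n n B) (i j : n) :
    scalarMul w m i j = ∑ k, w i k • m k j := rfl

theorem mulScalar_apply (m : CStarMatrix n n B) (w : CStarMatrix n n ℂ) (i j : n) :
    mulScalar m w i j = ∑ k, w k j • m i k := rfl

variable [DecidableEq n]

/-- Matrices of scalars as matrices over a unital C*-algebra. -/
def scalarMatrix (D : Type*) [CStarAlgebra D] : CStarMatrix n n ℂ →⋆ₐ[ℂ] CStarMatrix n n D where
  toFun w := w.map (algebraMap ℂ D)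
  map_one' := by
    ext i j
    rw [CStarMatrix.map_apply, CStarMatrix.one_apply, CStarMatrix.one_apply,
      apply_ite (algebraMap ℂ D), map_one, map_zero]
  map_mul' w w' := by
    ext i j
    simp only [CStarMatrix.map_apply, CStarMatrix.mul_apply, map_sum, map_mul]
  map_zero' := by
    ext
    exact map_zero (algebraMap ℂ D)
  map_add' w w' := by
    ext i j
    exact map_add (algebraMap ℂ D) _ _
  commutes' c := by
    ext i j
    rw [CStarMatrix.map_apply, CStarMatrix.algebraMap_apply, CStarMatrix.algebraMap_apply,
      apply_ite (algebraMap ℂ D), map_zero]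
    rfl
  map_star' w := by
    ext i j
    exact algebraMap_star_comm _

theorem unitizationMatrix_scalarMul (w : CStarMatrix n n ℂ) (m : CStarMatrix n n B) :
    unitizationMatrix (scalarMul w m) = scalarMatrix B⁺¹ w * unitizationMatrix m := by
  refine CStarMatrix.ext fun i j => ?_
  rw [CStarMatrix.mul_apply]
  exact (map_sum (Unitization.inrNonUnitalStarAlgHom ℂ B) _ _).trans
    (Finset.sum_congr rfl fun k _ => (Unitization.inl_mul_inr ..).symm)

theorem unitizationMatrix_mulScalar (m : CStarMatrix n n B) (w : CStarMatrix n n ℂ) :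
    unitizationMatrix (mulScalar m w) = unitizationMatrix m * scalarMatrix B⁺¹ w := by
  refine CStarMatrix.ext fun i j => ?_
  rw [CStarMatrix.mul_apply]
  exact (map_sum (Unitization.inrNonUnitalStarAlgHom ℂ B) _ _).trans
    (Finset.sum_congr rfl fun k _ => (Unitization.inr_mul_inl ..).symm)

theorem unitizationMatrix_conj (W : unitary (CStarMatrix n n ℂ)) (m : CStarMatrix n n B) :
    unitizationMatrix (scalarMul W (mulScalar m (star W : CStarMatrix n n ℂ))) =
      scalarMatrix B⁺¹ W * unitizationMatrix m * star (scalarMatrix B⁺¹ W) := by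
  rw [unitizationMatrix_scalarMul, unitizationMatrix_mulScalar, mul_assoc, map_star]

/-- The conjugation of matrices over a C*-algebra by unitary matrices of scalars. -/
def scalarConj : unitary (CStarMatrix n n ℂ) →* (CStarMatrix n n B →⋆ₙₐ[ℂ] CStarMatrix n n B) where
  toFun W :=
    { toFun m := scalarMul W (mulScalar m (star W : CStarMatrix n n ℂ))
      map_smul' c m := unitizationMatrix_injective <| by
        simp only [unitizationMatrix_conj, map_smul, mul_smul_comm, smul_mul_assoc,
          MonoidHom.id_apply]
      map_zero' := unitizationMatrix_injective <| by
        simp only [unitizationMatrix_conj, map_zero, mul_zero, zero_mul]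
      map_add' m m' := unitizationMatrix_injective <| by
        simp only [unitizationMatrix_conj, map_add, mul_add, add_mul]
      map_mul' m m' := unitizationMatrix_injective <| by
        have cancel (x : CStarMatrix n n B⁺¹) :
            star (scalarMatrix B⁺¹ (W : CStarMatrix n n ℂ)) * (scalarMatrix B⁺¹ W * x) = x := by
          rw [← mul_assoc, ← map_star, ← map_mul, Unitary.coe_star_mul_self, map_one, one_mul]
        simp only [unitizationMatrix_conj, map_mul, mul_assoc, cancel]
      map_star' m := unitizationMatrix_injective <| by
        simp only [unitizationMatrix_conj, map_star, star_mul, star_star, mul_assoc] }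
  map_one' := NonUnitalStarAlgHom.ext fun m => unitizationMatrix_injective <| by
    refine (unitizationMatrix_conj 1 m).trans ?_
    rw [OneMemClass.coe_one, map_one, star_one, one_mul, mul_one]
    rfl
  map_mul' W W' := NonUnitalStarAlgHom.ext fun m => unitizationMatrix_injective <| by
    refine (unitizationMatrix_conj _ m).trans
      (Eq.trans ?_ (unitizationMatrix_conj _ (scalarMul _ _)).symm)
    rw [unitizationMatrix_conj, Submonoid.coe_mul, map_mul, star_mul]
    simp only [mul_assoc]

theorem scalarConj_apply (W : unitary (CStarMatrix n n ℂ)) (m : CStarMatrix n n B) (i j : n) :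
    scalarConj W m i j =
      ∑ k, ∑ l, ((W : CStarMatrix n n ℂ) i k * star ((W : CStarMatrix n n ℂ) j l)) • m k l := by
  change scalarMul W (mulScalar m (star W : CStarMatrix n n ℂ)) i j = _
  simp only [scalarMul_apply, mulScalar_apply, Finset.smul_sum, smul_smul, CStarMatrix.star_apply]

theorem scalarMatrix_mul_unitizationMatrix (W : unitary (CStarMatrix n n ℂ))
    (m : CStarMatrix n n B) : scalarMatrix B⁺¹ W * unitizationMatrix m =
      unitizationMatrix (scalarConj W m) * scalarMatrix B⁺¹ W := by
  refine Eq.trans ?_ congr($((unitizationMatrix_conj W m).symm) * _)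
  rw [mul_assoc _ (star _), ← map_star, ← map_mul, Unitary.coe_star_mul_self, map_one, mul_one]

theorem scalarMul_mulScalar_single (i k l j : n) (m : CStarMatrix n n B) :
    scalarMul (CStarMatrix.ofMatrix (Matrix.single i k 1))
        (mulScalar m (CStarMatrix.ofMatrix (Matrix.single l j 1))) =
      CStarMatrix.ofMatrix (Matrix.single i j (m k l)) := by
  ext p q
  have scalar_apply (a b c d : n) :
      (CStarMatrix.ofMatrix (Matrix.single a b 1) : CStarMatrix n n ℂ) c d =
        if a = c ∧ b = d then 1 else 0 := Matrix.single_apply ..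
  have single_apply : (CStarMatrix.ofMatrix (Matrix.single i j (m k l)) : CStarMatrix n n B) p q =
      if i = p ∧ j = q then m k l else 0 := Matrix.single_apply ..
  simp only [scalarMul_apply, mulScalar_apply, scalar_apply, single_apply, ite_and, ite_smul,
    one_smul, zero_smul, Finset.sum_ite_irrel, Finset.sum_ite_eq, Finset.mem_univ, if_true,
    Finset.sum_const_zero]

end ScalarMatrices

section BellRow

variable {n A : Type*} [Fintype n] [DecidableEq n] [NonUnitalCStarAlgebra A]

/-- The identity `Ω^* m = a Ω^*` for the maximally entangled vector `Ω = ∑ i, e_i ⊗ e_i`, where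
`m` is viewed as a matrix over `A` indexed by pairs. -/
def IsBellRow (m : CStarMatrix n n (CStarMatrix n n A)) (a : A) : Prop :=
  ∀ j q, ∑ i, m i j i q = if j = q then a else 0

variable {m m' : CStarMatrix n n (CStarMatrix n n A)} {a a' : A}

theorem isBellRow_zero : IsBellRow (0 : CStarMatrix n n (CStarMatrix n n A)) 0 := fun j q => by
  rw [ite_self]
  exact Finset.sum_const_zero

theorem IsBellRow.add (h : IsBellRow m a) (h' : IsBellRow m' a') :
    IsBellRow (m + m') (a + a') := fun j q => by
  simp only [CStarMatrix.add_apply, Finset.sum_add_distrib, h j q, h' j q]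
  split_ifs <;> simp only [add_zero]

theorem IsBellRow.smul (h : IsBellRow m a) (c : ℂ) : IsBellRow (c • m) (c • a) := fun j q => by
  simp only [CStarMatrix.smul_apply, ← Finset.smul_sum, h j q, smul_ite, smul_zero]

theorem IsBellRow.mul (h : IsBellRow m a) (h' : IsBellRow m' a') :
    IsBellRow (m * m') (a * a') := fun j q =>
  calc ∑ i, (m * m') i j i q = ∑ k, ∑ r, (∑ i, m i k i r) * m' k j r q := by
        simp only [CStarMatrix.mul_apply, cstarMatrix_sum_apply, Finset.sum_mul]
        rw [Finset.sum_comm]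
        exact Finset.sum_congr rfl fun k _ => Finset.sum_comm
    _ = ∑ k, a * m' k j k q := by
        simp only [h _ _, ite_mul, zero_mul, Finset.sum_ite_eq, Finset.mem_univ, if_true]
    _ = if j = q then a * a' else 0 := by rw [← Finset.mul_sum, h' j q, mul_ite, mul_zero]

theorem isClosed_setOf_isBellRow (τ : A →⋆ₙₐ[ℂ] CStarMatrix n n (CStarMatrix n n A)) :
    IsClosed {a | IsBellRow (τ a) a} := by
  simp only [IsBellRow, Set.ofPred_forall]
  refine isClosed_iInter fun j => isClosed_iInter fun q => isClosed_eq ?_ ?_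
  · exact continuous_finsetSum _ fun i _ =>
      (entryCLM (A := A) i q ∘L entryCLM (A := CStarMatrix n n A) i j ∘L starHomCLM τ).continuous
  · split_ifs
    exacts [continuous_id, continuous_const]

theorem isBellRow_of_dense_adjoin {τ : A →⋆ₙₐ[ℂ] CStarMatrix n n (CStarMatrix n n A)} {s : Set A}
    (hs : Dense (NonUnitalStarAlgebra.adjoin ℂ s : Set A)) (h : ∀ a ∈ s, IsBellRow (τ a) a)
    (h_star : ∀ a ∈ s, IsBellRow (τ (star a)) (star a)) (a : A) : IsBellRow (τ a) a := by
  let S : NonUnitalStarSubalgebra ℂ A :=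
    { carrier := {a | IsBellRow (τ a) a ∧ IsBellRow (τ (star a)) (star a)}
      zero_mem' := by
        simp only [Set.mem_ofPred_eq, star_zero, map_zero]
        exact ⟨isBellRow_zero, isBellRow_zero⟩
      add_mem' := fun ha hb => by
        simp only [Set.mem_ofPred_eq, star_add, map_add]
        exact ⟨ha.1.add hb.1, ha.2.add hb.2⟩
      smul_mem' := fun c _ ha => by
        simp only [Set.mem_ofPred_eq, star_smul, map_smul]
        exact ⟨ha.1.smul c, ha.2.smul (star c)⟩
      mul_mem' := fun ha hb => by
        simp only [Set.mem_ofPred_eq, star_mul, map_mul]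
        exact ⟨ha.1.mul hb.1, hb.2.mul ha.2⟩
      star_mem' := fun ha => ⟨ha.2, by rw [star_star]; exact ha.1⟩ }
  have isClosed_S : IsClosed (S : Set A) := (isClosed_setOf_isBellRow τ).inter
    ((isClosed_setOf_isBellRow τ).preimage continuous_star)
  exact (mem_of_dense_adjoin hs isClosed_S (fun a ha => ⟨h a ha, h_star a ha⟩) a).1

end BellRow

/-- Two `*`-homomorphisms `A → M_n(B)` and `B → M_n(A)` whose composites `A → M_n(M_n(A))` and
`B → M_n(M_n(B))` compress to the identity at the maximally entangled vector. -/
structure IsBellDual {n A B : Type*} [Fintype n] [DecidableEq n] [NonUnitalCStarAlgebra A]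
    [NonUnitalCStarAlgebra B] (ρ : A →⋆ₙₐ[ℂ] CStarMatrix n n B)
    (σ : B →⋆ₙₐ[ℂ] CStarMatrix n n A) : Prop where
  left : ∀ a, IsBellRow (CStarMatrix.mapₙₐ σ (ρ a)) a
  right : ∀ b, IsBellRow (CStarMatrix.mapₙₐ ρ (σ b)) b

namespace IsBellDual

theorem symm {n A B : Type*} [Fintype n] [DecidableEq n] [NonUnitalCStarAlgebra A]
    [NonUnitalCStarAlgebra B] {ρ : A →⋆ₙₐ[ℂ] CStarMatrix n n B} {σ : B →⋆ₙₐ[ℂ] CStarMatrix n n A}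
    (h : IsBellDual ρ σ) : IsBellDual σ ρ :=
  ⟨h.right, h.left⟩

variable {N : ℕ} [NeZero N] {A B : Type} [NonUnitalCStarAlgebra A] [NonUnitalCStarAlgebra B]
  {ρ : A →⋆ₙₐ[ℂ] CStarMatrix (ZMod N) (ZMod N) B} {σ : B →⋆ₙₐ[ℂ] CStarMatrix (ZMod N) (ZMod N) A}

/-- The expectation `m ↦ N⁻¹ ∑ i j, σ(m i j) i j`, which is a left inverse of `ρ` for a Bell dual
pair `(ρ, σ)`. -/
def expectation (σ : B →⋆ₙₐ[ℂ] CStarMatrix (ZMod N) (ZMod N) A) :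
    CStarMatrix (ZMod N) (ZMod N) B⁺¹ →L[ℂ] A :=
  let nonscalarPart : B⁺¹ →L[ℂ] B := ⟨Unitization.sndHom ℂ ℂ B, Unitization.continuous_snd⟩
  (N : ℂ)⁻¹ • ∑ i, ∑ j, entryCLM i j ∘L starHomCLM σ ∘L nonscalarPart ∘L entryCLM i j

theorem expectation_unitizationMatrix (m : CStarMatrix (ZMod N) (ZMod N) B) :
    expectation σ (unitizationMatrix m) = (N : ℂ)⁻¹ • ∑ i, ∑ j, σ (m i j) i j := by
  simp only [expectation, smul_apply, sum_apply]
  rfl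

theorem expectation_mul (h : IsBellDual ρ σ) (a : A) (w : MatN N) :
    expectation σ (unitizationMatrix (ρ a) * scalarMatrix B⁺¹ w) = normTrace N w • a := by
  calc expectation σ (unitizationMatrix (ρ a) * scalarMatrix B⁺¹ w)
      = (N : ℂ)⁻¹ • ∑ j, ∑ k, w k j • ∑ i, σ (ρ a i k) i j := by
        rw [← unitizationMatrix_mulScalar, expectation_unitizationMatrix, Finset.sum_comm]
        simp only [mulScalar_apply, map_sum, map_smul, cstarMatrix_sum_apply,
          CStarMatrix.smul_apply, Finset.smul_sum]
        exact Finset.sum_congr rfl fun j _ => Finset.sum_comm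
    _ = (N : ℂ)⁻¹ • ∑ j, ∑ k, w k j • if k = j then a else 0 := by
        simp only [← h.left a _ _]
        rfl
    _ = normTrace N w • a := by
        simp only [smul_ite, smul_zero, Finset.sum_ite_eq', Finset.mem_univ, if_true,
          ← Finset.sum_smul, smul_smul]
        rfl

theorem unitizationMatrix_mem (h : IsBellDual ρ σ)
    {P : NonUnitalStarSubalgebra ℂ (CStarMatrix (ZMod N) (ZMod N) B⁺¹)}
    (hP : ∀ w a w', scalarMatrix B⁺¹ w * unitizationMatrix (ρ a) * scalarMatrix B⁺¹ w' ∈ P)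
    (m : CStarMatrix (ZMod N) (ZMod N) B) : unitizationMatrix m ∈ P := by
  have single_mem (i j : ZMod N) (b : B) :
      unitizationMatrix (CStarMatrix.ofMatrix (Matrix.single i j b)) ∈ P := by
    have expansion : b = ∑ k, ρ (σ b k j) k j := ((h.right b j j).trans (if_pos rfl)).symm
    have single_sum : CStarMatrix.ofMatrix (Matrix.single i j b) = ∑ k, scalarMul (matUnit N i k)
        (mulScalar (ρ (σ b k j)) (matUnit N j j)) := by
      simp only [matUnit, scalarMul_mulScalar_single]
      exact (congrArg _ expansion).trans (map_sum (Matrix.singleAddMonoidHom i j) _ _)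
    rw [single_sum, map_sum]
    refine sum_mem fun k _ => ?_
    rw [unitizationMatrix_scalarMul, unitizationMatrix_mulScalar, ← mul_assoc]
    exact hP ..
  have matrix_sum : m = ∑ i, ∑ j, CStarMatrix.ofMatrix (Matrix.single i j (m i j)) :=
    Matrix.matrix_eq_sum_single m
  rw [matrix_sum]
  simp only [map_sum]
  exact sum_mem fun i _ => sum_mem fun j _ => single_mem i j _

variable {γ₁ γ₂ : Multiplicative (ZMod N) →* (A →⋆ₙₐ[ℂ] A)}

theorem nonempty_matrix_equiv (h : IsBellDual ρ σ) (hγ : ∀ g h a, γ₁ g (γ₂ h a) = γ₂ h (γ₁ g a))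
    (hclock : ∀ g a, ρ (γ₁ g a) = scalarConj (clock g) (ρ a))
    (htranslation : ∀ g a, ρ (γ₂ g a) = scalarConj (translation g) (ρ a)) :
    Nonempty (CStarMatrix (ZMod N) (ZMod N) B ≃⋆ₐ[ℂ] DoubleCrossedProduct γ₁ γ₂ hγ) := by
  let emb : CStarMatrix (ZMod N) (ZMod N) B →⋆ₙₐ[ℂ] CStarMatrix (ZMod N) (ZMod N) B⁺¹ :=
    unitizationMatrix
  have covariance {W : unitary (MatN N)} {a a' : A} (ha : ρ a' = scalarConj W (ρ a)) :
      scalarMatrix B⁺¹ W * emb (ρ a) = emb (ρ a') * scalarMatrix B⁺¹ W := by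
    rw [ha]
    exact scalarMatrix_mul_unitizationMatrix W (ρ a)
  refine DoubleCrossedProduct.nonempty_equiv hγ (emb.comp ρ) (scalarMatrix B⁺¹)
    (fun g a => covariance (hclock g a)) (fun g a => covariance (htranslation g a))
    unitizationMatrix_injective (fun a w => ?_) (fun P hP => h.unitizationMatrix_mem hP)
    h.expectation_mul
  exact ⟨_, unitizationMatrix_mulScalar (ρ a) w⟩

end IsBellDual

section DiagonalHom

variable {n B : Type*} [Fintype n] [DecidableEq n] [NonUnitalCStarAlgebra B]

/-- The diagonal embedding of a C*-algebra into the matrices over it. -/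
def diagonalHom : B →⋆ₙₐ[ℂ] CStarMatrix n n B where
  toFun e := CStarMatrix.ofMatrix (Matrix.diagonal fun _ => e)
  map_smul' c _ := Matrix.diagonal_smul c _
  map_zero' := Matrix.diagonal_zero
  map_add' _ _ := (Matrix.diagonal_add _ _).symm
  map_mul' _ _ := (Matrix.diagonal_mul_diagonal _ _).symm
  map_star' _ := (Matrix.diagonal_conjTranspose _).symm

theorem diagonalHom_apply (e : B) (i j : n) : diagonalHom e i j = if i = j then e else 0 := rfl

theorem diagonalHom_injective [Nonempty n] :
    Function.Injective (diagonalHom : B →⋆ₙₐ[ℂ] CStarMatrix n n B) := fun e e' h => by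
  obtain ⟨i⟩ := ‹Nonempty n›
  simpa only [diagonalHom_apply, if_true] using congr($h i i)

theorem diagonalHom_mul_apply (e : B) (m : CStarMatrix n n B) (i j : n) :
    (diagonalHom e * m : CStarMatrix n n B) i j = e * m i j :=
  Matrix.diagonal_mul _ _ _ _

theorem sum_mul_star_unitary (W : unitary (CStarMatrix n n ℂ)) (i j : n) :
    ∑ k, (W : CStarMatrix n n ℂ) i k * star ((W : CStarMatrix n n ℂ) j k) =
      if i = j then 1 else 0 :=
  congr($(Unitary.coe_mul_star_self W) i j)

theorem sum_star_mul_unitary (W : unitary (CStarMatrix n n ℂ)) (k l : n) :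
    ∑ i, star ((W : CStarMatrix n n ℂ) i k) * (W : CStarMatrix n n ℂ) i l =
      if k = l then 1 else 0 :=
  congr($(Unitary.coe_star_mul_self W) k l)

theorem scalarConj_diagonalHom (W : unitary (CStarMatrix n n ℂ)) (e : B) :
    scalarConj W (diagonalHom e) = diagonalHom e := by
  ext i j
  simp only [scalarConj_apply, diagonalHom_apply, smul_ite, smul_zero, Finset.sum_ite_eq,
    Finset.mem_univ, if_true]
  rw [← Finset.sum_smul, sum_mul_star_unitary, ite_smul, one_smul, zero_smul]

end DiagonalHom

/-- The matrix `n⁻¹ ∑ x, T x ⊗ |U x⟩⟩⟨⟨U x|`, where `|U x⟩⟩` is the conjugate of the vectorization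
of the matrix `U x`. -/
def bellMatrix {n ι A : Type*} [Fintype n] [DecidableEq n] [Fintype ι] [NonUnitalCStarAlgebra A]
    (U : ι → unitary (CStarMatrix n n ℂ)) (T : ι → A) : CStarMatrix n n (CStarMatrix n n A) :=
  CStarMatrix.ofMatrix fun k l => CStarMatrix.ofMatrix fun p q => (Fintype.card n : ℂ)⁻¹ •
    ∑ x, (star ((U x : CStarMatrix n n ℂ) p k) * (U x : CStarMatrix n n ℂ) q l) • T x

theorem bellMatrix_apply {n ι A : Type*} [Fintype n] [DecidableEq n] [Fintype ι]
    [NonUnitalCStarAlgebra A] (U : ι → unitary (CStarMatrix n n ℂ)) (T : ι → A) (k l p q : n) :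
    bellMatrix U T k l p q = (Fintype.card n : ℂ)⁻¹ •
      ∑ x, (star ((U x : CStarMatrix n n ℂ) p k) * (U x : CStarMatrix n n ℂ) q l) • T x := rfl

namespace IsUnitaryErrorBasis

variable {n ι A B : Type*} [Fintype n] [DecidableEq n] [Fintype ι] [DecidableEq ι]
  [NonUnitalCStarAlgebra A] [NonUnitalCStarAlgebra B] {U : ι → unitary (CStarMatrix n n ℂ)}
  (hU : IsUnitaryErrorBasis U)

include hU

theorem sum_scalarConj (V : CStarMatrix n n B) :
    ∑ x, scalarConj (U x) V = diagonalHom ((Fintype.card n : ℂ) • ∑ k, V k k) := by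
  ext i j
  rw [cstarMatrix_sum_apply]
  calc ∑ x, scalarConj (U x) V i j
      = ∑ k, ∑ l, (∑ x, star ((U x : CStarMatrix n n ℂ) j l) * (U x : CStarMatrix n n ℂ) i k) •
          V k l := by
        simp only [scalarConj_apply, Finset.sum_smul, mul_comm (star _)]
        exact Finset.sum_comm_cycle.symm
    _ = ∑ k, if j = i then (Fintype.card n : ℂ) • V k k else 0 := by
        simp only [hU.complete, ite_and, ite_smul, zero_smul, Finset.sum_ite_irrel,
          Finset.sum_const_zero, Finset.sum_ite_eq', Finset.mem_univ, if_true]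
    _ = diagonalHom ((Fintype.card n : ℂ) • ∑ k, V k k) i j := by
        rw [diagonalHom_apply, Finset.sum_ite_irrel, Finset.sum_const_zero, Finset.smul_sum]
        exact if_congr eq_comm rfl rfl

theorem bellMatrix_mul (T T' : ι → A) :
    bellMatrix U (T * T') = bellMatrix U T * bellMatrix U T' := by
  refine CStarMatrix.ext fun k l => CStarMatrix.ext fun p q => ?_
  calc bellMatrix U (T * T') k l p q
      = (Fintype.card n : ℂ)⁻¹ • (Fintype.card n : ℂ)⁻¹ • ∑ x, ∑ y, (∑ s, ∑ r,
          star ((U y : CStarMatrix n n ℂ) s r) * (U x : CStarMatrix n n ℂ) s r) •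
          (star ((U x : CStarMatrix n n ℂ) p k) * (U y : CStarMatrix n n ℂ) q l) •
            (T x * T' y) := by
        have : Nonempty n := ⟨k⟩
        rw [bellMatrix_apply]
        congr 1
        simp only [hU.orthogonal, ite_smul, zero_smul, Finset.sum_ite_eq', Finset.mem_univ,
          if_true, ← Finset.smul_sum]
        rw [inv_smul_smul₀ (Nat.cast_ne_zero.mpr Fintype.card_ne_zero)]
        rfl
    _ = ∑ r, ∑ s, bellMatrix U T k r p s * bellMatrix U T' r l s q := by
        simp only [bellMatrix_apply, smul_mul_smul_comm, Finset.sum_mul_sum,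
          Finset.smul_sum, smul_smul]
        symm
        rw [Finset.sum_comm, Finset.sum_comm_cycle]
        refine Finset.sum_congr rfl fun x _ => Finset.sum_comm_cycle.trans ?_
        refine Finset.sum_congr rfl fun y _ => ?_
        simp only [Finset.sum_mul, Finset.mul_sum, Finset.sum_smul]
        refine Finset.sum_congr rfl fun s _ => Finset.sum_congr rfl fun r _ => ?_
        congr 1
        ring
    _ = (bellMatrix U T * bellMatrix U T') k l p q := by
        simp only [CStarMatrix.mul_apply, cstarMatrix_sum_apply]

/-- `bellMatrix U` as a `*`-homomorphism; multiplicativity is the orthogonality of the `U x`. -/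
def bellHom (hU : IsUnitaryErrorBasis U) : (ι → A) →⋆ₙₐ[ℂ] CStarMatrix n n (CStarMatrix n n A) where
  toFun := bellMatrix U
  map_smul' c T := CStarMatrix.ext fun k l => CStarMatrix.ext fun p q => by
    simp only [bellMatrix_apply, CStarMatrix.smul_apply, Pi.smul_apply, MonoidHom.id_apply,
      smul_comm _ c, Finset.smul_sum]
  map_zero' := CStarMatrix.ext fun k l => CStarMatrix.ext fun p q => by
    simp only [bellMatrix_apply, Pi.zero_apply, smul_zero, Finset.sum_const_zero,
      CStarMatrix.zero_apply]
  map_add' T T' := CStarMatrix.ext fun k l => CStarMatrix.ext fun p q => by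
    simp only [bellMatrix_apply, CStarMatrix.add_apply, Pi.add_apply, smul_add,
      Finset.sum_add_distrib]
  map_mul' := hU.bellMatrix_mul
  map_star' T := CStarMatrix.ext fun k l => CStarMatrix.ext fun p q => by
    simp only [bellMatrix_apply, CStarMatrix.star_apply, Pi.star_apply, star_smul, star_sum,
      star_mul, star_star, star_inv₀, star_natCast]

theorem bellHom_apply (T : ι → A) (k l p q : n) : hU.bellHom T k l p q =
    (Fintype.card n : ℂ)⁻¹ • ∑ x,
      (star ((U x : CStarMatrix n n ℂ) p k) * (U x : CStarMatrix n n ℂ) q l) • T x := rfl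

theorem bellHom_const (e : A) : hU.bellHom (fun _ => e) = diagonalHom (diagonalHom e) := by
  refine CStarMatrix.ext fun k l => CStarMatrix.ext fun p q => ?_
  have : Nonempty n := ⟨k⟩
  rw [bellHom_apply, ← Finset.sum_smul, hU.complete, smul_smul, mul_ite, mul_zero,
    inv_mul_cancel₀ (Nat.cast_ne_zero.mpr Fintype.card_ne_zero), ite_smul, one_smul, zero_smul]
  have diagonal_apply : diagonalHom (diagonalHom e) k l p q =
      if k = l then if p = q then e else 0 else 0 := by
    rw [diagonalHom_apply]
    split_ifs with hkl hpq
    exacts [(diagonalHom_apply ..).trans (if_pos hpq), (diagonalHom_apply ..).trans (if_neg hpq),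
      rfl]
  rw [diagonal_apply, ← ite_and]
  exact if_congr and_comm rfl rfl

theorem smul_sum_bellHom (T : ι → A) :
    (Fintype.card n : ℂ) • ∑ k, hU.bellHom T k k = diagonalHom (∑ x, T x) := by
  refine CStarMatrix.ext fun p q => ?_
  have : Nonempty n := ⟨p⟩
  calc ((Fintype.card n : ℂ) • ∑ k, hU.bellHom T k k) p q
      = ∑ x, (∑ k, (U x : CStarMatrix n n ℂ) q k * star ((U x : CStarMatrix n n ℂ) p k)) • T x := by
        simp only [CStarMatrix.smul_apply, cstarMatrix_sum_apply, bellHom_apply,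
          ← Finset.smul_sum, Finset.sum_smul, mul_comm (star _)]
        rw [smul_inv_smul₀ (Nat.cast_ne_zero.mpr Fintype.card_ne_zero), Finset.sum_comm]
    _ = diagonalHom (∑ x, T x) p q := by
        simp only [sum_mul_star_unitary, ite_smul, one_smul, zero_smul, diagonalHom_apply,
          Finset.sum_ite_irrel, Finset.sum_const_zero, eq_comm]

theorem isBellRow_scalarConj {σ : B →⋆ₙₐ[ℂ] CStarMatrix n n A} {T : ι → A} {V : CStarMatrix n n B}
    (hσ : ∀ k l, σ (V k l) = hU.bellHom T k l) (x : ι) :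
    IsBellRow (CStarMatrix.mapₙₐ σ (scalarConj (U x) V)) (T x) := fun j q => by
  have : Nonempty n := ⟨j⟩
  calc ∑ i, σ (scalarConj (U x) V i j) i q
      = ∑ l, ∑ y, (Fintype.card n : ℂ)⁻¹ • (∑ i, ∑ k,
          star ((U y : CStarMatrix n n ℂ) i k) * (U x : CStarMatrix n n ℂ) i k) •
          ((U y : CStarMatrix n n ℂ) q l * star ((U x : CStarMatrix n n ℂ) j l)) • T y := by
        simp only [scalarConj_apply, map_sum, map_smul, hσ, cstarMatrix_sum_apply,
          CStarMatrix.smul_apply, bellHom_apply, Finset.smul_sum, smul_smul]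
        rw [Finset.sum_comm_cycle]
        refine Finset.sum_congr rfl fun l _ => Finset.sum_comm_cycle.trans ?_
        refine Finset.sum_congr rfl fun y _ => ?_
        simp only [Finset.sum_mul, Finset.mul_sum, Finset.sum_smul]
        refine Finset.sum_congr rfl fun i _ => Finset.sum_congr rfl fun k _ => ?_
        congr 1
        ring
    _ = ∑ l, ((U x : CStarMatrix n n ℂ) q l * star ((U x : CStarMatrix n n ℂ) j l)) • T x := by
        simp only [hU.orthogonal, ite_smul, zero_smul, smul_ite, smul_zero, Finset.sum_ite_eq',
          Finset.mem_univ, if_true,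
          inv_smul_smul₀ (Nat.cast_ne_zero (R := ℂ).mpr (Fintype.card_ne_zero (α := n)))]
    _ = if j = q then T x else 0 := by
        rw [← Finset.sum_smul, sum_mul_star_unitary, ite_smul, one_smul, zero_smul]
        exact if_congr eq_comm rfl rfl

theorem isBellRow_bellHom {ρ : A →⋆ₙₐ[ℂ] CStarMatrix n n B} {T : ι → A} {V : CStarMatrix n n B}
    (hρ : ∀ x, ρ (T x) = scalarConj (U x) V) (k l : n) :
    IsBellRow (CStarMatrix.mapₙₐ ρ (hU.bellHom T k l)) (V k l) := fun j q => by
  have : Nonempty n := ⟨j⟩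
  calc ∑ i, ρ (hU.bellHom T k l i j) i q
      = (Fintype.card n : ℂ)⁻¹ • ∑ x, ∑ b, ∑ a, (∑ i,
          star ((U x : CStarMatrix n n ℂ) i k) * (U x : CStarMatrix n n ℂ) i a) •
          (star ((U x : CStarMatrix n n ℂ) q b) * (U x : CStarMatrix n n ℂ) j l) • V a b := by
        simp only [scalarConj_apply, map_sum, map_smul, hρ, cstarMatrix_sum_apply,
          CStarMatrix.smul_apply, bellHom_apply, Finset.smul_sum, smul_smul]
        rw [Finset.sum_comm]
        refine Finset.sum_congr rfl fun x _ => Finset.sum_comm_cycle.symm.trans ?_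
        rw [Finset.sum_comm]
        refine Finset.sum_congr rfl fun b _ => Finset.sum_congr rfl fun a _ => ?_
        simp only [Finset.sum_mul, Finset.mul_sum, Finset.sum_smul]
        refine Finset.sum_congr rfl fun i _ => ?_
        congr 1
        ring
    _ = (Fintype.card n : ℂ)⁻¹ • ∑ b, (∑ x,
          star ((U x : CStarMatrix n n ℂ) q b) * (U x : CStarMatrix n n ℂ) j l) • V k b := by
        simp only [sum_star_mul_unitary, ite_smul, one_smul, zero_smul, Finset.sum_ite_eq,
          Finset.mem_univ, if_true, Finset.sum_smul]
        rw [Finset.sum_comm]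
    _ = if j = q then V k l else 0 := by
        simp only [hU.complete, eq_comm, ite_and, ite_smul, zero_smul, Finset.sum_ite_irrel,
          Finset.sum_const_zero, Finset.sum_ite_eq, Finset.mem_univ, if_true,
          smul_ite, smul_zero,
          inv_smul_smul₀ (Nat.cast_ne_zero (R := ℂ).mpr (Fintype.card_ne_zero (α := n)))]

theorem isBellDual {ρ : A →⋆ₙₐ[ℂ] CStarMatrix n n B} {σ : B →⋆ₙₐ[ℂ] CStarMatrix n n A}
    {T : ι → A} {V : CStarMatrix n n B}
    (hT : Dense (NonUnitalStarAlgebra.adjoin ℂ (Set.range T) : Set A))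
    (hV : Dense (NonUnitalStarAlgebra.adjoin ℂ (Set.range fun p : n × n => V p.1 p.2) : Set B))
    (hρ : ∀ x, ρ (T x) = scalarConj (U x) V) (hσ : ∀ k l, σ (V k l) = hU.bellHom T k l) :
    IsBellDual ρ σ where
  left := isBellRow_of_dense_adjoin (τ := (CStarMatrix.mapₙₐ σ).comp ρ) hT
    (Set.forall_mem_range.mpr fun x => by
      rw [NonUnitalStarAlgHom.comp_apply, hρ]
      exact hU.isBellRow_scalarConj hσ x)
    (Set.forall_mem_range.mpr fun x => by
      rw [map_star, NonUnitalStarAlgHom.comp_apply, hρ, ← map_star, ← map_star]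
      refine hU.isBellRow_scalarConj (T := star T) (fun k l => ?_) x
      rw [map_star (bellHom hU), CStarMatrix.star_apply, CStarMatrix.star_apply, map_star, hσ])
  right := isBellRow_of_dense_adjoin (τ := (CStarMatrix.mapₙₐ ρ).comp σ) hV
    (Set.forall_mem_range.mpr fun p => by
      rw [NonUnitalStarAlgHom.comp_apply, hσ]
      exact hU.isBellRow_bellHom hρ p.1 p.2)
    (Set.forall_mem_range.mpr fun p => by
      rw [map_star, NonUnitalStarAlgHom.comp_apply, hσ, ← map_star,
        ← CStarMatrix.star_apply, ← CStarMatrix.star_apply, ← map_star (bellHom hU)]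
      refine hU.isBellRow_bellHom (T := star T) (fun x => ?_) p.2 p.1
      rw [Pi.star_apply, map_star, map_star, hρ])

end IsUnitaryErrorBasis

section Pauli

variable {N : ℕ} [NeZero N] {A B : Type*} [NonUnitalCStarAlgebra A] [NonUnitalCStarAlgebra B]

theorem scalarConj_clock_apply (g : Multiplicative (ZMod N))
    (m : CStarMatrix (ZMod N) (ZMod N) B) (i j : ZMod N) :
    scalarConj (clock g) m i j = (ZMod.stdAddChar (g.toAdd * (i - j)) : ℂ) • m i j := by
  have char_eq : (ZMod.stdAddChar (g.toAdd * (i - j)) : ℂ) =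
      ZMod.stdAddChar (g.toAdd * i) * ZMod.stdAddChar (-(g.toAdd * j)) := by
    rw [← AddChar.map_add_eq_mul]; ring_nf
  simp only [scalarConj_apply, clock_apply, apply_ite star, star_stdAddChar, star_zero, ite_mul,
    zero_mul, mul_ite, mul_zero, ite_smul, zero_smul,
    Finset.sum_ite_eq, Finset.mem_univ, if_true, char_eq]

theorem scalarConj_translation_apply (h : Multiplicative (ZMod N))
    (m : CStarMatrix (ZMod N) (ZMod N) B) (i j : ZMod N) :
    scalarConj (translation h) m i j = m (i + h.toAdd) (j + h.toAdd) := by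
  simp only [scalarConj_apply, translation_apply, apply_ite star, star_one, star_zero, ite_mul,
    one_mul, zero_mul, ite_smul, one_smul, zero_smul, Finset.sum_ite_irrel, Finset.sum_const_zero,
    Finset.sum_ite_eq', Finset.mem_univ, if_true]

theorem scalarConj_pauli_apply (p : ZMod N × ZMod N)
    (m : CStarMatrix (ZMod N) (ZMod N) B) (i j : ZMod N) :
    scalarConj (pauli p) m i j =
      (ZMod.stdAddChar (-p.1 * (i - j)) : ℂ) • m (i - p.2) (j - p.2) := by
  have conj_mul : scalarConj (pauli p) m = scalarConj (clock (.ofAdd (-p.1)))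
      (scalarConj (translation (.ofAdd (-p.2))) m) := by
    rw [pauli, map_mul]
    rfl
  rw [conj_mul, scalarConj_clock_apply, scalarConj_translation_apply, toAdd_ofAdd,
    toAdd_ofAdd, sub_eq_add_neg i p.2, sub_eq_add_neg j p.2]

variable (V : CStarMatrix (ZMod N) (ZMod N) B)

theorem scalarConj_clock_pauli (g : Multiplicative (ZMod N)) (p : ZMod N × ZMod N) :
    scalarConj (clock g) (scalarConj (pauli p) V) = scalarConj (pauli (p.1 - g.toAdd, p.2)) V := by
  refine CStarMatrix.ext fun i j => ?_
  rw [scalarConj_clock_apply, scalarConj_pauli_apply, scalarConj_pauli_apply, smul_smul,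
    ← AddChar.map_add_eq_mul]
  ring_nf

theorem scalarConj_translation_pauli (h : Multiplicative (ZMod N)) (p : ZMod N × ZMod N) :
    scalarConj (translation h) (scalarConj (pauli p) V) =
      scalarConj (pauli (p.1, p.2 - h.toAdd)) V := by
  refine CStarMatrix.ext fun i j => ?_
  rw [scalarConj_translation_apply, scalarConj_pauli_apply, scalarConj_pauli_apply]
  ring_nf

variable (T : ZMod N × ZMod N → A) (k l : ZMod N)

theorem bellHom_pauli_apply (i j : ZMod N) :
    isUnitaryErrorBasis_pauli.bellHom T k l i j = (N : ℂ)⁻¹ • ∑ p : ZMod N × ZMod N,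
      if k = i - p.2 ∧ l = j - p.2 then (ZMod.stdAddChar (p.1 * (i - j)) : ℂ) • T p else 0 := by
  rw [IsUnitaryErrorBasis.bellHom_apply, ZMod.card]
  refine congrArg _ (Finset.sum_congr rfl fun ⟨a, b⟩ _ => ?_)
  have char_eq : (ZMod.stdAddChar (a * (i - j)) : ℂ) =
      ZMod.stdAddChar (a * i) * ZMod.stdAddChar (-(a * j)) := by
    rw [← AddChar.map_add_eq_mul]; ring_nf
  simp only [pauli_apply, apply_ite star, star_stdAddChar, star_zero, neg_neg, char_eq, ite_and,
    ite_mul, mul_ite, zero_mul, mul_zero, ite_smul, zero_smul]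
  split_ifs <;> rfl

theorem scalarConj_clock_bellHom_pauli (g : Multiplicative (ZMod N)) :
    scalarConj (clock g) (isUnitaryErrorBasis_pauli.bellHom T k l) =
      (ZMod.stdAddChar (g.toAdd * (k - l)) : ℂ) • isUnitaryErrorBasis_pauli.bellHom T k l := by
  refine CStarMatrix.ext fun i j => ?_
  simp only [scalarConj_clock_apply, CStarMatrix.smul_apply, bellHom_pauli_apply,
    smul_comm _ (N : ℂ)⁻¹]
  simp only [Finset.smul_sum]
  refine Finset.sum_congr rfl fun p _ => congrArg _ ?_
  split_ifs with support
  · rw [support.1, support.2, sub_sub_sub_cancel_right]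
  · rw [smul_zero, smul_zero]

theorem scalarConj_translation_bellHom_pauli (h : Multiplicative (ZMod N)) :
    scalarConj (translation h) (isUnitaryErrorBasis_pauli.bellHom T k l) =
      isUnitaryErrorBasis_pauli.bellHom T (k - h.toAdd) (l - h.toAdd) := by
  refine CStarMatrix.ext fun i j => ?_
  simp only [scalarConj_translation_apply, bellHom_pauli_apply, add_sub_add_right_eq_sub,
    sub_eq_iff_eq_add, sub_add_eq_add_sub]

end Pauli

theorem starHom_ext_of_dense_adjoin {A B : Type*} [NonUnitalCStarAlgebra A]
    [NonUnitalCStarAlgebra B] {s : Set A} (hs : Dense (NonUnitalStarAlgebra.adjoin ℂ s : Set A))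
    {φ ψ : A →⋆ₙₐ[ℂ] B} (h : Set.EqOn φ ψ s) : φ = ψ :=
  NonUnitalStarAlgHom.ext <| mem_of_dense_adjoin hs (S := NonUnitalStarAlgHom.equalizer φ ψ)
    (isClosed_eq (map_continuous φ) (map_continuous ψ)) h

section Cuntz

open UniversalCStarAlgebra

theorem eq_zero_of_sum_mul_star_eq_zero {ι D : Type*} [Fintype ι] [NonUnitalCStarAlgebra D]
    {y : ι → D} (h : ∑ i, y i * star (y i) = 0) (i : ι) : y i = 0 := by
  let _ := CStarAlgebra.spectralOrder D
  have _ := CStarAlgebra.spectralOrderedRing D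
  rw [Finset.sum_eq_zero_iff_of_nonneg fun i _ => mul_star_self_nonneg (y i)] at h
  exact (CStarRing.mul_star_self_eq_zero_iff _).1 (h i (Finset.mem_univ i))

theorem mul_eq_self_of_sum_mul_star_eq {ι D : Type*} [Fintype ι] [NonUnitalCStarAlgebra D]
    {x : ι → D} {e : D} {c : ℂ} (hc : c ≠ 0) (he : IsStarProjection e)
    (h : c • ∑ i, x i * star (x i) = e) (i : ι) : e * x i = x i := by
  have sum_eq : ∑ i, x i * star (x i) = c⁻¹ • e := by rw [← h, inv_smul_smul₀ hc]
  have he_star : star e = e := he.isSelfAdjoint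
  have he_mul : e * e = e := he.isIdempotentElem
  have sum_defect_eq_zero : ∑ i, (x i - e * x i) * star (x i - e * x i) = 0 := by
    have expand (i : ι) : (x i - e * x i) * star (x i - e * x i) =
        x i * star (x i) - e * (x i * star (x i)) - x i * star (x i) * e +
          e * (x i * star (x i)) * e := by
      rw [star_sub, star_mul, he_star]
      noncomm_ring
    simp only [expand, Finset.sum_add_distrib, Finset.sum_sub_distrib, ← Finset.mul_sum,
      ← Finset.sum_mul, sum_eq, mul_smul_comm, smul_mul_assoc, he_mul]
    abel
  exact (sub_eq_zero.1 (eq_zero_of_sum_mul_star_eq_zero sum_defect_eq_zero i)).symm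

theorem cuntzRelation_gen (ι : Type) [Fintype ι] :
    (cuntzRelation ι).Holds (gen (cuntzRelation ι)) := by
  let unit : CuntzAlgebra ι := ∑ i, gen (cuntzRelation ι) i * star (gen (cuntzRelation ι) i)
  have map_unit (D : Type) [NonUnitalCStarAlgebra D] (π : CuntzAlgebra ι →⋆ₙₐ[ℂ] D) :
      π unit = ∑ i, π (gen _ i) * star (π (gen _ i)) := by
    simp only [unit, map_sum, map_mul, map_star]
  refine ⟨unit, fun i => ⟨?_, ?_, ?_⟩, rfl⟩ <;>
  · refine eq_of_forall_hom_eq fun D _ π ⟨e, he, hsum⟩ => ?_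
    simp only [map_mul, map_star, map_unit, hsum, he i]

theorem cuntzRelation_scalarConj {n ι D : Type} [Fintype n] [DecidableEq n] [Nonempty n]
    [Fintype ι] [DecidableEq ι] [NonUnitalCStarAlgebra D] {U : ι → unitary (CStarMatrix n n ℂ)}
    (hU : IsUnitaryErrorBasis U) {V : CStarMatrix n n D} (h_isometry : V * (star V * V) = V)
    (h_adjacency : star V * V = diagonalHom ((Fintype.card n : ℂ) • ∑ k, (V * star V) k k)) :
    (cuntzRelation ι).Holds fun x => scalarConj (U x) V := by
  set e : D := (Fintype.card n : ℂ) • ∑ k, (V * star V) k k with he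
  rw [h_adjacency] at h_isometry
  have isStarProjection_e : IsStarProjection e := by
    refine ⟨diagonalHom_injective (n := n) ?_, diagonalHom_injective (n := n) ?_⟩
    · rw [map_mul]
      nth_rewrite 1 [← h_adjacency]
      rw [mul_assoc, h_isometry, h_adjacency]
    · rw [map_star, ← h_adjacency, star_mul, star_star]
  have diagonal_mul : diagonalHom e * V = V := by
    refine CStarMatrix.ext fun k l => ?_
    rw [diagonalHom_mul_apply]
    refine mul_eq_self_of_sum_mul_star_eq (x := fun p : n × n => V p.1 p.2)
      (c := Fintype.card n) (by simp) isStarProjection_e ?_ (k, l)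
    rw [Fintype.sum_prod_type, he]
    simp only [CStarMatrix.mul_apply, CStarMatrix.star_apply]
  refine ⟨diagonalHom e, fun x => ⟨?_, ?_, ?_⟩, ?_⟩
  · rw [← scalarConj_diagonalHom (U x) e, ← map_mul, diagonal_mul]
  · rw [← scalarConj_diagonalHom (U x) e, ← map_mul, h_isometry]
  · rw [← map_star, ← map_mul, h_adjacency, scalarConj_diagonalHom]
  · simp only [← map_star, ← map_mul]
    exact hU.sum_scalarConj _

end Cuntz

namespace FreeProduct

open UniversalCStarAlgebra

variable {ι : Type} (A : ι → Type) [∀ i, NonUnitalCStarAlgebra (A i)]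

/-- The canonical `*`-homomorphism from a factor to the free product. -/
def incl (i : ι) : A i →⋆ₙₐ[ℂ] FreeProduct A where
  toFun a := gen (freeProductRelation A) ⟨i, a⟩
  map_smul' c a := eq_of_forall_hom_eq fun D _ π ⟨φ, hφ⟩ => by
    simp only [map_smul, hφ, MonoidHom.id_apply]
  map_zero' := eq_of_forall_hom_eq fun D _ π ⟨φ, hφ⟩ => by simp only [map_zero, hφ]
  map_add' a b := eq_of_forall_hom_eq fun D _ π ⟨φ, hφ⟩ => by simp only [map_add, hφ]
  map_mul' a b := eq_of_forall_hom_eq fun D _ π ⟨φ, hφ⟩ => by simp only [map_mul, hφ]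
  map_star' a := eq_of_forall_hom_eq fun D _ π ⟨φ, hφ⟩ => by simp only [map_star, hφ]

theorem exists_lift {D : Type} [NonUnitalCStarAlgebra D] (φ : ∀ i, A i →⋆ₙₐ[ℂ] D) :
    ∃ π : FreeProduct A →⋆ₙₐ[ℂ] D, ∀ i a, π (incl A i a) = φ i a :=
  ⟨lift (fun x => φ x.1 x.2) ⟨φ, fun _ _ => rfl⟩, fun _ _ => lift_gen _ _ _⟩

theorem dense_adjoin_range_incl {x : ∀ i, A i}
    (hx : ∀ i, Dense (NonUnitalStarAlgebra.adjoin ℂ {x i} : Set (A i))) :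
    Dense (NonUnitalStarAlgebra.adjoin ℂ (Set.range fun i => incl A i (x i)) :
      Set (FreeProduct A)) := by
  let S := (NonUnitalStarAlgebra.adjoin ℂ (Set.range fun i => incl A i (x i))).topologicalClosure
  have hS : IsClosed (S : Set (FreeProduct A)) :=
    NonUnitalStarSubalgebra.isClosed_topologicalClosure _
  have incl_mem (i : ι) (a : A i) : incl A i a ∈ S :=
    mem_of_dense_adjoin (hx i) (S := S.comap (incl A i)) (hS.preimage (map_continuous (incl A i)))
      (Set.singleton_subset_iff.2 <|
        subset_closure (NonUnitalStarAlgebra.subset_adjoin ℂ _ ⟨i, rfl⟩)) a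
  exact fun y => mem_of_dense_adjoin dense_adjoin_range_gen hS
    (Set.range_subset_iff.2 fun ⟨i, a⟩ => incl_mem i a) y

end FreeProduct

section Circle

/-- The canonical unitary generator of `C(S¹)`. -/
def circleCoord : C(Circle, ℂ) := ⟨fun z => z, continuous_subtype_val⟩

theorem star_circleCoord_mul : star circleCoord * circleCoord = 1 := by
  ext z
  change star (z : ℂ) * z = 1
  rw [Complex.star_def, Complex.conj_mul', Circle.norm_coe, Complex.ofReal_one, one_pow]

theorem dense_adjoin_circleCoord :
    Dense (NonUnitalStarAlgebra.adjoin ℂ {circleCoord} : Set C(Circle, ℂ)) := by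
  let S := NonUnitalStarAlgebra.adjoin ℂ {circleCoord}
  have coord_mem : circleCoord ∈ S := NonUnitalStarAlgebra.subset_adjoin ℂ _ rfl
  have one_mem : (1 : C(Circle, ℂ)) ∈ S := by
    rw [← star_circleCoord_mul]
    exact mul_mem (star_mem coord_mem) coord_mem
  let U : StarSubalgebra ℂ C(Circle, ℂ) :=
    { S with
      one_mem' := one_mem
      algebraMap_mem' := fun c => by
        rw [Algebra.algebraMap_eq_smul_one]
        exact S.smul_mem c one_mem }
  have separatesPoints : U.SeparatesPoints := fun z w hzw =>
    ⟨circleCoord, ⟨circleCoord, coord_mem, rfl⟩, fun h => hzw (Circle.ext h)⟩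
  intro f
  have f_mem : f ∈ U.topologicalClosure := by
    rw [ContinuousMap.starSubalgebra_topologicalClosure_eq_top_of_separatesPoints U separatesPoints]
    trivial
  exact f_mem

variable {D : Type*} [NonUnitalCStarAlgebra D] {v : D}

attribute [local instance] IsStarNormal.instNonUnitalContinuousFunctionalCalculus

theorem eq_zero_or_norm_eq_one_of_mem_quasispectrum (h_isometry : v * star v * v = v)
    (h_normal : star v * v = v * star v) {z : ℂ} (hz : z ∈ quasispectrum ℂ v) :
    z = 0 ∨ ‖z‖ = 1 := by
  have hv : IsStarNormal v := ⟨h_normal⟩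
  have cfc_eq : cfcₙ (fun z : ℂ => z * star z * z) v = cfcₙ (fun z : ℂ => z) v := by
    rw [cfcₙ_mul (fun z : ℂ => z * star z) (fun z => z) v, cfcₙ_mul (fun z : ℂ => z) star v,
      cfcₙ_star_id v, cfcₙ_id' ℂ v, h_isometry]
  have cube_eq : z * star z * z = z := eqOn_of_cfcₙ_eq_cfcₙ cfc_eq hv (by fun_prop) (by simp)
    (by fun_prop) rfl hz
  refine or_iff_not_imp_left.2 fun hz₀ => ?_
  have normSq_eq : z * star z = 1 := mul_right_cancel₀ hz₀ (by rw [cube_eq, one_mul])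
  rw [Complex.star_def, Complex.mul_conj'] at normSq_eq
  exact (pow_eq_one_iff_of_nonneg (norm_nonneg z) two_ne_zero).1 (by exact_mod_cast normSq_eq)

/-- Extension of functions on the circle by zero to the complex plane. -/
def circleExtend : C(Circle, ℂ) →⋆ₙₐ[ℂ] (ℂ → ℂ) where
  toFun f := Function.extend (fun z : Circle => (z : ℂ)) f 0
  map_smul' c f := by
    rw [ContinuousMap.coe_smul, ← smul_zero c, Function.extend_smul, smul_zero, MonoidHom.id_apply]
  map_zero' := Function.extend_zero _
  map_add' f g := by
    rw [← Function.extend_add, add_zero, ContinuousMap.coe_add]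
  map_mul' f g := by
    rw [← Function.extend_mul, mul_zero, ContinuousMap.coe_mul]
  map_star' f := by
    have star_comp_zero : star ∘ (0 : ℂ → ℂ) = 0 := funext fun _ => star_zero ℂ
    funext z
    rw [Pi.star_apply, Function.apply_extend star, star_comp_zero]
    rfl

theorem circleExtend_coe (f : C(Circle, ℂ)) (z : Circle) : circleExtend f z = f z :=
  Circle.coe_injective.extend_apply _ _ z

theorem circleExtend_zero (f : C(Circle, ℂ)) : circleExtend f 0 = 0 :=
  Function.extend_apply' _ _ _ fun ⟨z, hz⟩ => z.coe_ne_zero hz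

theorem continuousOn_circleExtend (f : C(Circle, ℂ)) :
    ContinuousOn (circleExtend f) ({0} ∪ Metric.sphere 0 1) := by
  refine (continuousOn_singleton _ _).union_of_isClosed ?_ isClosed_singleton Metric.isClosed_sphere
  rw [continuousOn_iff_continuous_domRestrict]
  exact f.continuous.congr fun z => (circleExtend_coe f z).symm

/-- Such a `φ` need not be unital, even if `D` is: the spectrum of `v` may contain `0`. -/
theorem exists_starHom_circleCoord_eq (h_isometry : v * star v * v = v)
    (h_normal : star v * v = v * star v) :
    ∃ φ : C(Circle, ℂ) →⋆ₙₐ[ℂ] D, φ circleCoord = v := by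
  have hv : IsStarNormal v := ⟨h_normal⟩
  have continuousOn (f : C(Circle, ℂ)) : ContinuousOn (circleExtend f) (quasispectrum ℂ v) :=
    (continuousOn_circleExtend f).mono fun z hz =>
      (eq_zero_or_norm_eq_one_of_mem_quasispectrum h_isometry h_normal hz).imp id
        mem_sphere_zero_iff_norm.2
  let φ : C(Circle, ℂ) →⋆ₙₐ[ℂ] D :=
    { toFun := fun f => cfcₙ (circleExtend f) v
      map_smul' := fun c f => by
        rw [map_smul]
        exact cfcₙ_smul c _ v (continuousOn f) (circleExtend_zero f)
      map_zero' := by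
        rw [map_zero]
        exact cfcₙ_zero ℂ v
      map_add' := fun f g => by
        rw [map_add]
        exact cfcₙ_add _ _ (hf := continuousOn f) (hf0 := circleExtend_zero f)
          (hg := continuousOn g) (hg0 := circleExtend_zero g)
      map_mul' := fun f g => by
        rw [map_mul]
        exact cfcₙ_mul _ _ v (continuousOn f) (circleExtend_zero f) (continuousOn g)
          (circleExtend_zero g)
      map_star' := fun f => by
        rw [map_star]
        exact cfcₙ_star _ v }
  refine ⟨φ, (cfcₙ_congr fun z hz => ?_).trans (cfcₙ_id' ℂ v)⟩
  rcases eq_zero_or_norm_eq_one_of_mem_quasispectrum h_isometry h_normal hz with rfl | h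
  · exact circleExtend_zero _
  · exact circleExtend_coe circleCoord ⟨z, mem_sphere_zero_iff_norm.2 h⟩

end Circle

section Convolution

variable {B : Type} [CStarAlgebra B] [FiniteDimensional ℂ B] (Q : FiniteQuantumSpace B)
  {D D' : Type} [NonUnitalCStarAlgebra D] [NonUnitalCStarAlgebra D']

/-- The convolution product `μ (f ⊗ g) m^*` of linear maps on a finite quantum space. -/
def FiniteQuantumSpace.convolution (f g : B →ₗ[ℂ] D) : B →ₗ[ℂ] D :=
  LinearMap.mul' ℂ D ∘ₗ TensorProduct.map f g ∘ₗ Q.comul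

theorem FiniteQuantumSpace.comp_convolution (π : D →⋆ₙₐ[ℂ] D') (f g : B →ₗ[ℂ] D) :
    (π : D →ₗ[ℂ] D') ∘ₗ Q.convolution f g =
      Q.convolution ((π : D →ₗ[ℂ] D') ∘ₗ f) ((π : D →ₗ[ℂ] D') ∘ₗ g) := by
  have comp_mul' : (π : D →ₗ[ℂ] D') ∘ₗ LinearMap.mul' ℂ D =
      LinearMap.mul' ℂ D' ∘ₗ TensorProduct.map (π : D →ₗ[ℂ] D') (π : D →ₗ[ℂ] D') :=
    TensorProduct.ext' fun x y => map_mul π x y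
  simp only [convolution, TensorProduct.map_comp, ← LinearMap.comp_assoc, comp_mul']

omit [FiniteDimensional ℂ B] in
theorem comp_starConj (π : D →⋆ₙₐ[ℂ] D') (s : B →ₗ[ℂ] D) :
    (π : D →ₗ[ℂ] D') ∘ₗ s.starConj = ((π : D →ₗ[ℂ] D') ∘ₗ s).starConj :=
  LinearMap.ext fun b => map_star π (s (star b))

variable {Q}

theorem QuantumGraph.isCuntzKriegerFamily_iff (𝒢 : QuantumGraph Q) (s : B →ₗ[ℂ] D) :
    𝒢.IsCuntzKriegerFamily s ↔ Q.convolution s (Q.convolution s.starConj s) = s ∧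
      Q.convolution s.starConj s = Q.convolution s s.starConj ∘ₗ 𝒢.adj := by
  have map_convolution : TensorProduct.map s (Q.convolution s.starConj s) =
      TensorProduct.map LinearMap.id (LinearMap.mul' ℂ D) ∘ₗ
        TensorProduct.map s (TensorProduct.map s.starConj s) ∘ₗ
          TensorProduct.map LinearMap.id Q.comul := by
    simp only [FiniteQuantumSpace.convolution, ← TensorProduct.map_comp, LinearMap.id_comp,
      LinearMap.comp_id]
  rw [FiniteQuantumSpace.convolution, map_convolution]
  exact ⟨fun h => ⟨h.isometry, h.adjacency⟩, fun h => ⟨h.1, h.2⟩⟩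

end Convolution

namespace QuantumGraph

open UniversalCStarAlgebra

variable {B : Type} [CStarAlgebra B] [FiniteDimensional ℂ B] {Q : FiniteQuantumSpace B}
  (𝒢 : QuantumGraph Q) [𝒢.relation.IsBounded]

/-- The quantum Cuntz-Krieger family generating the quantum Cuntz-Krieger algebra. -/
def universalFamily : B →ₗ[ℂ] 𝒢.FO where
  toFun b := gen 𝒢.relation b
  map_add' a b := eq_of_forall_hom_eq fun D _ π ⟨S, hS, _⟩ => by simp only [map_add, hS]
  map_smul' c a := eq_of_forall_hom_eq fun D _ π ⟨S, hS, _⟩ => by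
    simp only [map_smul, hS, RingHom.id_apply]

theorem exists_lift {D : Type} [NonUnitalCStarAlgebra D] {S : B →ₗ[ℂ] D}
    (hS : 𝒢.IsCuntzKriegerFamily S) : ∃ π : 𝒢.FO →⋆ₙₐ[ℂ] D, ∀ b, π (𝒢.universalFamily b) = S b :=
  ⟨lift S ⟨S, fun _ => rfl, hS⟩, lift_gen _ _⟩

theorem action_universalFamily {G : Type} [Group G] {θ : G → B →ₗ[ℂ] B}
    (hθ : ∀ g, 𝒢.IsSymmetry (θ g)) (θ_one : ∀ b, θ 1 b = b)
    (θ_mul : ∀ g h b, θ (g * h) b = θ g (θ h b)) (g : G) (b : B) :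
    𝒢.action θ hθ θ_one θ_mul g (𝒢.universalFamily b) = 𝒢.universalFamily (θ g b) :=
  action_gen _ _ _ _ _ _

theorem isCuntzKriegerFamily_universalFamily : 𝒢.IsCuntzKriegerFamily 𝒢.universalFamily := by
  have eq_of_comp_eq {f g : B →ₗ[ℂ] 𝒢.FO}
      (h : ∀ (D : Type) [NonUnitalCStarAlgebra D] (π : 𝒢.FO →⋆ₙₐ[ℂ] D),
        𝒢.IsCuntzKriegerFamily ((π : 𝒢.FO →ₗ[ℂ] D) ∘ₗ 𝒢.universalFamily) →
          (π : 𝒢.FO →ₗ[ℂ] D) ∘ₗ f = (π : 𝒢.FO →ₗ[ℂ] D) ∘ₗ g) : f = g := by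
    refine LinearMap.ext fun b => eq_of_forall_hom_eq fun D _ π ⟨S, hS, hCK⟩ => ?_
    rw [← show (π : 𝒢.FO →ₗ[ℂ] D) ∘ₗ 𝒢.universalFamily = S from LinearMap.ext hS] at hCK
    exact LinearMap.congr_fun (h D π hCK) b
  refine (𝒢.isCuntzKriegerFamily_iff _).2
    ⟨eq_of_comp_eq fun D _ π hπ => ?_, eq_of_comp_eq fun D _ π hπ => ?_⟩
  · simp only [Q.comp_convolution, comp_starConj, ((𝒢.isCuntzKriegerFamily_iff _).1 hπ).1]
  · simp only [← LinearMap.comp_assoc, Q.comp_convolution, comp_starConj,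
      ((𝒢.isCuntzKriegerFamily_iff _).1 hπ).2]

end QuantumGraph

section GeneratorMatrix

open QuantumGraph

variable {N : ℕ} [NeZero N] {D : Type} [NonUnitalCStarAlgebra D]

theorem matComul_smul_matUnit (i j : ZMod N) : matComul N ((N : ℂ) • matUnit N i j) =
    ∑ k, ((N : ℂ) • matUnit N i k) ⊗ₜ[ℂ] ((N : ℂ) • matUnit N k j) := by
  rw [map_smul, matComul_matUnit]
  simp only [TensorProduct.smul_tmul_smul, ← Finset.smul_sum, smul_smul]

theorem inv_smul_sum_smul_matUnit (b : MatN N) :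
    (N : ℂ)⁻¹ • ∑ i, ∑ j, b i j • (N : ℂ) • matUnit N i j = b := by
  have hN : (N : ℂ) ≠ 0 := NeZero.ne _
  simp only [smul_comm _ (N : ℂ), ← Finset.smul_sum, sum_matUnit, smul_inv_smul₀ hN]

/-- Linear maps `s` on `M_N(ℂ)` correspond to matrices, with entries `s (N e_ij)`. -/
def generatorMatrix : (MatN N →ₗ[ℂ] D) ≃ CStarMatrix (ZMod N) (ZMod N) D where
  toFun s := CStarMatrix.ofMatrix fun i j => s ((N : ℂ) • matUnit N i j)
  invFun m :=
    { toFun := fun b => (N : ℂ)⁻¹ • ∑ i, ∑ j, b i j • m i j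
      map_add' := fun a b => by
        simp only [CStarMatrix.add_apply, add_smul, Finset.sum_add_distrib, smul_add]
      map_smul' := fun c a => by
        simp only [CStarMatrix.smul_apply, smul_eq_mul, mul_smul, ← Finset.smul_sum,
          RingHom.id_apply]
        rw [smul_comm] }
  left_inv s := LinearMap.ext fun b => by
    conv_rhs => rw [← inv_smul_sum_smul_matUnit b]
    simp only [map_smul s (N : ℂ)⁻¹, map_sum, map_smul s (b _ _)]
    rfl
  right_inv m := CStarMatrix.ext fun i j => by
    change (N : ℂ)⁻¹ • ∑ k, ∑ l, ((N : ℂ) • matUnit N i j) k l • m k l = m i j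
    simp only [CStarMatrix.smul_apply, matUnit_apply, smul_eq_mul, mul_ite, mul_one, mul_zero,
      ite_smul, zero_smul, ite_and, Finset.sum_ite_irrel, Finset.sum_const_zero, Finset.sum_ite_eq,
      Finset.mem_univ, if_true, inv_smul_smul₀ (NeZero.ne (N : ℂ))]

theorem generatorMatrix_apply (s : MatN N →ₗ[ℂ] D) (i j : ZMod N) :
    generatorMatrix s i j = s ((N : ℂ) • matUnit N i j) := rfl

theorem generatorMatrix_convolution (f g : MatN N →ₗ[ℂ] D) :
    generatorMatrix ((matSpace N).convolution f g) = generatorMatrix f * generatorMatrix g := by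
  refine CStarMatrix.ext fun i j => ?_
  change LinearMap.mul' ℂ D (TensorProduct.map f g (matComul N ((N : ℂ) • matUnit N i j))) = _
  simp only [matComul_smul_matUnit, map_sum, TensorProduct.map_tmul, LinearMap.mul'_apply,
    CStarMatrix.mul_apply, generatorMatrix_apply]

theorem generatorMatrix_starConj (s : MatN N →ₗ[ℂ] D) :
    generatorMatrix s.starConj = star (generatorMatrix s) := by
  refine CStarMatrix.ext fun i j => ?_
  change star (s (star _)) = star (s _)
  rw [star_smul, star_matUnit, Complex.star_def, Complex.conj_natCast]

theorem normTrace_smul_matUnit (i j : ZMod N) :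
    normTrace N ((N : ℂ) • matUnit N i j) = if i = j then 1 else 0 := by
  change (N : ℂ)⁻¹ * ∑ k, (N : ℂ) * matUnit N i j k k = _
  simp only [← Finset.mul_sum, inv_mul_cancel_left₀ (NeZero.ne (N : ℂ)), matUnit_apply, ite_and,
    Finset.sum_ite_eq, Finset.mem_univ, if_true, eq_comm]

theorem sum_matUnit_self : ∑ k, matUnit N k k = 1 := by
  rw [← sum_matUnit (1 : MatN N)]
  simp only [CStarMatrix.one_apply, ite_smul, one_smul, zero_smul, Finset.sum_ite_eq,
    Finset.mem_univ, if_true]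

theorem generatorMatrix_comp_complete_adj (f : MatN N →ₗ[ℂ] D) :
    generatorMatrix (f ∘ₗ (complete (matSpace N)).adj) =
      diagonalHom ((N : ℂ) • ∑ k, generatorMatrix f k k) := by
  refine CStarMatrix.ext fun i j => ?_
  change f (((N : ℝ) : ℂ) ^ 2 • normTrace N ((N : ℂ) • matUnit N i j) • (1 : MatN N)) = _
  rw [normTrace_smul_matUnit]
  simp only [diagonalHom_apply, generatorMatrix_apply, map_smul,
    ← sum_matUnit_self, map_sum, ← Finset.smul_sum, smul_smul, ite_smul, one_smul, zero_smul,
    smul_ite, smul_zero, apply_ite f, map_zero, sq, Complex.ofReal_natCast]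

theorem isCuntzKriegerFamily_trivial_iff (s : MatN N →ₗ[ℂ] D) :
    (QuantumGraph.trivial (matSpace N)).IsCuntzKriegerFamily s ↔
      generatorMatrix s * (star (generatorMatrix s) * generatorMatrix s) = generatorMatrix s ∧
      star (generatorMatrix s) * generatorMatrix s =
        generatorMatrix s * star (generatorMatrix s) := by
  simp only [isCuntzKriegerFamily_iff, ← generatorMatrix_starConj, ← generatorMatrix_convolution,
    generatorMatrix.injective.eq_iff]
  rfl

theorem isCuntzKriegerFamily_complete_iff (s : MatN N →ₗ[ℂ] D) :
    (complete (matSpace N)).IsCuntzKriegerFamily s ↔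
      generatorMatrix s * (star (generatorMatrix s) * generatorMatrix s) = generatorMatrix s ∧
      star (generatorMatrix s) * generatorMatrix s = diagonalHom
        ((N : ℂ) • ∑ k, (generatorMatrix s * star (generatorMatrix s)) k k) := by
  simp only [isCuntzKriegerFamily_iff, ← generatorMatrix_starConj, ← generatorMatrix_convolution,
    ← generatorMatrix_comp_complete_adj, generatorMatrix.injective.eq_iff]

section UniversalMatrix

variable (𝒢 : QuantumGraph (matSpace N))

/-- The matrix of standard generators `S_kl = S(N e_kl)` of a quantum Cuntz-Krieger algebra. -/
def universalMatrix : CStarMatrix (ZMod N) (ZMod N) 𝒢.FO := generatorMatrix 𝒢.universalFamily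

theorem dense_adjoin_range_universalMatrix : Dense (NonUnitalStarAlgebra.adjoin ℂ
    (Set.range fun p : ZMod N × ZMod N => universalMatrix 𝒢 p.1 p.2) : Set 𝒢.FO) := by
  let S := (NonUnitalStarAlgebra.adjoin ℂ
    (Set.range fun p : ZMod N × ZMod N => universalMatrix 𝒢 p.1 p.2)).topologicalClosure
  have universalMatrix_mem (i j : ZMod N) : 𝒢.universalFamily ((N : ℂ) • matUnit N i j) ∈ S :=
    subset_closure (NonUnitalStarAlgebra.subset_adjoin ℂ _ ⟨(i, j), rfl⟩)
  refine fun y => mem_of_dense_adjoin UniversalCStarAlgebra.dense_adjoin_range_gen (S := S)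
    (NonUnitalStarSubalgebra.isClosed_topologicalClosure _) (Set.range_subset_iff.2 fun b => ?_) y
  change 𝒢.universalFamily b ∈ S
  rw [← inv_smul_sum_smul_matUnit b]
  simp only [map_smul _ (N : ℂ)⁻¹, map_sum, map_smul _ (b _ _)]
  exact S.smul_mem _ (S.sum_mem fun i _ => S.sum_mem fun j _ =>
    S.smul_mem _ (universalMatrix_mem i j))

theorem exists_starHom_universalMatrix_eq {m : CStarMatrix (ZMod N) (ZMod N) D}
    (hm : 𝒢.IsCuntzKriegerFamily (generatorMatrix.symm m)) :
    ∃ π : 𝒢.FO →⋆ₙₐ[ℂ] D, ∀ k l, π (universalMatrix 𝒢 k l) = m k l := by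
  obtain ⟨π, hπ⟩ := 𝒢.exists_lift hm
  refine ⟨π, fun k l => (hπ _).trans ?_⟩
  rw [← generatorMatrix_apply, Equiv.apply_symm_apply]

theorem phase_action_universalMatrix (hθ : ∀ g, 𝒢.IsSymmetry (phase N g))
    (g : Multiplicative (ZMod N)) (k l : ZMod N) :
    𝒢.action (phase N) hθ phase_one phase_mul g (universalMatrix 𝒢 k l) =
      (ZMod.stdAddChar (g.toAdd * (k - l)) : ℂ) • universalMatrix 𝒢 k l := by
  refine (𝒢.action_universalFamily hθ phase_one phase_mul g _).trans ?_
  rw [map_smul, phase_matUnit, smul_comm, map_smul]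
  rfl

theorem shift_action_universalMatrix (hθ : ∀ g, 𝒢.IsSymmetry (shift N g))
    (g : Multiplicative (ZMod N)) (k l : ZMod N) :
    𝒢.action (shift N) hθ shift_one shift_mul g (universalMatrix 𝒢 k l) =
      universalMatrix 𝒢 (k - g.toAdd) (l - g.toAdd) := by
  refine (𝒢.action_universalFamily hθ shift_one shift_mul g _).trans ?_
  rw [map_smul, shift_matUnit]
  rfl

end UniversalMatrix

end GeneratorMatrix

section PermutationActions

open UniversalCStarAlgebra

variable {ι G : Type} [Group G]

theorem cuntzAction_gen [Fintype ι] (σ : G →* Equiv.Perm ι) (g : G) (i : ι) :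
    cuntzAction σ g (gen (cuntzRelation ι) i) = gen (cuntzRelation ι) (σ g i) :=
  action_gen _ _ _ _ _ _

theorem freeProductAction_incl {A : Type} [NonUnitalCStarAlgebra A] (σ : G →* Equiv.Perm ι)
    (g : G) (i : ι) (a : A) : freeProductAction σ g (FreeProduct.incl (fun _ : ι => A) i a) =
      FreeProduct.incl (fun _ : ι => A) (σ g i) a :=
  action_gen _ _ _ _ _ _

end PermutationActions

/-- The canonical unitary generators of the free product of copies of `C(S¹)`. -/
def FreeProduct.circleGen {ι : Type} (i : ι) : FreeProduct fun _ : ι => C(Circle, ℂ) :=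
  incl (fun _ => C(Circle, ℂ)) i circleCoord

theorem exists_freeProduct_starHom {N : ℕ} [NeZero N] {ι : Type} (U : ι → unitary (MatN N)) :
    ∃ ρ : FreeProduct (fun _ : ι => C(Circle, ℂ)) →⋆ₙₐ[ℂ] CStarMatrix (ZMod N) (ZMod N)
      (FOTrivial N), ∀ x, ρ (FreeProduct.circleGen x) = scalarConj (U x) (universalMatrix _) := by
  obtain ⟨h_isometry, h_adjacency⟩ := (isCuntzKriegerFamily_trivial_iff _).1
    (QuantumGraph.trivial (matSpace N)).isCuntzKriegerFamily_universalFamily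
  have exists_factor (x : ι) : ∃ φ : C(Circle, ℂ) →⋆ₙₐ[ℂ] CStarMatrix (ZMod N) (ZMod N)
      (FOTrivial N), φ circleCoord = scalarConj (U x) (universalMatrix _) :=
    exists_starHom_circleCoord_eq
      (by rw [mul_assoc, ← map_star, ← map_mul, ← map_mul]; exact congrArg _ h_isometry)
      (by rw [← map_star, ← map_mul, ← map_mul]; exact congrArg _ h_adjacency)
  choose φ hφ using exists_factor
  obtain ⟨ρ, hρ⟩ := FreeProduct.exists_lift _ φ
  exact ⟨ρ, fun x => (hρ x _).trans (hφ x)⟩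

namespace IsUnitaryErrorBasis

open UniversalCStarAlgebra

variable {N : ℕ} [NeZero N] {ι : Type} [Fintype ι] [DecidableEq ι] {U : ι → unitary (MatN N)}
  (hU : IsUnitaryErrorBasis U)

include hU in
theorem exists_cuntz_starHom : ∃ ρ : CuntzAlgebra ι →⋆ₙₐ[ℂ] CStarMatrix (ZMod N) (ZMod N)
    (FOComplete N), ∀ x, ρ (gen (cuntzRelation ι) x) = scalarConj (U x) (universalMatrix _) := by
  obtain ⟨h_isometry, h_adjacency⟩ := (isCuntzKriegerFamily_complete_iff _).1
    (QuantumGraph.complete (matSpace N)).isCuntzKriegerFamily_universalFamily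
  exact ⟨lift _ (cuntzRelation_scalarConj hU h_isometry (by rw [ZMod.card]; exact h_adjacency)),
    lift_gen _ _⟩

theorem exists_foComplete_starHom :
    ∃ σ : FOComplete N →⋆ₙₐ[ℂ] CStarMatrix (ZMod N) (ZMod N) (CuntzAlgebra ι),
      ∀ k l, σ (universalMatrix _ k l) = hU.bellHom (gen (cuntzRelation ι)) k l := by
  obtain ⟨e, he, sum_eq⟩ := cuntzRelation_gen ι
  refine exists_starHom_universalMatrix_eq _ ((isCuntzKriegerFamily_complete_iff _).2 ?_)
  rw [Equiv.apply_symm_apply]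
  have star_mul_self : star (gen (cuntzRelation ι)) * gen (cuntzRelation ι) = fun _ => e :=
    funext fun x => (he x).2.2
  have mul_unit : gen (cuntzRelation ι) * (fun _ => e) = gen (cuntzRelation ι) :=
    funext fun x => (he x).2.1
  have sum_diagonal := hU.smul_sum_bellHom (gen (cuntzRelation ι) * star (gen (cuntzRelation ι)))
  rw [ZMod.card] at sum_diagonal
  rw [← map_star, ← map_mul hU.bellHom, ← map_mul hU.bellHom, ← map_mul hU.bellHom, star_mul_self,
    mul_unit, sum_diagonal, bellHom_const]
  exact ⟨rfl, congrArg _ (congrArg _ sum_eq.symm)⟩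

theorem exists_foTrivial_starHom : ∃ σ : FOTrivial N →⋆ₙₐ[ℂ] CStarMatrix (ZMod N) (ZMod N)
    (FreeProduct fun _ : ι => C(Circle, ℂ)),
      ∀ k l, σ (universalMatrix _ k l) = hU.bellHom FreeProduct.circleGen k l := by
  let T : ι → FreeProduct fun _ : ι => C(Circle, ℂ) := FreeProduct.circleGen
  refine exists_starHom_universalMatrix_eq _ ((isCuntzKriegerFamily_trivial_iff _).2 ?_)
  rw [Equiv.apply_symm_apply]
  have isometry : T * (star T * T) = T := funext fun x => by
    simp only [T, Pi.mul_apply, Pi.star_apply, FreeProduct.circleGen, ← map_star, ← map_mul,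
      star_circleCoord_mul, mul_one]
  have normal : star T * T = T * star T := funext fun x => by
    simp only [T, Pi.mul_apply, Pi.star_apply, FreeProduct.circleGen, ← map_star, ← map_mul,
      mul_comm]
  rw [← map_star, ← map_mul hU.bellHom, ← map_mul hU.bellHom, ← map_mul hU.bellHom]
  exact ⟨congrArg _ isometry, congrArg _ normal⟩

end IsUnitaryErrorBasis

section PauliDuality

variable {N : ℕ} [NeZero N] {A B : Type} [NonUnitalCStarAlgebra A] [NonUnitalCStarAlgebra B]
  {T : ZMod N × ZMod N → A} {V : CStarMatrix (ZMod N) (ZMod N) B}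
  {ρ : A →⋆ₙₐ[ℂ] CStarMatrix (ZMod N) (ZMod N) B} {σ : B →⋆ₙₐ[ℂ] CStarMatrix (ZMod N) (ZMod N) A}

theorem IsBellDual.nonempty_matrix_equiv_of_translates (h : IsBellDual ρ σ)
    (hT : Dense (NonUnitalStarAlgebra.adjoin ℂ (Set.range T) : Set A))
    (hρ : ∀ p, ρ (T p) = scalarConj (pauli p) V)
    {β₁ β₂ : Multiplicative (ZMod N) →* (A →⋆ₙₐ[ℂ] A)} (hβ : ∀ g h a, β₁ g (β₂ h a) = β₂ h (β₁ g a))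
    (hβ₁ : ∀ g k l, β₁ g (T (k, l)) = T (k - g.toAdd, l))
    (hβ₂ : ∀ g k l, β₂ g (T (k, l)) = T (k, l - g.toAdd)) :
    Nonempty (CStarMatrix (ZMod N) (ZMod N) B ≃⋆ₐ[ℂ] DoubleCrossedProduct β₁ β₂ hβ) := by
  have clock_covariant (g) : ρ.comp (β₁ g) = (scalarConj (clock g)).comp ρ :=
    starHom_ext_of_dense_adjoin hT <| Set.eqOn_range.2 <| funext fun p => by
      change ρ (β₁ g (T p)) = scalarConj (clock g) (ρ (T p))
      rw [hβ₁, hρ, hρ, scalarConj_clock_pauli]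
  have translation_covariant (g) : ρ.comp (β₂ g) = (scalarConj (translation g)).comp ρ :=
    starHom_ext_of_dense_adjoin hT <| Set.eqOn_range.2 <| funext fun p => by
      change ρ (β₂ g (T p)) = scalarConj (translation g) (ρ (T p))
      rw [hβ₂, hρ, hρ, scalarConj_translation_pauli]
  exact h.nonempty_matrix_equiv hβ (fun g => DFunLike.congr_fun (clock_covariant g))
    (fun g => DFunLike.congr_fun (translation_covariant g))

theorem IsBellDual.nonempty_matrix_equiv_of_phase_shift (h : IsBellDual ρ σ)
    (hV : Dense (NonUnitalStarAlgebra.adjoin ℂ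
      (Set.range fun p : ZMod N × ZMod N => V p.1 p.2) : Set B))
    (hσ : ∀ k l, σ (V k l) = isUnitaryErrorBasis_pauli.bellHom T k l)
    {α₁ α₂ : Multiplicative (ZMod N) →* (B →⋆ₙₐ[ℂ] B)} (hα : ∀ g h b, α₁ g (α₂ h b) = α₂ h (α₁ g b))
    (hα₁ : ∀ g k l, α₁ g (V k l) = (ZMod.stdAddChar (g.toAdd * (k - l)) : ℂ) • V k l)
    (hα₂ : ∀ g k l, α₂ g (V k l) = V (k - g.toAdd) (l - g.toAdd)) :
    Nonempty (CStarMatrix (ZMod N) (ZMod N) A ≃⋆ₐ[ℂ] DoubleCrossedProduct α₁ α₂ hα) := by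
  have clock_covariant (g) : σ.comp (α₁ g) = (scalarConj (clock g)).comp σ :=
    starHom_ext_of_dense_adjoin hV <| Set.eqOn_range.2 <| funext fun p => by
      change σ (α₁ g (V p.1 p.2)) = scalarConj (clock g) (σ (V p.1 p.2))
      rw [hα₁, map_smul, hσ, scalarConj_clock_bellHom_pauli]
  have translation_covariant (g) : σ.comp (α₂ g) = (scalarConj (translation g)).comp σ :=
    starHom_ext_of_dense_adjoin hV <| Set.eqOn_range.2 <| funext fun p => by
      change σ (α₂ g (V p.1 p.2)) = scalarConj (translation g) (σ (V p.1 p.2))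
      rw [hα₂, hσ, hσ, scalarConj_translation_bellHom_pauli]
  exact h.symm.nonempty_matrix_equiv hα (fun g => DFunLike.congr_fun (clock_covariant g))
    (fun g => DFunLike.congr_fun (translation_covariant g))

end PauliDuality

end

theorem mainTheorem5 (N : ℕ) [NeZero N] :
    Nonempty (CStarMatrix (ZMod N) (ZMod N) (FOComplete N) ≃⋆ₐ[ℂ]
      DoubleCrossedProduct (betaOneCuntz N) (betaTwoCuntz N) (betaCuntz_comm N)) ∧
    Nonempty (CStarMatrix (ZMod N) (ZMod N) (CuntzSq N) ≃⋆ₐ[ℂ]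
      DoubleCrossedProduct (alphaOneComplete N) (alphaTwoComplete N) (alphaComplete_comm N)) ∧
    Nonempty (CStarMatrix (ZMod N) (ZMod N) (FOTrivial N) ≃⋆ₐ[ℂ]
      DoubleCrossedProduct (betaOneFree N) (betaTwoFree N) (betaFree_comm N)) ∧
    Nonempty (CStarMatrix (ZMod N) (ZMod N) (FreeCircleSq N) ≃⋆ₐ[ℂ]
      DoubleCrossedProduct (alphaOneTrivial N) (alphaTwoTrivial N) (alphaTrivial_comm N)) := by
  obtain ⟨ρ, hρ⟩ := (isUnitaryErrorBasis_pauli (N := N)).exists_cuntz_starHom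
  obtain ⟨σ, hσ⟩ := (isUnitaryErrorBasis_pauli (N := N)).exists_foComplete_starHom
  obtain ⟨ρ', hρ'⟩ := exists_freeProduct_starHom (pauli (N := N))
  obtain ⟨σ', hσ'⟩ := (isUnitaryErrorBasis_pauli (N := N)).exists_foTrivial_starHom
  have hT := UniversalCStarAlgebra.dense_adjoin_range_gen (R := cuntzRelation (ZMod N × ZMod N))
  have hT' := FreeProduct.dense_adjoin_range_incl (fun _ : ZMod N × ZMod N => C(Circle, ℂ))
    fun _ => dense_adjoin_circleCoord
  have hV := dense_adjoin_range_universalMatrix (QuantumGraph.complete (matSpace N))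
  have hV' := dense_adjoin_range_universalMatrix (QuantumGraph.trivial (matSpace N))
  have bellDual := isUnitaryErrorBasis_pauli.isBellDual hT hV hρ hσ
  have bellDual' := isUnitaryErrorBasis_pauli.isBellDual hT' hV' hρ' hσ'
  refine ⟨?_, ?_, ?_, ?_⟩
  · exact bellDual.nonempty_matrix_equiv_of_translates hT hρ _
      (fun g k l => cuntzAction_gen _ g (k, l)) (fun g k l => cuntzAction_gen _ g (k, l))
  · exact bellDual.nonempty_matrix_equiv_of_phase_shift hV hσ _
      (phase_action_universalMatrix _ _) (shift_action_universalMatrix _ _)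
  · exact bellDual'.nonempty_matrix_equiv_of_translates hT' hρ' _
      (fun g k l => freeProductAction_incl _ g (k, l) _)
      (fun g k l => freeProductAction_incl _ g (k, l) _)
  · exact bellDual'.nonempty_matrix_equiv_of_phase_shift hV' hσ' _
      (phase_action_universalMatrix _ _) (shift_action_universalMatrix _ _)
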